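/- **Setting.** Let $\Psi:\mathbb R\to[0,1]$ be differentiable with $\Psi'\le 0$ Riemann integrable, $\Psi\in L^1(0,\infty)$ and $1-\Psi\in L^1(-\infty,0)$, and put $\Phi=-\Psi'$. Let $\alpha\in(0,1)$ and $\tau,\nu,\beta,\epsilon>0$. For $N>0$ let $\Gamma=\Gamma_N>0$, let $\eta=\eta_N:\mathbb Z\to\mathbb R$ be non-decreasing, and let $\xi_k=\xi_{N,k}\in(0,1)$ be such that $\frac1{\tau N^\alpha}\Phi\big(\frac{k+\xi_k}{\tau N^\alpha}\big)=\Psi\big(\frac{k}{\tau N^\alpha}\big)-\Psi\big(\frac{k+1}{\tau N^\alpha}\big)$ for all $k\in\mathbb Z$ (mean value theorem). Define the kernel $$L^N_{\Psi,\eta}(x,y)=\frac1{\tau N^\alpha}\sum_{k\in\mathbb Z,\ |k|\le\Gamma N^\alpha}\Phi\Big(\frac{k+\xi_k}{\tau N^\alpha}\Big)\frac{\sin[2\pi\eta(k)(x-y)]}{\pi(x-y)},$$ where the quotient is read as $2\eta(k)$ for $x=y$. Assume that, as $N\to\infty$, $\Gamma_N/N^\nu\to0$, $$\eta_N(k)=N^\nu+\beta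 kN^{-\alpha}+O(N^{-\epsilon})\quad\text{uniformly in }|k|\le\Gamma_N N^\alpha,$$ $$N^\nu\max\Big\{\Psi\Big(\frac{\Gamma_N}{\tau}\Big),\ 1-\Psi\Big(-\frac{\lfloor\Gamma_NN^\alpha\rfloor}{\tau N^\alpha}\Big)\Big\}\longrightarrow0 .$$ Let $f\in H^1_0(\mathbb R)$, i.e. $f$ is a real, continuous, compactly supported function with $\int|\hat f(u)|^2|u|^2du<\infty$, where $\hat f(u)=\int f(x)e^{-2\pi ixu}dx$. **Notation.** A composition of $n$ is a tuple ${\bf m}=(m_1,\dots,m_\ell)$ of positive integers with $|{\bf m}|=m_1+\dots+m_\ell=n$; its length is $\ell=\ell({\bf m})$. Put $\binom n{\bf m}=\frac{n!}{m_1!\cdots m_\ell!}$, $\mathrm M({\bf m})=\frac{(-1)^{\ell+1}}{\ell}\binom n{\bf m}$, $\overline m_i=m_1+\dots+m_i$ and $\Lambda^{\bf m}_{is}(u)=\sum_{j\le\overline m_i}u_j-\sum_{j\le\overline m_s}u_j$. For a permutation $\sigma\in\mathbb S(n)$ let $\underline s\le\ell$ be the index with $\sigma(\underline s)=\min_{j\le\ell}\sigma(j)$,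 and for $t>0$ put $$\mathrm G^{\bf m}_{t}(u,x)=\sum_{\sigma\in\mathbb S(n)}\max_{i\le\ell}\big\{\Lambda^{\bf m}_{i\underline s}(u)-t\,(x_{\sigma(i)}-x_{\sigma(\underline s)})\big\}.$$ Further, for $n\ge2$, $$\mathrm B^n_\Psi=\sum_{k=0}^{n-1}b^n_k\int_{\mathbb R}x\Phi(x)\Psi(x)^k(1-\Psi(x))^{n-1-k}dx,\qquad b^n_k=\sum_{l=1}^{k+1}(-1)^{l+1}\binom{n-l}{k+1-l}\sum_{|{\bf m}|=n,\ \ell({\bf m})=l}\binom n{\bf m}.$$ Let $\mathbb R^n_<=\{x\in\mathbb R^n: x_1<\dots<x_n\}$ and $\mathbb R^n_0=\{u\in\mathbb R^n: u_1+\dots+u_n=0\}$, the latter with Lebesgue measure $d^{n-1}u=du_1\cdots du_{n-1}$. For a kernel $K$ let $$C^n_K[\Xi f]=\sum_{|{\bf m}|=n}\mathrm M({\bf m})\int_{\mathbb R^\ell}\prod_{i=1}^{\ell}f(x_i)^{m_i}K(x_i,x_{i+1})\,dx\qquad(x_{\ell+1}=x_1).$$ **Theorem.** For every $n\ge2$ the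 integrals below (and those in $\mathrm B^n_\Psi$) converge absolutely, and $$\lim_{N\to\infty}C^n_{L^N_{\Psi,\eta}}[\Xi f]=2\beta\tau\,\mathrm B^n_\Psi\int_{\mathbb R}f(t)^n\,dt-2\iint_{\mathbb R^n_0\times\mathbb R^n_<}\Re\Big\{\prod_{i=1}^n\hat f(u_i)\Phi(x_i)\Big\}\sum_{|{\bf m}|=n}\mathrm M({\bf m})\,\mathrm G^{\bf m}_{\beta\tau}(u,x)\,d^{n-1}u\,d^nx .$$ Moreover, if for all large $N$ a determinantal point process $(X_i)$ on $\mathbb R$ with correlation kernel $L^N_{\Psi,\eta}$ (with respect to Lebesgue measure) is given, then for all large $N$ the linear statistic $\Xi f=\sum_if(X_i)$ has finite exponential moments of all orders, and its $n$-th cumulant, i.e. the coefficient of $t^n/n!$ in the expansion of $\log\mathbb E[e^{t\,\Xi f}]$ at $t=0$, converges to the same limit. -/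

import Mathlib

open MeasureTheory ProbabilityTheory Filter Topology
open scoped FourierTransform Nat

/-- The class of shapes: differentiable, non-increasing functions `Ψ : ℝ → [0,1]` whose derivative
is Riemann integrable, with `Ψ ∈ L¹(0,∞)` and `1 - Ψ ∈ L¹(-∞,0)`.  (Since `Ψ' ≤ 0` and `Ψ` is
bounded, the improper integral of `Ψ'` over `ℝ` converges as soon as `Ψ'` is Riemann integrable
on bounded intervals.) -/
structure IsShape (Ψ : ℝ → ℝ) : Prop where
  mem_Icc : ∀ t, Ψ t ∈ Set.Icc (0 : ℝ) 1
  differentiable : Differentiable ℝ Ψ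
  deriv_nonpos : ∀ t, deriv Ψ t ≤ 0
  riemann : ∀ I : BoxIntegral.Box (Fin 1),
    BoxIntegral.Integrable I BoxIntegral.IntegrationParams.Riemann
      (fun x : Fin 1 → ℝ => deriv Ψ (x 0)) BoxIntegral.BoxAdditiveMap.volume
  integrable_pos : IntegrableOn Ψ (Set.Ioi 0)
  integrable_neg : IntegrableOn (fun t => 1 - Ψ t) (Set.Iio 0)

/-- The density `Φ = -Ψ'` of a shape. -/
noncomputable def shapeDensity (Ψ : ℝ → ℝ) (t : ℝ) : ℝ := -deriv Ψ t

/-- The numbers `ξ_k ∈ (0,1)` given by the mean value theorem: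
`(τ N^α)⁻¹ Φ((k + ξ_k)/(τ N^α)) = Ψ(k/(τ N^α)) - Ψ((k+1)/(τ N^α))`. -/
def IsMeanValueChoice (Ψ : ℝ → ℝ) (α τ N : ℝ) (ξ : ℤ → ℝ) : Prop :=
  ∀ k : ℤ, ξ k ∈ Set.Ioo (0 : ℝ) 1 ∧
    1 / (τ * N ^ α) * shapeDensity Ψ ((k + ξ k) / (τ * N ^ α)) =
      Ψ (k / (τ * N ^ α)) - Ψ ((k + 1) / (τ * N ^ α))

/-- The kernel `sin(2π a t) / (π t)`, with its continuous value `2 a` at `t = 0`. -/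
noncomputable def sineKernel (a t : ℝ) : ℝ := 2 * a * Real.sinc (2 * Real.pi * a * t)

theorem sineKernel_zero (a : ℝ) : sineKernel a 0 = 2 * a := by
  simp [sineKernel]

theorem sineKernel_of_ne_zero (a : ℝ) {t : ℝ} (ht : t ≠ 0) :
    sineKernel a t = Real.sin (2 * Real.pi * a * t) / (Real.pi * t) := by
  rcases eq_or_ne a 0 with rfl | ha
  · simp [sineKernel]
  · have hp := Real.pi_ne_zero
    rw [sineKernel, Real.sinc_of_ne_zero (by positivity)]
    field_simp

/-- The kernel `L^N_{Ψ,η}(x,y) = (τ N^α)⁻¹ ∑_{|k| ≤ Γ N^α} Φ((k+ξ_k)/(τ N^α)) ·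
sin(2π η(k)(x-y)) / (π(x-y))`, the sum being over integers `k`. -/
noncomputable def kernelL (Ψ : ℝ → ℝ) (α τ Γ : ℝ) (η ξ : ℤ → ℝ) (N x y : ℝ) : ℝ :=
  1 / (τ * N ^ α) * ∑ k ∈ Finset.Icc (-⌊Γ * N ^ α⌋) ⌊Γ * N ^ α⌋,
    shapeDensity Ψ ((k + ξ k) / (τ * N ^ α)) * sineKernel (η k) (x - y)

/-- The growth conditions on the cut-off `Γ = Γ_N > 0` and on the non-decreasing functions
`η = η_N`: `Γ_N = o(N^ν)`, the expansion `η_N(k) = N^ν + β k N^{-α} + O(N^{-ε})` uniformly in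
`|k| ≤ Γ_N N^α`, and the mass of `Φ` (at temperature `τ`) that the cut-off neglects is
`o(N^{-ν})`; the smallest index retained by the cut-off is `-⌊Γ_N N^α⌋`. -/
structure GrowthConditions (Ψ : ℝ → ℝ) (α τ ν β ε : ℝ) (Γ : ℝ → ℝ) (η : ℝ → ℤ → ℝ) : Prop where
  cutoff_pos : ∀ N, 0 < N → 0 < Γ N
  monotone : ∀ N, 0 < N → Monotone (η N)
  cutoff_small : Tendsto (fun N : ℝ => Γ N / N ^ ν) atTop (𝓝 0)
  expansion : ∃ C N₀ : ℝ, ∀ N ≥ N₀, ∀ k : ℤ, |(k : ℝ)| ≤ Γ N * N ^ α →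
    |η N k - (N ^ ν + β * k * N ^ (-α))| ≤ C * N ^ (-ε)
  tails : Tendsto (fun N : ℝ => N ^ ν *
    max (Ψ (Γ N / τ)) (1 - Ψ (-(⌊Γ N * N ^ α⌋ : ℝ) / (τ * N ^ α)))) atTop (𝓝 0)

/-- `f ∈ H¹_0(ℝ)`: the (continuous representative of a) compactly supported real-valued function
with `∫ |f̂(u)|² |u|² du < ∞`. -/
structure IsH1Compact (f : ℝ → ℝ) : Prop where
  continuous : Continuous f
  compact : HasCompactSupport f
  sobolev : Integrable (fun u : ℝ => ‖𝓕 (fun x : ℝ => (f x : ℂ)) u‖ ^ 2 * |u| ^ 2)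

/-- `M(m) = ((-1)^(ℓ+1)/ℓ) · n!/(m_1! ⋯ m_ℓ!)` for a composition `m` of `n` of length `ℓ`. -/
noncomputable def compWeight {n : ℕ} (c : Composition n) : ℝ :=
  (-1) ^ (c.length + 1) / c.length * (n ! / ∏ i, (c.blocksFun i)! : ℝ)

/-- `Tr[f^{m_1} K f^{m_2} ⋯ f^{m_ℓ} K] = ∫ ∏_i f(x_i)^{m_i} K(x_i, x_{i+1}) dx`, with
`x_{ℓ+1} = x_1`. -/
noncomputable def compTrace (K : ℝ → ℝ → ℝ) (f : ℝ → ℝ) {n : ℕ} (c : Composition n) : ℝ :=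
  ∫ x : Fin c.length → ℝ,
    ∏ i, f (x i) ^ c.blocksFun i * K (x i) (x (finRotate c.length i))

/-- The `n`-th cumulant `C^n_K[Ξf]` of a linear statistic in terms of the kernel `K`. -/
noncomputable def kernelCumulant (K : ℝ → ℝ → ℝ) (f : ℝ → ℝ) (n : ℕ) : ℝ :=
  ∑ c : Composition n, compWeight c * compTrace K f c

/-- The random configuration `X : Ω → Set ℝ` (without accumulation points) is a determinantal
point process with correlation kernel `K` with respect to Lebesgue measure: its correlation
functions are `ρ_k(x_1, …, x_k) = det [K(x_i, x_j)]`, that is,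
`E ∏_{x ∈ X} (1 + g(x)) = ∑_{k ≥ 0} (1/k!) ∫ ∏_i g(x_i) det [K(x_i, x_j)] dx`
for all continuous compactly supported `g : ℝ → ℂ`. -/
structure IsDeterminantalProcess {Ω : Type*} [MeasurableSpace Ω] (P : Measure Ω)
    (X : Ω → Set ℝ) (K : ℝ → ℝ → ℝ) : Prop where
  locallyFinite : ∀ ω, ∀ C : Set ℝ, IsCompact C → (X ω ∩ C).Finite
  measurable_count : ∀ B : Set ℝ, MeasurableSet B → Bornology.IsBounded B →
    Measurable fun ω => (X ω ∩ B).ncard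
  integrable : ∀ g : ℝ → ℂ, Continuous g → HasCompactSupport g →
    Integrable (fun ω => ∏ᶠ x ∈ X ω, (1 + g x)) P
  hasSum : ∀ g : ℝ → ℂ, Continuous g → HasCompactSupport g →
    HasSum (fun k : ℕ => (1 / (k ! : ℂ)) * ∫ x : Fin k → ℝ,
        (∏ i, g (x i)) * ((Matrix.of fun i j => K (x i) (x j)).det : ℂ))
      (∫ ω, ∏ᶠ x ∈ X ω, (1 + g x) ∂P)

/-- The linear statistic `Ξf = ∑_{x ∈ X} f(x)`. -/
noncomputable def linearStatistic {Ω : Type*} (X : Ω → Set ℝ) (f : ℝ → ℝ) (ω : Ω) : ℝ :=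
  ∑ᶠ x ∈ X ω, f x

/-- The `n`-th cumulant of a random variable: the coefficient of `t^n / n!` in the expansion of
`log E[exp(t Z)]` at `t = 0`. -/
noncomputable def cumulant {Ω : Type*} [MeasurableSpace Ω] (P : Measure Ω) (Z : Ω → ℝ)
    (n : ℕ) : ℝ :=
  iteratedDeriv n (cgf Z P) 0

/-- The coefficients `b^n_k = ∑_{l=1}^{k+1} (-1)^(l+1) (n-l choose k+1-l)
∑_{|m| = n, ℓ(m) = l} n!/(m_1! ⋯ m_l!)`. -/
noncomputable def coeffB (n k : ℕ) : ℝ :=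
  ∑ l ∈ Finset.Icc 1 (k + 1), (-1) ^ (l + 1) * ((n - l).choose (k + 1 - l) : ℝ) *
    ∑ c : Composition n with c.length = l, (n ! / ∏ i, (c.blocksFun i)! : ℝ)

/-- `B^n_Ψ = ∑_{k=0}^{n-1} b^n_k ∫ x Φ(x) Ψ(x)^k (1-Ψ(x))^(n-1-k) dx` (used for `n ≥ 2`). -/
noncomputable def shapeB (Ψ : ℝ → ℝ) (n : ℕ) : ℝ :=
  ∑ k ∈ Finset.range n, coeffB n k *
    ∫ x : ℝ, x * shapeDensity Ψ x * Ψ x ^ k * (1 - Ψ x) ^ (n - 1 - k)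

/-- `u_1 + ⋯ + u_{m_1 + ⋯ + m_i}`, where the `i`-th part is indexed from `0`. -/
def blockSum {n : ℕ} (c : Composition n) (u : Fin n → ℝ) (i : Fin c.length) : ℝ :=
  ∑ j : Fin n with j.val < c.sizeUpTo (i.val + 1), u j

/-- The antisymmetric matrix `Λ^m_{is}(u)`. -/
def blockLambda {n : ℕ} (c : Composition n) (u : Fin n → ℝ) (i s : Fin c.length) : ℝ :=
  blockSum c u i - blockSum c u s

/-- The index `s ≤ ℓ(m)` with `σ(s) = min {σ(j) : j ≤ ℓ(m)}`. -/
noncomputable def argMinIndex {n : ℕ} (hn : 0 < n) (c : Composition n)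
    (σ : Equiv.Perm (Fin n)) : Fin c.length :=
  haveI : Nonempty (Fin c.length) := ⟨⟨0, c.length_pos_of_pos hn⟩⟩
  Function.argmin fun i : Fin c.length => σ (Fin.castLE c.length_le i)

/-- `G^m_τ(u,x) = ∑_σ max_{i ≤ ℓ} {Λ^m_{is}(u) - τ (x_{σ(i)} - x_{σ(s)})}`, where `s` is the
index at which `σ` is minimal on `{1, …, ℓ(m)}`. -/
noncomputable def compG {n : ℕ} (hn : 0 < n) (τ : ℝ) (c : Composition n)
    (u x : Fin n → ℝ) : ℝ :=
  ∑ σ : Equiv.Perm (Fin n), ⨆ i : Fin c.length,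
    (blockLambda c u i (argMinIndex hn c σ) -
      τ * (x (σ (Fin.castLE c.length_le i)) -
        x (σ (Fin.castLE c.length_le (argMinIndex hn c σ)))))

/-- The parametrization `(u_1, …, u_{n-1}) ↦ (u_1, …, u_{n-1}, -(u_1 + ⋯ + u_{n-1}))` of the
hyperplane `ℝ^n_0 = {u : u_1 + ⋯ + u_n = 0}`; the measure `d^{n-1}u` is Lebesgue measure in these
coordinates. -/
def zeroSum {n : ℕ} (v : Fin (n - 1) → ℝ) (i : Fin n) : ℝ :=
  if h : i.val < n - 1 then v ⟨i.val, h⟩ else -∑ j, v j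

/-- The integrand
`Re {∏_i f̂(u_i) Φ(x_i)} ∑_{|m| = n} M(m) G^m_τ(u,x)` with `u` in the coordinates `zeroSum`. -/
noncomputable def limitIntegrand {n : ℕ} (hn : 0 < n) (Ψ f : ℝ → ℝ) (τ : ℝ)
    (p : (Fin (n - 1) → ℝ) × (Fin n → ℝ)) : ℝ :=
  (∏ i, 𝓕 (fun y : ℝ => (f y : ℂ)) (zeroSum p.1 i) * (shapeDensity Ψ (p.2 i) : ℂ)).re *
    ∑ c : Composition n, compWeight c * compG hn τ c (zeroSum p.1) p.2

/-- The integration domain `ℝ^n_0 × ℝ^n_<` in the coordinates `zeroSum`. -/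
def limitDomain (n : ℕ) : Set ((Fin (n - 1) → ℝ) × (Fin n → ℝ)) :=
  Set.univ ×ˢ {x | StrictMono x}

/-- `2 τ B^n_Ψ ∫ f^n - 2 ∬_{ℝ^n_0 × ℝ^n_<} Re {∏ f̂(u_i) Φ(x_i)} ∑_m M(m) G^m_τ(u,x)`. -/
noncomputable def limitCumulant {n : ℕ} (hn : 0 < n) (Ψ f : ℝ → ℝ) (τ : ℝ) : ℝ :=
  2 * τ * shapeB Ψ n * (∫ t : ℝ, f t ^ n) -
    2 * ∫ p in limitDomain n, limitIntegrand hn Ψ f τ p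

/-! The kernel is a mixture of sine kernels, so it acts as a Fourier multiplier. By the mean value
choice the weight of the `k`-th cell is exactly the mass of that cell under the probability law with
density `Φ`. Hence the multiplier is `w(s) = P(|s| ≤ e(x))`, where `x` has density `Φ` and `e` is
`η` read on the cell of `x` (`cutoffMultiplier`, `kernel_eq_integral`).

Writing `K` and all but one factor `f` per block by Fourier inversion, integrating out the positions
and applying a unimodular shear turns a trace into the integral of `∏ f̂(u_i)` over the hyperplane
`∑ u_i = 0` against `∫ ∏ w(s - Λ_i) ds` (`IsH1Compact.compTrace_eq`). The product of probabilities
is the probability of independent events. By Fubini the `s`-integral is therefore the expected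
length of an intersection of intervals centred at `Λ_i` with half-lengths `e(x_i)`
(`integral_prod_cutoffMultiplier`). Since `e(x) ≈ N^ν + βτx`, this length is `2N^ν` plus a
convergent remainder `min(Λ_i + βτx_i) + min(-Λ_i + βτx_i)`. Dominated convergence applies because
the remainder grows linearly, `f ∈ H¹` controls the frequencies and `Φ` has a first moment
(`tendsto_integral_overlap`). The divergent part is the same for every composition and disappears
because `∑ M(m) = 0` for `n ≥ 2`, which is the identity `log(1 + (e^t - 1)) = t` (`sum_compWeight`).

To identify the limit, `u ↦ -u` exchanges the two minima, giving the factor 2. Symmetrizing over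
permutations restricts `x` to increasing configurations. There the minimum is `-G`, plus a term odd
in `u` that integrates to zero, plus `βτ` times the minimum of the block variables. The last term
factors; its mean comes from the law of a minimum and, after a binomial resummation, assembles to
`B^n_Ψ` (`sum_blockMin_eq`, `integral_blockMin`, `IsShape.shapeB_eq`).

For a point process, `E e^{tΞf}` is the Fredholm series of `K` against `e^{tf} - 1`. The Plemelj
recursion (`fredholmCoeff_succ`), obtained from Laplace expansion, shows that for small test
functions this series is the exponential of a power series in traces. Composing that series with `t
↦ e^{tf} - 1` produces the sum over compositions, so the cumulants equal `C^n_K[Ξf]`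
(`IsDeterminantalProcess.cumulant_eq`). -/

namespace IsShape

/-! ### Limits of a shape and integrability of its density -/

variable {Ψ : ℝ → ℝ}

theorem antitone (h : IsShape Ψ) : Antitone Ψ :=
  antitone_of_deriv_nonpos h.differentiable h.deriv_nonpos

theorem density_nonneg (h : IsShape Ψ) (t : ℝ) : 0 ≤ shapeDensity Ψ t :=
  neg_nonneg.2 (h.deriv_nonpos t)

theorem hasDerivAt (h : IsShape Ψ) (t : ℝ) : HasDerivAt Ψ (-shapeDensity Ψ t) t := by
  simpa [shapeDensity] using (h.differentiable t).hasDerivAt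

theorem hasDerivAt_neg (h : IsShape Ψ) (t : ℝ) :
    HasDerivAt (-Ψ) (shapeDensity Ψ t) t := by
  simpa using (h.hasDerivAt t).neg

theorem measurable_density (Ψ : ℝ → ℝ) : Measurable (shapeDensity Ψ) :=
  (measurable_deriv Ψ).neg

/-- Such a point is a global minimum. With its counterpart at the value 1, this shows that `Φ(t) >
0` forces `0 < Ψ(t) < 1`, so every such point lies strictly inside the range reached by the cut-off.
-/
theorem density_eq_zero_of_eq_zero (h : IsShape Ψ) {t : ℝ} (ht : Ψ t = 0) :
    shapeDensity Ψ t = 0 := by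
  have : IsLocalMin Ψ t := Filter.Eventually.of_forall fun s => by
    rw [ht]; exact (h.mem_Icc s).1
  simp [shapeDensity, this.deriv_eq_zero]

theorem density_eq_zero_of_eq_one (h : IsShape Ψ) {t : ℝ} (ht : Ψ t = 1) :
    shapeDensity Ψ t = 0 := by
  have : IsLocalMax Ψ t := Filter.Eventually.of_forall fun s => by
    rw [ht]; exact (h.mem_Icc s).2
  simp [shapeDensity, this.deriv_eq_zero]

/-- The limit is the infimum; were it positive, a nonzero constant would be integrable on a
half-line. -/
theorem _root_.tendsto_zero_of_antitone_of_integrableOn_Ioi {g : ℝ → ℝ} (hg : Antitone g)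
    (h0 : ∀ t, 0 ≤ g t) (hi : IntegrableOn g (Set.Ioi 0)) : Tendsto g atTop (𝓝 0) := by
  have hb : BddBelow (Set.range g) := ⟨0, by rintro _ ⟨t, rfl⟩; exact h0 t⟩
  have hlim := tendsto_atTop_ciInf hg hb
  have hle : ∀ t, ⨅ i, g i ≤ g t := fun t => ciInf_le hb t
  have hnn : 0 ≤ ⨅ i, g i := le_ciInf h0
  suffices ⨅ i, g i = 0 by rwa [this] at hlim
  by_contra hne
  have hpos : 0 < ⨅ i, g i := lt_of_le_of_ne hnn (Ne.symm hne)
  have hc : IntegrableOn (fun _ : ℝ => ⨅ i, g i) (Set.Ioi 0) := by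
    refine Integrable.mono' hi aestronglyMeasurable_const (Eventually.of_forall fun t => ?_)
    rw [Real.norm_of_nonneg hnn]; exact hle t
  rw [integrableOn_const_iff] at hc
  rcases hc with hc | hc
  · exact hpos.ne' (by simpa using hc)
  · simp at hc

theorem tendsto_atTop (h : IsShape Ψ) : Tendsto Ψ atTop (𝓝 0) :=
  tendsto_zero_of_antitone_of_integrableOn_Ioi h.antitone (fun t => (h.mem_Icc t).1)
    h.integrable_pos

theorem tendsto_atBot (h : IsShape Ψ) : Tendsto Ψ atBot (𝓝 1) := by
  have h1 : Tendsto (fun t => 1 - Ψ (-t)) atTop (𝓝 0) := by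
    refine tendsto_zero_of_antitone_of_integrableOn_Ioi ?_ (fun t => ?_) ?_
    · intro a b hab
      exact sub_le_sub_left (h.antitone (neg_le_neg hab)) 1
    · linarith [(h.mem_Icc (-t)).2]
    · have := h.integrable_neg
      have h2 := (Measure.measurePreserving_neg (volume : Measure ℝ)).integrableOn_comp_preimage
        (MeasurableEquiv.neg ℝ).measurableEmbedding (f := fun t => 1 - Ψ t) (s := Set.Iio 0)
      have h3 := h2.2 this
      simpa [Function.comp_def] using h3
  have h2 : Tendsto (fun t => 1 - (1 - Ψ (-(-t)))) atBot (𝓝 (1 - 0)) :=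
    tendsto_const_nhds.sub (h1.comp tendsto_neg_atBot_atTop)
  simpa using h2

/-- A nonnegative derivative of a function with finite limits is integrable on each half-line; the
negative one is treated by reflection. -/
theorem integrable_density (h : IsShape Ψ) : Integrable (shapeDensity Ψ) := by
  have h1 : IntegrableOn (shapeDensity Ψ) (Set.Ioi 0) :=
    integrableOn_Ioi_deriv_of_nonneg' (fun t _ => h.hasDerivAt_neg t)
      (fun t _ => h.density_nonneg t) h.tendsto_atTop.neg
  have h2 : IntegrableOn (fun t => shapeDensity Ψ (-t)) (Set.Ioi 0) := by
    refine integrableOn_Ioi_deriv_of_nonneg' (g := Ψ ∘ Neg.neg) (l := 1) (fun t _ => ?_)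
      (fun t _ => h.density_nonneg _) (h.tendsto_atBot.comp tendsto_neg_atTop_atBot)
    simpa using (h.hasDerivAt (-t)).scomp t (_root_.hasDerivAt_neg t)
  have h3 := ((Measure.measurePreserving_neg (volume : Measure ℝ)).integrableOn_comp_preimage
    (MeasurableEquiv.neg ℝ).measurableEmbedding (f := shapeDensity Ψ) (s := Set.Iio 0)).1
    (by simpa [Function.comp_def] using h2)
  rw [← integrableOn_Iic_iff_integrableOn_Iio] at h3
  rw [← integrableOn_univ, ← Set.Iic_union_Ioi (a := (0 : ℝ))]
  exact h3.union h1

theorem integral_Ioi_density (h : IsShape Ψ) (t : ℝ) :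
    ∫ x in Set.Ioi t, shapeDensity Ψ x = Ψ t := by
  rw [integral_Ioi_of_hasDerivAt_of_tendsto' (fun x _ => h.hasDerivAt_neg x)
    h.integrable_density.integrableOn h.tendsto_atTop.neg]
  simp

theorem integral_density (h : IsShape Ψ) : ∫ x, shapeDensity Ψ x = 1 := by
  rw [integral_of_hasDerivAt_of_tendsto (fun x => h.hasDerivAt_neg x) h.integrable_density
    h.tendsto_atBot.neg h.tendsto_atTop.neg]
  simp

end IsShape

/-! ### The law with density `Φ`, its first moment and its powers -/

/-- The probability measure with density `Φ = -Ψ'`. -/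
noncomputable def shapeMeasure (Ψ : ℝ → ℝ) : Measure ℝ :=
  volume.withDensity fun t => ENNReal.ofReal (shapeDensity Ψ t)

namespace IsShape

variable {Ψ : ℝ → ℝ}

theorem isProbabilityMeasure (h : IsShape Ψ) : IsProbabilityMeasure (shapeMeasure Ψ) := by
  constructor
  rw [shapeMeasure, withDensity_apply _ MeasurableSet.univ, Measure.restrict_univ,
    ← ofReal_integral_eq_lintegral_ofReal h.integrable_density
      (Eventually.of_forall h.density_nonneg), h.integral_density, ENNReal.ofReal_one]

theorem integrable_shapeMeasure_iff (h : IsShape Ψ) {E : Type*} [NormedAddCommGroup E]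
    [NormedSpace ℝ E] (g : ℝ → E) :
    Integrable g (shapeMeasure Ψ) ↔ Integrable (fun x => shapeDensity Ψ x • g x) := by
  rw [shapeMeasure, integrable_withDensity_iff_integrable_smul'
    (IsShape.measurable_density Ψ).ennreal_ofReal (by simp)]
  simp [ENNReal.toReal_ofReal (h.density_nonneg _)]

theorem ae_density_ne_zero (Ψ : ℝ → ℝ) : ∀ᵐ x ∂shapeMeasure Ψ, 0 < shapeDensity Ψ x := by
  rw [shapeMeasure, ae_withDensity_iff (IsShape.measurable_density Ψ).ennreal_ofReal]
  exact Eventually.of_forall fun x hx => by simpa using hx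

theorem measureReal_Ioi (h : IsShape Ψ) (t : ℝ) : (shapeMeasure Ψ).real (Set.Ioi t) = Ψ t := by
  rw [← h.integral_Ioi_density t, measureReal_def, shapeMeasure,
    withDensity_apply _ measurableSet_Ioi, integral_eq_lintegral_of_nonneg_ae
      (Eventually.of_forall h.density_nonneg) (IsShape.measurable_density Ψ).aestronglyMeasurable]

theorem measure_Ioi (h : IsShape Ψ) (t : ℝ) :
    shapeMeasure Ψ (Set.Ioi t) = ENNReal.ofReal (Ψ t) := by
  have := h.isProbabilityMeasure
  rw [← h.measureReal_Ioi t, ofReal_measureReal]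

instance nullSingletonClass_shapeMeasure (Ψ : ℝ → ℝ) :
    NullSingletonClass (shapeMeasure Ψ) :=
  ⟨fun x => (withDensity_absolutelyContinuous volume _) (measure_singleton x)⟩

theorem measure_Iio (h : IsShape Ψ) (t : ℝ) :
    shapeMeasure Ψ (Set.Iio t) = ENNReal.ofReal (1 - Ψ t) := by
  have := h.isProbabilityMeasure
  rw [measure_congr (Iio_ae_eq_Iic (μ := shapeMeasure Ψ) (a := t)), ← Set.compl_Ioi,
    ← ofReal_measureReal, measureReal_compl measurableSet_Ioi, h.measureReal_Ioi]
  simp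

/-- Layer-cake formula: the means of the positive and negative parts are `∫ Ψ` over `(0,∞)` and `∫
(1 - Ψ)` over `(-∞,0)`, which are finite by the two integrability assumptions on the shape. -/
theorem integrable_id (h : IsShape Ψ) : Integrable (fun x : ℝ => x) (shapeMeasure Ψ) := by
  have hm : AEStronglyMeasurable (fun x : ℝ => x) (shapeMeasure Ψ) :=
    measurable_id.aestronglyMeasurable
  refine ⟨hm, ?_⟩
  have hle : ∀ x : ℝ, ‖x‖ₑ = ENNReal.ofReal (max x 0) + ENNReal.ofReal (max (-x) 0) := by
    intro x
    rw [← ENNReal.ofReal_add (le_max_right _ _) (le_max_right _ _), ← ofReal_norm,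
      Real.norm_eq_abs]
    congr 1
    rcases le_total 0 x with hx | hx
    · simp [abs_of_nonneg hx, hx]
    · simp [abs_of_nonpos hx, hx]
  unfold HasFiniteIntegral
  simp_rw [hle]
  rw [lintegral_add_left (by fun_prop), ENNReal.add_lt_top]
  constructor
  · rw [lintegral_eq_lintegral_meas_lt _ (f := fun x => max x 0)
      (Eventually.of_forall fun x => le_max_right _ _) (by fun_prop)]
    refine lt_of_le_of_lt (setLIntegral_mono' measurableSet_Ioi (g := fun t => ‖Ψ t‖ₑ) ?_)
      h.integrable_pos.2
    intro t ht
    have : {a : ℝ | t < max a 0} = Set.Ioi t := by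
      ext a; simp only [Set.mem_ofPred_eq, lt_max_iff, Set.mem_Ioi]
      exact or_iff_left (not_lt.2 (le_of_lt ht))
    rw [this, h.measure_Ioi, ← ofReal_norm, Real.norm_of_nonneg (h.mem_Icc t).1]
  · rw [lintegral_eq_lintegral_meas_lt _ (f := fun x => max (-x) 0)
      (Eventually.of_forall fun x => le_max_right _ _) (by fun_prop)]
    have h2 := ((Measure.measurePreserving_neg (volume : Measure ℝ)).integrableOn_comp_preimage
        (MeasurableEquiv.neg ℝ).measurableEmbedding (f := fun t => 1 - Ψ t) (s := Set.Iio 0)).2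
        h.integrable_neg
    have h3 : IntegrableOn (fun t => 1 - Ψ (-t)) (Set.Ioi 0) := by
      simpa [Function.comp_def] using h2
    refine lt_of_le_of_lt (setLIntegral_mono' measurableSet_Ioi
      (g := fun t => ‖1 - Ψ (-t)‖ₑ) ?_) h3.2
    intro t ht
    have : {a : ℝ | t < max (-a) 0} = Set.Iio (-t) := by
      ext a; simp only [Set.mem_ofPred_eq, lt_max_iff, Set.mem_Iio, lt_neg]
      exact or_iff_left (not_lt.2 (le_of_lt ht))
    rw [this, h.measure_Iio, ← ofReal_norm,
      Real.norm_of_nonneg (by linarith [(h.mem_Icc (-t)).2])]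

theorem integrable_moment (h : IsShape Ψ) (k m : ℕ) :
    Integrable fun x : ℝ => x * shapeDensity Ψ x * Ψ x ^ k * (1 - Ψ x) ^ m := by
  have h1 := (h.integrable_shapeMeasure_iff _).1 h.integrable_id
  have h2 : Integrable (fun x : ℝ => (Ψ x ^ k * (1 - Ψ x) ^ m) * (shapeDensity Ψ x • x)) := by
    refine h1.bdd_mul (c := 1) ?_ (Eventually.of_forall fun x => ?_)
    · have := h.differentiable.continuous
      fun_prop
    · have h0 := h.mem_Icc x
      rw [norm_mul, norm_pow, norm_pow, Real.norm_of_nonneg h0.1,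
        Real.norm_of_nonneg (sub_nonneg.2 h0.2)]
      exact mul_le_one₀ (pow_le_one₀ h0.1 h0.2) (pow_nonneg (sub_nonneg.2 h0.2) _)
        (pow_le_one₀ (sub_nonneg.2 h0.2) (by linarith [h0.1]))
  refine h2.congr (Eventually.of_forall fun x => ?_)
  simp only [smul_eq_mul]; ring

end IsShape

/-- A finite product of measures with integrable densities has the product density. -/
theorem pi_withDensity_ofReal {ι : Type*} [Fintype ι] {g : ℝ → ℝ}
    (h0 : ∀ x, 0 ≤ g x) (hi : Integrable g) :
    Measure.pi (fun _ : ι => volume.withDensity fun x => ENNReal.ofReal (g x)) =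
      volume.withDensity fun x : ι → ℝ => ENNReal.ofReal (∏ i, g (x i)) := by
  have hp : ∀ x : ι → ℝ, 0 ≤ ∏ i, g (x i) := fun x => Finset.prod_nonneg fun i _ => h0 _
  refine Measure.pi_eq fun s hs => ?_
  have hind : ∀ x : ι → ℝ, (Set.univ.pi s).indicator (fun x : ι → ℝ => ∏ i, g (x i)) x =
      ∏ i, (s i).indicator g (x i) := by
    intro x
    by_cases hx : x ∈ Set.univ.pi s
    · rw [Set.indicator_of_mem hx]
      exact Finset.prod_congr rfl fun i _ => (Set.indicator_of_mem (hx i trivial) _).symm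
    · rw [Set.indicator_of_notMem hx]
      simp only [Set.mem_pi, Set.mem_univ, true_imp_iff, not_forall] at hx
      obtain ⟨i, hi⟩ := hx
      exact (Finset.prod_eq_zero (Finset.mem_univ i) (Set.indicator_of_notMem hi _)).symm
  have hip : Integrable fun x : ι → ℝ => ∏ i, g (x i) :=
    Integrable.fintype_prod (f := fun _ => g) fun _ => hi
  have hm := MeasurableSet.univ_pi hs
  rw [withDensity_apply _ hm, ← ofReal_integral_eq_lintegral_ofReal hip.integrableOn
    (Eventually.of_forall hp), ← integral_indicator hm]
  simp_rw [hind]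
  rw [integral_fintype_prod_volume_eq_prod (fun i => (s i).indicator g),
    ENNReal.ofReal_prod_of_nonneg fun i _ =>
      integral_nonneg fun x => Set.indicator_nonneg (fun x _ => h0 x) x]
  refine Finset.prod_congr rfl fun i _ => ?_
  rw [integral_indicator (hs i), withDensity_apply _ (hs i),
    ofReal_integral_eq_lintegral_ofReal hi.integrableOn (Eventually.of_forall h0)]

/-- The joint law of `n` independent variables with density `Φ`. -/
noncomputable abbrev shapePi (Ψ : ℝ → ℝ) (ι : Type*) [Fintype ι] : Measure (ι → ℝ) :=
  Measure.pi fun _ => shapeMeasure Ψ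

theorem IsShape.shapePi_eq {Ψ : ℝ → ℝ} (h : IsShape Ψ) (ι : Type*) [Fintype ι] :
    shapePi Ψ ι =
      volume.withDensity fun x : ι → ℝ => ENNReal.ofReal (∏ i, shapeDensity Ψ (x i)) :=
  pi_withDensity_ofReal h.density_nonneg h.integrable_density

/-! ### Fourier analysis of the test function -/

/-- The character `x ↦ exp (2 π i x)`, with complex values. -/
noncomputable def planeWave (x : ℝ) : ℂ := (Real.fourierChar x : ℂ)

theorem planeWave_add (x y : ℝ) : planeWave (x + y) = planeWave x * planeWave y := by
  simp [planeWave, AddChar.map_add_eq_mul]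

theorem planeWave_zero : planeWave 0 = 1 := by simp [planeWave]

theorem planeWave_sum {ι : Type*} (s : Finset ι) (g : ι → ℝ) :
    planeWave (∑ i ∈ s, g i) = ∏ i ∈ s, planeWave (g i) := by
  classical
  induction s using Finset.induction_on with
  | empty => simp [planeWave_zero]
  | insert a s ha ih => rw [Finset.sum_insert ha, Finset.prod_insert ha, planeWave_add, ih]

theorem norm_planeWave (x : ℝ) : ‖planeWave x‖ = 1 := Circle.norm_coe _

theorem planeWave_eq_exp (x : ℝ) : planeWave x = Complex.exp (↑(2 * Real.pi * x) * Complex.I) :=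
  Real.fourierChar_apply x

@[fun_prop]
theorem continuous_planeWave : Continuous planeWave := by
  rw [funext planeWave_eq_exp]
  fun_prop

theorem star_planeWave (x : ℝ) : (starRingEnd ℂ) (planeWave x) = planeWave (-x) := by
  rw [planeWave_eq_exp, planeWave_eq_exp, ← Complex.exp_conj]
  congr 1
  simp [Complex.conj_ofReal, map_ofNat]

/-- The Fourier transform of a real function. -/
noncomputable def realFourier (f : ℝ → ℝ) (u : ℝ) : ℂ := 𝓕 (fun y : ℝ => (f y : ℂ)) u

theorem realFourier_eq (f : ℝ → ℝ) (u : ℝ) :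
    realFourier f u = ∫ x : ℝ, (f x : ℂ) * planeWave (-(x * u)) := by
  rw [realFourier, Real.fourier_real_eq]
  refine integral_congr_ae (Eventually.of_forall fun x => ?_)
  simp only [planeWave, Circle.smul_def, smul_eq_mul]
  rw [mul_comm]

theorem realFourier_neg (f : ℝ → ℝ) (u : ℝ) :
    realFourier f (-u) = (starRingEnd ℂ) (realFourier f u) := by
  rw [realFourier_eq, realFourier_eq, ← integral_conj]
  refine integral_congr_ae (Eventually.of_forall fun x => ?_)
  simp [star_planeWave]

namespace IsH1Compact

variable {f : ℝ → ℝ}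

theorem integrable_ofReal (hf : IsH1Compact f) : Integrable fun x => (f x : ℂ) :=
  (hf.continuous.integrable_of_hasCompactSupport hf.compact).ofReal

theorem continuous_realFourier (hf : IsH1Compact f) : Continuous (realFourier f) :=
  VectorFourier.fourierIntegral_continuous Real.continuous_fourierChar
    (by exact continuous_inner) hf.integrable_ofReal

theorem norm_realFourier_le (f : ℝ → ℝ) (u : ℝ) : ‖realFourier f u‖ ≤ ∫ x, ‖(f x : ℂ)‖ := by
  rw [realFourier_eq]
  refine (norm_integral_le_integral_norm _).trans_eq ?_
  simp [norm_planeWave]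

theorem integrable_weighted (hf : IsH1Compact f) :
    Integrable fun u : ℝ => |u| ^ 2 * ‖realFourier f u‖ ^ 2 :=
  hf.sobolev.congr (Eventually.of_forall fun u => by simp only [realFourier]; ring)

/-- A continuous function dominated by an integrable one off `[-1,1]` is integrable. -/
theorem _root_.Continuous.integrable_of_le_off_Icc {g k : ℝ → ℝ} (hg : Continuous g)
    (hk : IntegrableOn k (Set.Icc (-1) 1)ᶜ) (h : ∀ u ∈ (Set.Icc (-1 : ℝ) 1)ᶜ, ‖g u‖ ≤ k u) :
    Integrable g := by
  rw [← integrableOn_univ, ← Set.union_compl_self (Set.Icc (-1 : ℝ) 1)]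
  refine (hg.integrableOn_Icc).union ?_
  refine Integrable.mono' hk hg.aestronglyMeasurable ?_
  filter_upwards [ae_restrict_mem measurableSet_Icc.compl] with u hu using h u hu

theorem _root_.one_lt_sq_of_notMem_Icc {u : ℝ} (hu : u ∈ (Set.Icc (-1 : ℝ) 1)ᶜ) : 1 < |u| ^ 2 := by
  rw [sq_abs, one_lt_sq_iff_one_lt_abs]
  rw [Set.mem_compl_iff, Set.mem_Icc, ← abs_le] at hu
  exact not_le.1 hu

theorem integrable_norm_sq (hf : IsH1Compact f) :
    Integrable fun u : ℝ => ‖realFourier f u‖ ^ 2 := by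
  refine Continuous.integrable_of_le_off_Icc (hf.continuous_realFourier.norm.pow 2)
    hf.integrable_weighted.integrableOn fun u hu => ?_
  rw [Real.norm_of_nonneg (by positivity)]
  exact le_mul_of_one_le_left (by positivity) (one_lt_sq_of_notMem_Icc hu).le

/-- Off `[-1,1]` one has `|f̂| ≤ 2/(1+u²) + u²|f̂|²`, and both terms are integrable. This is what
makes pointwise Fourier inversion available. -/
theorem integrable_norm (hf : IsH1Compact f) : Integrable fun u : ℝ => ‖realFourier f u‖ := by
  have hinv : Integrable fun u : ℝ => 2 * (1 + u ^ 2)⁻¹ := integrable_inv_one_add_sq.const_mul 2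
  refine Continuous.integrable_of_le_off_Icc (hf.continuous_realFourier.norm)
    (hinv.add hf.integrable_weighted).integrableOn fun u hu => ?_
  have h1 := one_lt_sq_of_notMem_Icc hu
  simp only [Pi.add_apply]
  rw [norm_norm, sq_abs] at *
  have h2 : 1 ≤ 2 * (1 + u ^ 2)⁻¹ * u ^ 2 := by
    have : 0 < 1 + u ^ 2 := by positivity
    rw [mul_right_comm, ← div_eq_mul_inv, le_div_iff₀ this]
    linarith
  set a := ‖realFourier f u‖
  set b := 2 * (1 + u ^ 2)⁻¹
  have ha : 0 ≤ a := norm_nonneg _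
  have hb : 0 ≤ b := by positivity
  -- Either `a ≤ b`, or `b ≤ a` and then `a ≤ a·b·u² ≤ a²u²`, because `b·u² ≥ 1` off `[-1,1]`.
  rcases le_total a b with hab | hab
  · have : 0 ≤ u ^ 2 * a ^ 2 := by positivity
    linarith
  · have : a * 1 ≤ a * (b * u ^ 2) := mul_le_mul_of_nonneg_left h2 ha
    nlinarith [mul_le_mul_of_nonneg_left hab (mul_nonneg ha (sq_nonneg u))]

theorem integrable_realFourier (hf : IsH1Compact f) : Integrable (realFourier f) :=
  (integrable_norm_iff hf.continuous_realFourier.aestronglyMeasurable).1 hf.integrable_norm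

theorem inversion (hf : IsH1Compact f) (x : ℝ) :
    ∫ u, realFourier f u * planeWave (u * x) = (f x : ℂ) := by
  have hc : Continuous fun x => (f x : ℂ) := by have := hf.continuous; fun_prop
  have h := congrFun (hc.fourierInv_fourier_eq hf.integrable_ofReal hf.integrable_realFourier) x
  rw [← h, Real.fourierInv_eq]
  refine integral_congr_ae (Eventually.of_forall fun u => ?_)
  simp only [planeWave, Circle.smul_def, smul_eq_mul, realFourier]
  rw [mul_comm]
  simp [mul_comm]

end IsH1Compact

/-! ### The product of Fourier transforms on the zero-sum hyperplane -/

theorem zeroSum_castSucc {m : ℕ} (v : Fin m → ℝ) (j : Fin m) :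
    zeroSum (n := m + 1) v j.castSucc = v j := by
  simp [zeroSum]

theorem zeroSum_last {m : ℕ} (v : Fin m → ℝ) :
    zeroSum (n := m + 1) v (Fin.last m) = -∑ j, v j := by
  simp [zeroSum]

theorem sum_zeroSum {m : ℕ} (v : Fin m → ℝ) : ∑ i, zeroSum (n := m + 1) v i = 0 := by
  simp [Fin.sum_univ_castSucc, zeroSum_castSucc, zeroSum_last]

theorem prod_zeroSum {m : ℕ} {M : Type*} [CommMonoid M] (g : ℝ → M) (v : Fin m → ℝ) :
    ∏ i, g (zeroSum (n := m + 1) v i) = (∏ j, g (v j)) * g (-∑ j, v j) := by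
  simp [Fin.prod_univ_castSucc, zeroSum_castSucc, zeroSum_last]

theorem zeroSum_neg {m : ℕ} (v : Fin m → ℝ) (i : Fin (m + 1)) :
    zeroSum (n := m + 1) (-v) i = -zeroSum (n := m + 1) v i := by
  induction i using Fin.lastCases with
  | last => simp [zeroSum_last]
  | cast j => simp [zeroSum_castSucc]

@[fun_prop]
theorem continuous_zeroSum {m : ℕ} (i : Fin (m + 1)) :
    Continuous fun v : Fin m → ℝ => zeroSum (n := m + 1) v i := by
  induction i using Fin.lastCases with
  | last => simp only [zeroSum_last]; fun_prop
  | cast j => simp only [zeroSum_castSucc]; fun_prop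

theorem abs_zeroSum_le {m : ℕ} (v : Fin m → ℝ) (i : Fin (m + 1)) :
    |zeroSum (n := m + 1) v i| ≤ ∑ j, |v j| := by
  induction i using Fin.lastCases with
  | last => rw [zeroSum_last, abs_neg]; exact Finset.abs_sum_le_sum_abs _ _
  | cast j =>
    rw [zeroSum_castSucc]
    exact Finset.single_le_sum (f := fun j => |v j|) (fun _ _ => abs_nonneg _) (Finset.mem_univ j)

/-- The product `∏ f̂(u_i)` over the hyperplane `u_1 + ⋯ + u_n = 0`. -/
noncomputable def hyperplaneProd (f : ℝ → ℝ) {m : ℕ} (v : Fin m → ℝ) : ℂ :=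
  ∏ i, realFourier f (zeroSum (n := m + 1) v i)

theorem hyperplaneProd_eq (f : ℝ → ℝ) {m : ℕ} (v : Fin m → ℝ) :
    hyperplaneProd f v = (∏ j, realFourier f (v j)) * realFourier f (-∑ j, v j) :=
  prod_zeroSum _ _

/-- Reality of `f`; consequently the real part is even, the source of all cancellations under `u ↦
-u`. -/
theorem hyperplaneProd_neg (f : ℝ → ℝ) {m : ℕ} (v : Fin m → ℝ) :
    hyperplaneProd f (-v) = (starRingEnd ℂ) (hyperplaneProd f v) := by
  simp [hyperplaneProd, zeroSum_neg, realFourier_neg]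

/-- A linear automorphism of `ℝ^ι` of determinant `±1` preserves Lebesgue measure. -/
theorem measurePreserving_of_abs_det_eq_one {ι : Type*} [Fintype ι]
    (T : (ι → ℝ) →ₗ[ℝ] (ι → ℝ)) (hT : |LinearMap.det T| = 1) :
    MeasurePreserving T volume volume := by
  have h0 : LinearMap.det T ≠ 0 := by intro h; simp [h] at hT
  refine ⟨T.continuous_on_pi.measurable, ?_⟩
  rw [Real.map_linearMap_volume_pi_eq_smul_volume_pi h0, abs_inv, hT]
  simp

/-- The reflection of `ℝ^m` replacing the coordinate `v_j` by `-(v_1 + ⋯ + v_m)`. -/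
noncomputable def negSumReflection {m : ℕ} (j : Fin m) : (Fin m → ℝ) →ₗ[ℝ] (Fin m → ℝ) :=
  LinearMap.pi fun k => if k = j then -∑ i, LinearMap.proj i else LinearMap.proj k

theorem negSumReflection_self {m : ℕ} (j : Fin m) (v : Fin m → ℝ) :
    negSumReflection j v j = -∑ i, v i := by
  simp [negSumReflection]

theorem negSumReflection_of_ne {m : ℕ} {j k : Fin m} (h : k ≠ j) (v : Fin m → ℝ) :
    negSumReflection j v k = v k := by
  simp [negSumReflection, h]

theorem negSumReflection_sum {m : ℕ} (j : Fin m) (v : Fin m → ℝ) :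
    ∑ k, negSumReflection j v k = -v j := by
  rw [← Finset.add_sum_erase _ _ (Finset.mem_univ j), negSumReflection_self,
    Finset.sum_congr rfl fun k hk => negSumReflection_of_ne (Finset.ne_of_mem_erase hk) v,
    ← Finset.add_sum_erase Finset.univ v (Finset.mem_univ j)]
  ring

/-- The map is an involution, so its determinant squares to 1. -/
theorem measurePreserving_negSumReflection {m : ℕ} (j : Fin m) :
    MeasurePreserving (negSumReflection j) volume volume := by
  refine measurePreserving_of_abs_det_eq_one _ ?_
  have h : negSumReflection j ∘ₗ negSumReflection j = LinearMap.id := by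
    refine LinearMap.ext fun v => funext fun k => ?_
    simp only [LinearMap.comp_apply, LinearMap.id_apply]
    by_cases hk : k = j
    · subst hk; rw [negSumReflection_self, negSumReflection_sum, neg_neg]
    · rw [negSumReflection_of_ne hk, negSumReflection_of_ne hk]
  have h2 := congrArg LinearMap.det h
  rw [LinearMap.det_comp, LinearMap.det_id, ← sq] at h2
  rcases sq_eq_one_iff.1 h2 with h3 | h3 <;> simp [h3]

namespace IsH1Compact

variable {f : ℝ → ℝ}

@[fun_prop]
theorem continuous_hyperplaneProd (hf : IsH1Compact f) {m : ℕ} :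
    Continuous fun v : Fin m → ℝ => hyperplaneProd f v := by
  have := hf.continuous_realFourier
  unfold hyperplaneProd
  fun_prop

theorem integrable_hyperplaneProd (hf : IsH1Compact f) {m : ℕ} :
    Integrable fun v : Fin m → ℝ => hyperplaneProd f v := by
  have h : Integrable fun v : Fin m → ℝ => ∏ j, realFourier f (v j) :=
    Integrable.fintype_prod (f := fun _ => realFourier f) fun _ => hf.integrable_realFourier
  simp_rw [hyperplaneProd_eq, mul_comm _ (realFourier f _)]
  have := hf.continuous_realFourier
  exact h.bdd_mul (c := ∫ x, ‖(f x : ℂ)‖) (by fun_prop)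
    (Eventually.of_forall fun v => norm_realFourier_le f _)

/-- By `ab ≤ a² + b²` the pair `|v_j f̂(v_j)|`, `|f̂(-∑ v)|` is bounded by a sum of squares. The
first square gives a product integrand; the second becomes one after the reflection that exchanges
`v_j` with `-∑ v`. The Sobolev condition enters through `∫ u²|f̂|²`. -/
theorem integrable_abs_mul_hyperplaneProd (hf : IsH1Compact f) {m : ℕ} (j : Fin m) :
    Integrable fun v : Fin m → ℝ => |v j| * ‖hyperplaneProd f v‖ := by
  have hc := hf.continuous_realFourier
  set F := fun u => ‖realFourier f u‖ with hF
  have hFc : Continuous F := hc.norm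
  have h1 : Integrable fun v : Fin m → ℝ =>
      ∏ k, (if k = j then fun u => |u| ^ 2 * F u ^ 2 else F) (v k) := by
    refine Integrable.fintype_prod fun k => ?_
    split_ifs
    · exact hf.integrable_weighted
    · exact hf.integrable_norm
  have h2 : Integrable fun v : Fin m → ℝ => ∏ k, (if k = j then fun u => F u ^ 2 else F) (v k) := by
    refine Integrable.fintype_prod fun k => ?_
    split_ifs
    · exact hf.integrable_norm_sq
    · exact hf.integrable_norm
  have h3 := (measurePreserving_negSumReflection j).integrable_comp_of_integrable h2
  refine Integrable.mono' (h1.add h3) ?_ (Eventually.of_forall fun v => ?_)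
  · have := hf.continuous_hyperplaneProd (m := m)
    fun_prop
  · simp only [Pi.add_apply, Function.comp_apply]
    rw [Real.norm_of_nonneg (by positivity), hyperplaneProd_eq, norm_mul, norm_prod,
      ← Finset.mul_prod_erase _ _ (Finset.mem_univ j),
      ← Finset.mul_prod_erase _ _ (Finset.mem_univ j),
      ← Finset.mul_prod_erase _ _ (Finset.mem_univ j)]
    have e1 : ∏ k ∈ Finset.univ.erase j, (if k = j then fun u => |u| ^ 2 * F u ^ 2 else F) (v k)
        = ∏ k ∈ Finset.univ.erase j, F (v k) :=
      Finset.prod_congr rfl fun k hk => by rw [if_neg (Finset.ne_of_mem_erase hk)]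
    have e2 : ∏ k ∈ Finset.univ.erase j,
        (if k = j then fun u => F u ^ 2 else F) (negSumReflection j v k)
        = ∏ k ∈ Finset.univ.erase j, F (v k) :=
      Finset.prod_congr rfl fun k hk => by
        rw [if_neg (Finset.ne_of_mem_erase hk), negSumReflection_of_ne (Finset.ne_of_mem_erase hk)]
    rw [e1, e2, if_pos rfl, if_pos rfl, negSumReflection_self, ← add_mul]
    have e3 : |v j| * (‖realFourier f (v j)‖ * (∏ k ∈ Finset.univ.erase j, ‖realFourier f (v k)‖)
        * ‖realFourier f (-∑ j, v j)‖) = (|v j| * F (v j)) * F (-∑ j, v j) *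
          ∏ k ∈ Finset.univ.erase j, F (v k) := by simp only [hF]; ring
    rw [e3]
    refine mul_le_mul_of_nonneg_right ?_ (Finset.prod_nonneg fun k _ => norm_nonneg _)
    rw [← mul_pow]
    nlinarith [sq_nonneg (|v j| * F (v j) - F (-∑ j, v j)), sq_nonneg (|v j| * F (v j)),
      sq_nonneg (F (-∑ j, v j))]

/-- Expanding the last factor `f̂(-∑ v)` as an integral over `x` decouples the `v_j`; Fourier
inversion in each of them gives a factor `f(x)`. -/
theorem integral_hyperplaneProd (hf : IsH1Compact f) (m : ℕ) :
    ∫ v : Fin m → ℝ, hyperplaneProd f v = ((∫ t, f t ^ (m + 1) : ℝ) : ℂ) := by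
  have hc := hf.continuous
  have hFc := hf.continuous_realFourier
  have hint : Integrable (fun p : (Fin m → ℝ) × ℝ => ((∏ j, realFourier f (p.1 j)) * (f p.2 : ℂ)) *
      planeWave ((∑ j, p.1 j) * p.2)) (volume.prod volume) := by
    refine ((Integrable.fintype_prod (f := fun _ : Fin m => realFourier f)
      fun _ => hf.integrable_realFourier).mul_prod hf.integrable_ofReal).mul_bdd (c := 1) ?_ ?_
    · fun_prop
    · exact Eventually.of_forall fun p => (norm_planeWave _).le
  calc ∫ v : Fin m → ℝ, hyperplaneProd f v
      = ∫ v : Fin m → ℝ, ∫ x : ℝ, ((∏ j, realFourier f (v j)) * (f x : ℂ)) *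
          planeWave ((∑ j, v j) * x) := by
        refine integral_congr_ae (Eventually.of_forall fun v => ?_)
        simp only [hyperplaneProd_eq]
        rw [realFourier_eq, ← integral_const_mul]
        refine integral_congr_ae (Eventually.of_forall fun x => ?_)
        simp only
        rw [mul_assoc]; congr 3; ring
    _ = ∫ x : ℝ, ∫ v : Fin m → ℝ, ((∏ j, realFourier f (v j)) * (f x : ℂ)) *
          planeWave ((∑ j, v j) * x) := integral_integral_swap hint
    _ = ∫ x : ℝ, ((f x ^ (m + 1) : ℝ) : ℂ) := by
        refine integral_congr_ae (Eventually.of_forall fun x => ?_)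
        have : ∀ v : Fin m → ℝ, ((∏ j, realFourier f (v j)) * (f x : ℂ)) *
            planeWave ((∑ j, v j) * x) =
            (f x : ℂ) * ∏ j, (realFourier f (v j) * planeWave (v j * x)) := by
          intro v
          rw [Finset.sum_mul, planeWave_sum, Finset.prod_mul_distrib]; ring
        simp only [this]
        rw [integral_const_mul, integral_fintype_prod_volume_eq_pow
          (fun u => realFourier f u * planeWave (u * x)), hf.inversion]
        simp [pow_succ']
    _ = _ := integral_ofReal

end IsH1Compact

/-! ### The unimodular change of frequency variables -/

/-- The matrix of the shear taking `v` to the vector with entries `-∑_{k ≤ j} v_k` for `j ∈ P` and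
`v_j` for `j ∉ P`. -/
noncomputable def partialSumMatrix {m : ℕ} (P : Fin m → Prop) [DecidablePred P] :
    Matrix (Fin m) (Fin m) ℝ :=
  Matrix.of fun j k => if P j then (if k ≤ j then -1 else 0) else if k = j then 1 else 0

theorem partialSumMatrix_mulVec {m : ℕ} (P : Fin m → Prop) [DecidablePred P] (v : Fin m → ℝ)
    (j : Fin m) :
    Matrix.toLin' (partialSumMatrix P) v j = if P j then -∑ k with k ≤ j, v k else v j := by
  simp only [Matrix.toLin'_apply, Matrix.mulVec, dotProduct, partialSumMatrix, Matrix.of_apply]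
  split_ifs
  · simp only [ite_mul, neg_mul, one_mul, zero_mul, Finset.sum_filter, ← Finset.sum_neg_distrib]
    exact Finset.sum_congr rfl fun k _ => by split_ifs <;> simp
  · simp

/-- The matrix is lower triangular with diagonal entries `±1`. -/
theorem measurePreserving_partialSum {m : ℕ} (P : Fin m → Prop) [DecidablePred P] :
    MeasurePreserving (Matrix.toLin' (partialSumMatrix P)) volume volume := by
  refine measurePreserving_of_abs_det_eq_one _ ?_
  rw [LinearMap.det_toLin', Matrix.det_of_isLowerTriangular, Finset.abs_prod]
  · refine Finset.prod_eq_one fun j _ => ?_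
    simp only [partialSumMatrix, Matrix.of_apply]
    split_ifs <;> simp_all
  · intro j k hjk
    have : j < k := hjk
    simp [partialSumMatrix, this.ne', not_le.2 this]

/-- The affine shear of `ℝ × ℝ^m` onto `ℝ^(m+1)`, with last coordinate `s` and with `j`-th
coordinate `s - ∑_{k ≤ j} v_k` for `j ∈ P` and `v_j` for `j ∉ P`. -/
noncomputable def affineShear {m : ℕ} (P : Fin m → Prop) [DecidablePred P] (q : ℝ × (Fin m → ℝ)) :
    Fin (m + 1) → ℝ :=
  Fin.snoc (fun j => if P j then q.1 - ∑ k with k ≤ j, q.2 k else q.2 j) q.1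

/-- For fixed `s` it is the linear shear followed by a translation, so the whole map is a
measure-preserving skew product over `s`. -/
theorem measurePreserving_affineShear {m : ℕ} (P : Fin m → Prop) [DecidablePred P] :
    MeasurePreserving (affineShear P) (volume.prod volume) volume := by
  have h1 : MeasurePreserving (fun q : ℝ × (Fin m → ℝ) =>
      (q.1, Matrix.toLin' (partialSumMatrix P) q.2 + fun j => if P j then q.1 else 0))
      (volume.prod volume) (volume.prod volume) := by
    refine (MeasurePreserving.id volume).skew_product (g := fun s v =>
      Matrix.toLin' (partialSumMatrix P) v + fun j => if P j then s else 0) ?_ ?_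
    · have h : Continuous (Matrix.toLin' (partialSumMatrix P)) := LinearMap.continuous_on_pi _
      have h2 : Continuous fun s : ℝ => fun j => if P j then s else 0 :=
        continuous_pi fun j => by split_ifs <;> fun_prop
      exact ((h.comp continuous_snd).add (h2.comp continuous_fst)).measurable
    · refine Eventually.of_forall fun s => ?_
      exact ((measurePreserving_add_right volume (fun j => if P j then s else 0)).comp
        (measurePreserving_partialSum P)).map_eq
  have h2 := (volume_preserving_piFinSuccAbove (fun _ : Fin (m + 1) => ℝ) (Fin.last m)).symm
  have h3 := h2.comp h1
  suffices h4 : affineShear P = (MeasurableEquiv.piFinSuccAbove (fun _ => ℝ) (Fin.last m)).symm ∘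
      fun q : ℝ × (Fin m → ℝ) =>
        (q.1, Matrix.toLin' (partialSumMatrix P) q.2 + fun j => if P j then q.1 else 0) by
    rw [h4]; exact h3
  funext q j
  induction j using Fin.lastCases with
  | last => simp [affineShear, MeasurableEquiv.piFinSuccAbove, Fin.insertNthEquiv]
  | cast j =>
    simp only [affineShear, Fin.snoc_castSucc, MeasurableEquiv.piFinSuccAbove, Function.comp_apply,
      MeasurableEquiv.symm_mk, MeasurableEquiv.coe_mk, Equiv.symm_symm, Fin.insertNthEquiv,
      Equiv.coe_fn_mk, Fin.insertNth_last', Pi.add_apply, partialSumMatrix_mulVec]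
    split_ifs <;> ring

/-! ### Blocks of a composition and their partial sums -/

namespace Composition

variable {m : ℕ} (c : Composition (m + 1))

/-- The last element of a block. -/
def blockEnd (i : Fin c.length) : Fin (m + 1) :=
  ⟨c.sizeUpTo (i + 1) - 1, by
    have := c.sizeUpTo_le (i + 1); omega⟩

theorem blockEnd_add_one (i : Fin c.length) : (c.blockEnd i : ℕ) + 1 = c.sizeUpTo (i + 1) := by
  have := c.sizeUpTo_strict_mono i.2
  simp only [blockEnd]; omega

theorem index_eq_iff (j : Fin (m + 1)) (i : Fin c.length) :
    c.index j = i ↔ c.sizeUpTo i ≤ j ∧ (j : ℕ) < c.sizeUpTo (i + 1) := by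
  rw [eq_comm, ← c.mem_range_embedding_iff', c.mem_range_embedding_iff]

theorem index_blockEnd (i : Fin c.length) : c.index (c.blockEnd i) = i := by
  have h1 := c.blockEnd_add_one i
  have h2 := c.sizeUpTo_strict_mono i.2
  rw [index_eq_iff]; omega

theorem blockEnd_injective : Function.Injective c.blockEnd :=
  Function.LeftInverse.injective c.index_blockEnd

theorem prod_blockEnd {M : Type*} [CommMonoid M] (g : Fin (m + 1) → M) :
    ∏ i, g (c.blockEnd i) = ∏ j with ∃ i, c.blockEnd i = j, g j := by
  classical
  rw [← Finset.prod_image (f := g) (c.blockEnd_injective.injOn)]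
  refine Finset.prod_congr ?_ fun _ _ => rfl
  ext j; simp

theorem sum_blockEnd {M : Type*} [AddCommMonoid M] (g : Fin (m + 1) → M) :
    ∑ i, g (c.blockEnd i) = ∑ j with ∃ i, c.blockEnd i = j, g j := by
  classical
  rw [← Finset.sum_image (f := g) (c.blockEnd_injective.injOn)]
  refine Finset.sum_congr ?_ fun _ _ => rfl
  ext j; simp

theorem card_index_eq (i : Fin c.length) :
    (Finset.univ.filter fun j => c.index j = i).card = c.blocksFun i := by
  have : (Finset.univ.filter fun j => c.index j = i) =
      Finset.univ.map (c.embedding i).toEmbedding := by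
    ext j
    simp only [Finset.mem_filter, Finset.mem_univ, true_and, Finset.mem_map]
    rw [eq_comm, ← c.mem_range_embedding_iff']
    rfl
  rw [this]; simp

/-- Spreads the power `m_i` over the `m_i` indices of the block, so that each factor can get its own
frequency. -/
theorem prod_index {M : Type*} [CommMonoid M] (g : Fin c.length → M) :
    ∏ j, g (c.index j) = ∏ i, g i ^ c.blocksFun i := by
  rw [← Finset.prod_fiberwise Finset.univ c.index]
  refine Finset.prod_congr rfl fun i _ => ?_
  rw [Finset.prod_congr rfl (g := fun _ => g i) fun j hj => by rw [(Finset.mem_filter.1 hj).2],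
    Finset.prod_const, c.card_index_eq]

/-- Exchanging the factors attached to the block ends. -/
theorem prod_ite_blockEnd {M : Type*} [CommMonoid M] (a b : Fin (m + 1) → M) :
    (∏ j, if ∃ i, c.blockEnd i = j then a j else b j) * ∏ i, b (c.blockEnd i) =
      (∏ i, a (c.blockEnd i)) * ∏ j, b j := by
  rw [Finset.prod_ite, c.prod_blockEnd a, c.prod_blockEnd b, mul_assoc,
    mul_comm (∏ j with ¬∃ i, c.blockEnd i = j, b j), Finset.prod_filter_mul_prod_filter_not]

theorem blockSum_eq (u : Fin (m + 1) → ℝ) (i : Fin c.length) :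
    blockSum c u i = ∑ j with j ≤ c.blockEnd i, u j := by
  refine Finset.sum_congr ?_ fun _ _ => rfl
  ext j
  have := c.blockEnd_add_one i
  simp only [Finset.mem_filter, Finset.mem_univ, true_and, Fin.le_def]
  omega

theorem blockEnd_eq_last {i : Fin c.length} (hi : (i : ℕ) + 1 = c.length) :
    c.blockEnd i = Fin.last m := by
  have := c.blockEnd_add_one i
  rw [hi, c.sizeUpTo_length] at this
  ext; simpa using this

theorem coe_finRotate_of_lt {k : ℕ} {i : Fin k} (hi : (i : ℕ) + 1 < k) :
    (finRotate k i : ℕ) = i + 1 := by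
  obtain _ | k := k
  · exact i.elim0
  · rw [coe_finRotate, if_neg]
    rintro rfl
    simp at hi

theorem coe_finRotate_of_eq {k : ℕ} {i : Fin k} (hi : (i : ℕ) + 1 = k) :
    (finRotate k i : ℕ) = 0 := by
  obtain _ | k := k
  · exact i.elim0
  · rw [coe_finRotate, if_pos]
    ext; simpa using hi

theorem blockSum_of_last {u : Fin (m + 1) → ℝ} (hu : ∑ j, u j = 0) {i : Fin c.length}
    (hi : (i : ℕ) + 1 = c.length) : blockSum c u i = 0 := by
  rw [blockSum_eq, c.blockEnd_eq_last hi, ← hu]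
  exact Finset.sum_congr (Finset.filter_true_of_mem fun j _ => Fin.le_last j) fun _ _ => rfl

/-- A block sum is a difference of consecutive partial sums. The cyclic wrap-around from the last
block to the first fits the same formula because the full sum is zero. -/
theorem sum_index_eq_finRotate {u : Fin (m + 1) → ℝ} (hu : ∑ j, u j = 0) (i : Fin c.length) :
    ∑ j with c.index j = finRotate _ i, u j = blockSum c u (finRotate _ i) - blockSum c u i := by
  have hfil : ∀ k : Fin c.length, (Finset.univ.filter fun j => c.index j = k) =
      (Finset.univ.filter fun j : Fin (m + 1) =>
        c.sizeUpTo k ≤ j ∧ (j : ℕ) < c.sizeUpTo (k + 1)) := fun k => by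
    ext j; simp [index_eq_iff]
  rw [hfil]
  rcases (Nat.succ_le_of_lt i.2).lt_or_eq with hi | hi
  · have hr := coe_finRotate_of_lt hi
    rw [eq_sub_iff_add_eq, blockSum, blockSum, ← Finset.sum_union]
    · refine Finset.sum_congr ?_ fun _ _ => rfl
      ext j
      have := c.monotone_sizeUpTo (Nat.le_succ ((i : ℕ) + 1))
      simp only [Finset.mem_union, Finset.mem_filter, Finset.mem_univ, true_and, hr]
      simp only [Nat.succ_eq_add_one] at this
      omega
    · rw [Finset.disjoint_filter]
      intro j _ h1
      rw [hr] at h1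
      omega
  · have hr := coe_finRotate_of_eq hi
    rw [c.blockSum_of_last hu hi, sub_zero, blockSum]
    refine Finset.sum_congr ?_ fun _ _ => rfl
    ext j
    simp only [Finset.mem_filter, Finset.mem_univ, true_and, hr]
    simp

theorem affineShear_blockEnd (q : ℝ × (Fin m → ℝ)) [DecidablePred fun j : Fin m =>
    ∃ i, c.blockEnd i = j.castSucc] (i : Fin c.length) :
    affineShear (fun j : Fin m => ∃ i, c.blockEnd i = j.castSucc) q (c.blockEnd i) =
      q.1 - blockSum c (zeroSum (n := m + 1) q.2) i := by
  rcases Fin.eq_castSucc_or_eq_last (c.blockEnd i) with ⟨j, hj⟩ | hj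
  · rw [c.blockSum_eq, hj]
    have hP : ∃ i, c.blockEnd i = j.castSucc := ⟨i, hj⟩
    simp only [affineShear, Fin.snoc_castSucc, if_pos hP, Finset.sum_filter]
    rw [Fin.sum_univ_castSucc]
    simp [zeroSum_castSucc]
  · rw [c.blockSum_eq, hj, Finset.filter_true_of_mem fun j _ => Fin.le_last j, sum_zeroSum]
    simp [affineShear]

/-- The last index is always a block end, so only coordinates left untouched by the shear occur
here. -/
theorem affineShear_of_not (q : ℝ × (Fin m → ℝ)) [DecidablePred fun j : Fin m =>
    ∃ i, c.blockEnd i = j.castSucc] (hm : 0 < c.length) {j : Fin (m + 1)}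
    (hj : ¬∃ i, c.blockEnd i = j) :
    affineShear (fun j : Fin m => ∃ i, c.blockEnd i = j.castSucc) q j =
      zeroSum (n := m + 1) q.2 j := by
  induction j using Fin.lastCases with
  | last => exact absurd ⟨⟨c.length - 1, by omega⟩, c.blockEnd_eq_last (by simp; omega)⟩ hj
  | cast j => simp only [affineShear, Fin.snoc_castSucc, if_neg hj, zeroSum_castSucc]

end Composition

/-! ### Traces as integrals over frequencies -/

open scoped Classical in
/-- The frequency integrand of the trace before the change of variables. -/
noncomputable def traceFactor (f w : ℝ → ℝ) {m : ℕ} (c : Composition (m + 1)) (j : Fin (m + 1)) :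
    ℝ → ℂ :=
  if ∃ i, c.blockEnd i = j then fun s => (w s : ℂ) else realFourier f

/-- The frequency seen by the `i`-th position variable. -/
noncomputable def tracePhase {m : ℕ} (c : Composition (m + 1)) (z : Fin (m + 1) → ℝ)
    (i : Fin c.length) : ℝ :=
  ∑ j with c.index j = finRotate _ i, z j - z (c.blockEnd i)

-- Reorders the total phase by positions. Each `x_k` collects all frequencies of its own block and
-- loses the kernel frequency at the end of the preceding block, since `K(x_i, x_{i+1})` carries the
-- phase `z (x_i - x_{i+1})`.
open scoped Classical in
theorem sum_mul_tracePhase {m : ℕ} (c : Composition (m + 1)) (z : Fin (m + 1) → ℝ)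
    (x : Fin c.length → ℝ) :
    ∑ j, z j * (x (c.index j) - if ∃ i, c.blockEnd i = j then x (finRotate _ (c.index j)) else 0) =
      ∑ i, x (finRotate _ i) * tracePhase c z i := by
  simp only [mul_sub, mul_ite, mul_zero, Finset.sum_sub_distrib, tracePhase]
  rw [← Finset.sum_filter, ← c.sum_blockEnd fun j => z j * x (finRotate _ (c.index j))]
  simp only [c.index_blockEnd]
  congr 1
  · rw [Equiv.sum_comp (finRotate c.length) (fun k => x k * ∑ j with c.index j = k, z j),
      ← Finset.sum_fiberwise Finset.univ c.index]
    refine Finset.sum_congr rfl fun k _ => ?_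
    rw [Finset.mul_sum]
    refine Finset.sum_congr rfl fun j hj => ?_
    rw [(Finset.mem_filter.1 hj).2, mul_comm]
  · exact Finset.sum_congr rfl fun i _ => mul_comm _ _

namespace IsH1Compact

variable {f : ℝ → ℝ}

theorem integrable_traceFactor (hf : IsH1Compact f) {w : ℝ → ℝ} (hw : Integrable w) {m : ℕ}
    (c : Composition (m + 1)) (j : Fin (m + 1)) : Integrable (traceFactor f w c j) := by
  unfold traceFactor
  split_ifs
  · exact hw.ofReal
  · exact hf.integrable_realFourier

open scoped Classical in
/-- The integrand of the trace as an integral over frequencies. -/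
theorem prod_mul_eq_integral (hf : IsH1Compact f) {w : ℝ → ℝ} {K : ℝ → ℝ → ℝ}
    (hK : ∀ x y, (K x y : ℂ) = ∫ s, (w s : ℂ) * planeWave (s * (x - y)))
    {m : ℕ} (c : Composition (m + 1)) (x : Fin c.length → ℝ) :
    ((∏ i, f (x i) ^ c.blocksFun i * K (x i) (x (finRotate c.length i)) : ℝ) : ℂ) =
      ∫ z : Fin (m + 1) → ℝ, (∏ i, (f (x i) : ℂ)) * (∏ j, traceFactor f w c j (z j)) *
        planeWave (∑ i, x (finRotate _ i) * tracePhase c z i) := by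
  have h1 : ∀ z : Fin (m + 1) → ℝ,
      (∏ i, (f (x i) : ℂ)) * (∏ j, traceFactor f w c j (z j)) *
        planeWave (∑ i, x (finRotate _ i) * tracePhase c z i) =
      (∏ i, (f (x i) : ℂ)) * ∏ j, (traceFactor f w c j (z j) * planeWave (z j *
        (x (c.index j) - if ∃ i, c.blockEnd i = j then x (finRotate _ (c.index j)) else 0))) := by
    intro z
    rw [← sum_mul_tracePhase, planeWave_sum, Finset.prod_mul_distrib, mul_assoc]
  simp only [h1]
  rw [integral_const_mul, integral_fintype_prod_volume_eq_prod (fun j s =>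
    traceFactor f w c j s * planeWave (s *
        (x (c.index j) - if ∃ i, c.blockEnd i = j then x (finRotate _ (c.index j)) else 0)))]
  have h2 : ∀ j, ∫ s, traceFactor f w c j s * planeWave (s *
        (x (c.index j) - if ∃ i, c.blockEnd i = j then x (finRotate _ (c.index j)) else 0)) =
      if ∃ i, c.blockEnd i = j then (K (x (c.index j)) (x (finRotate _ (c.index j))) : ℂ)
        else (f (x (c.index j)) : ℂ) := by
    intro j
    unfold traceFactor
    split_ifs
    · rw [hK]
    · rw [sub_zero, hf.inversion]
  simp only [h2]
  -- Only `m_i - 1` factors `f(x_i)` were inverted, the end of each block being taken by the kernel;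
  -- the missing factor is the one left in position space.
  have h3 := c.prod_ite_blockEnd (fun j => (K (x (c.index j)) (x (finRotate _ (c.index j))) : ℂ))
    (fun j => (f (x (c.index j)) : ℂ))
  simp only [c.index_blockEnd] at h3
  rw [mul_comm, h3, c.prod_index fun i => (f (x i) : ℂ), Finset.prod_mul_distrib, mul_comm]
  push_cast
  rfl

/-- Each position carries one remaining factor `f`, so the position integral splits into Fourier
transforms at the collected frequencies. -/
theorem integral_position (f : ℝ → ℝ) {m : ℕ} (c : Composition (m + 1))
    (z : Fin (m + 1) → ℝ) (a : ℂ) :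
    ∫ x : Fin c.length → ℝ, (∏ i, (f (x i) : ℂ)) * a *
        planeWave (∑ i, x (finRotate _ i) * tracePhase c z i) =
      a * ∏ i, realFourier f (-tracePhase c z i) := by
  have h1 : ∀ x : Fin c.length → ℝ, (∏ i, (f (x i) : ℂ)) * a *
        planeWave (∑ i, x (finRotate _ i) * tracePhase c z i) =
      a * ∏ i, ((f (x i) : ℂ) * planeWave (-(x i * -tracePhase c z ((finRotate _).symm i)))) := by
    intro x
    rw [mul_comm _ a, mul_assoc, planeWave_sum, Finset.prod_mul_distrib,
      ← Equiv.prod_comp (finRotate c.length)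
        (fun i => planeWave (-(x i * -tracePhase c z ((finRotate _).symm i))))]
    simp only [Equiv.symm_apply_apply, mul_neg, neg_neg]
  simp only [h1]
  rw [integral_const_mul, integral_fintype_prod_volume_eq_prod (fun i s =>
    (f s : ℂ) * planeWave (-(s * -tracePhase c z ((finRotate _).symm i))))]
  simp only [← realFourier_eq]
  rw [Equiv.prod_comp (finRotate c.length).symm fun i => realFourier f (-tracePhase c z i)]

@[fun_prop]
theorem _root_.continuous_tracePhase {m : ℕ} (c : Composition (m + 1)) (i : Fin c.length) :
    Continuous fun z => tracePhase c z i := by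
  unfold tracePhase; fun_prop

open scoped Classical in
/-- Evaluation of the frequency integrand in hyperplane coordinates. -/
theorem traceFactor_comp_affineShear (f w : ℝ → ℝ) {m : ℕ} (c : Composition (m + 1))
    (q : ℝ × (Fin m → ℝ)) :
    (∏ j, traceFactor f w c j (affineShear (fun j => ∃ i, c.blockEnd i = j.castSucc) q j)) *
      ∏ i, realFourier f (-tracePhase c (affineShear (fun j => ∃ i, c.blockEnd i = j.castSucc) q) i)
      = ((∏ i, w (q.1 - blockSum c (zeroSum (n := m + 1) q.2) i) : ℝ) : ℂ) *
        hyperplaneProd f q.2 := by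
  set z := affineShear (fun j => ∃ i, c.blockEnd i = j.castSucc) q with hz
  set u := zeroSum (n := m + 1) q.2 with hu
  have hlen : 0 < c.length := c.length_pos_of_pos m.succ_pos
  have hE : ∀ i, z (c.blockEnd i) = q.1 - blockSum c u i := fun i => c.affineShear_blockEnd q i
  have hN : ∀ j, (¬∃ i, c.blockEnd i = j) → z j = u j := fun j hj =>
    c.affineShear_of_not q hlen hj
  -- The free variable `s` cancels between two consecutive block ends, and the difference of partial
  -- sums leaves the hyperplane frequency that the kernel had displaced from the end of the next
  -- block.
  have h1 : ∀ i, -tracePhase c z i = u (c.blockEnd (finRotate _ i)) := by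
    intro i
    have hsum : ∀ y : Fin (m + 1) → ℝ, ∑ j with c.index j = finRotate _ i, y j =
        y (c.blockEnd (finRotate _ i)) +
          ∑ j ∈ (Finset.univ.filter fun j => c.index j = finRotate _ i).erase
            (c.blockEnd (finRotate _ i)), y j := fun y =>
      (Finset.add_sum_erase _ _ (by simp [c.index_blockEnd])).symm
    have hb := c.sum_index_eq_finRotate (sum_zeroSum q.2) i
    rw [← hu, hsum] at hb
    have hs : ∑ j ∈ (Finset.univ.filter fun j => c.index j = finRotate _ i).erase
        (c.blockEnd (finRotate _ i)), z j =
        ∑ j ∈ (Finset.univ.filter fun j => c.index j = finRotate _ i).erase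
        (c.blockEnd (finRotate _ i)), u j := by
      refine Finset.sum_congr rfl fun j hj => hN j ?_
      rintro ⟨k, rfl⟩
      simp only [Finset.mem_erase, Finset.mem_filter, c.index_blockEnd] at hj
      exact hj.1 (by rw [hj.2.2])
    rw [tracePhase, hsum, hs, hE, hE]
    linarith
  have h2 : ∀ j, traceFactor f w c j (z j) = if ∃ i, c.blockEnd i = j then (w (z j) : ℂ)
      else realFourier f (u j) := by
    intro j
    unfold traceFactor
    split_ifs with h
    · rfl
    · rw [hN j h]
  simp only [h1, h2]
  rw [Equiv.prod_comp (finRotate c.length) fun i => realFourier f (u (c.blockEnd i)),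
    c.prod_ite_blockEnd (fun j => (w (z j) : ℂ)) (fun j => realFourier f (u j))]
  simp only [hE, hyperplaneProd]
  push_cast
  rfl

/-- Keeping one factor `f` per block in position space makes the joint integrand absolutely
integrable, so Fubini needs no regularization. After the shear the `n` frequencies of the `f̂` sum
to zero, and `s` is the one frequency left over. -/
theorem compTrace_eq (hf : IsH1Compact f) {w : ℝ → ℝ} (hw : Integrable w) {K : ℝ → ℝ → ℝ}
    (hK : ∀ x y, (K x y : ℂ) = ∫ s, (w s : ℂ) * planeWave (s * (x - y)))
    {m : ℕ} (c : Composition (m + 1)) :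
    Integrable (fun q : ℝ × (Fin m → ℝ) =>
      ((∏ i, w (q.1 - blockSum c (zeroSum (n := m + 1) q.2) i) : ℝ) : ℂ) *
        hyperplaneProd f q.2) (volume.prod volume) ∧
    (compTrace K f c : ℂ) = ∫ q : ℝ × (Fin m → ℝ),
      ((∏ i, w (q.1 - blockSum c (zeroSum (n := m + 1) q.2) i) : ℝ) : ℂ) *
        hyperplaneProd f q.2 ∂(volume.prod volume) := by
  classical
  have hfc := hf.continuous
  have hFc := hf.continuous_realFourier
  have hg : Integrable fun z : Fin (m + 1) → ℝ => ∏ j, traceFactor f w c j (z j) :=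
    Integrable.fintype_prod fun j => hf.integrable_traceFactor hw c j
  have hx : Integrable fun x : Fin c.length → ℝ => ∏ i, (f (x i) : ℂ) :=
    Integrable.fintype_prod (f := fun _ s => (f s : ℂ)) fun _ => hf.integrable_ofReal
  have hint : Integrable (fun p : (Fin c.length → ℝ) × (Fin (m + 1) → ℝ) =>
      (∏ i, (f (p.1 i) : ℂ)) * (∏ j, traceFactor f w c j (p.2 j)) *
        planeWave (∑ i, p.1 (finRotate _ i) * tracePhase c p.2 i)) (volume.prod volume) := by
    refine (hx.mul_prod hg).mul_bdd (c := 1) ?_ (Eventually.of_forall fun p => (norm_planeWave _).le)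
    fun_prop
  have hmp := measurePreserving_affineShear (fun j : Fin m => ∃ i, c.blockEnd i = j.castSucc)
  have hG : Integrable fun z : Fin (m + 1) → ℝ =>
      (∏ j, traceFactor f w c j (z j)) * ∏ i, realFourier f (-tracePhase c z i) := by
    refine hg.mul_bdd (c := ∏ i : Fin c.length, ∫ x, ‖(f x : ℂ)‖) (by fun_prop)
      (Eventually.of_forall fun z => ?_)
    rw [norm_prod]
    exact Finset.prod_le_prod (fun _ _ => norm_nonneg _) fun i _ => norm_realFourier_le f _
  constructor
  · refine (hmp.integrable_comp_of_integrable hG).congr (Eventually.of_forall fun q => ?_)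
    exact traceFactor_comp_affineShear f w c q
  · rw [compTrace, ← integral_complex_ofReal]
    calc _ = ∫ x : Fin c.length → ℝ, ∫ z : Fin (m + 1) → ℝ,
          (∏ i, (f (x i) : ℂ)) * (∏ j, traceFactor f w c j (z j)) *
          planeWave (∑ i, x (finRotate _ i) * tracePhase c z i) :=
          integral_congr_ae (Eventually.of_forall fun x => hf.prod_mul_eq_integral hK c x)
      _ = ∫ z : Fin (m + 1) → ℝ, (∏ j, traceFactor f w c j (z j)) *
          ∏ i, realFourier f (-tracePhase c z i) := by
          rw [integral_integral_swap hint]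
          exact integral_congr_ae (Eventually.of_forall fun z => integral_position f c z _)
      _ = _ := by
          rw [← hmp.map_eq, integral_map hmp.measurable.aemeasurable
            (by rw [hmp.map_eq]; exact hG.aestronglyMeasurable)]
          exact integral_congr_ae (Eventually.of_forall fun q =>
            traceFactor_comp_affineShear f w c q)

end IsH1Compact

/-! ### The kernel as a Fourier multiplier with a probabilistic meaning -/

theorem intervalIntegral_planeWave {a : ℝ} (t : ℝ) :
    ∫ s in (-a)..a, planeWave (s * t) = (sineKernel a t : ℂ) := by
  rcases eq_or_ne t 0 with rfl | ht
  · simp only [mul_zero, planeWave_zero, sineKernel_zero]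
    rw [intervalIntegral.integral_const]
    simp only [sub_neg_eq_add, Complex.real_smul, mul_one]
    push_cast; ring
  · have hp := Real.pi_ne_zero
    have hc : (2 * Real.pi * t * Complex.I : ℂ) ≠ 0 := by
      simp [ht]
    have h1 : ∀ s : ℝ, planeWave (s * t) = Complex.exp ((2 * Real.pi * t * Complex.I) * s) := by
      intro s
      rw [planeWave_eq_exp]; congr 1; push_cast; ring
    simp only [h1]
    rw [integral_exp_mul_complex hc, sineKernel_of_ne_zero a ht]
    have h2 : (2 * Real.pi * t * Complex.I : ℂ) * ((-a : ℝ) : ℂ) =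
      -(((2 * Real.pi * a * t : ℝ) : ℂ)) * Complex.I := by push_cast; ring
    have h3 : (2 * Real.pi * t * Complex.I : ℂ) * (a : ℂ) =
      (((2 * Real.pi * a * t : ℝ) : ℂ)) * Complex.I := by push_cast; ring
    rw [h2, h3, Complex.ofReal_div, Complex.ofReal_sin, Complex.sin]
    set θ : ℂ := ((2 * Real.pi * a * t : ℝ) : ℂ)
    have hp' : (Real.pi : ℂ) ≠ 0 := by exact_mod_cast hp
    have ht' : (t : ℂ) ≠ 0 := by exact_mod_cast ht
    have hI := Complex.I_ne_zero
    push_cast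
    rw [div_eq_div_iff (by simp [ht]) (by simp [ht])]
    linear_combination (2 * Real.pi * t / 2 : ℂ) * (Complex.exp (θ * Complex.I) -
      Complex.exp (-θ * Complex.I)) * Complex.I_sq

/-- The points whose cell `⌊a x⌋` is retained by the cut-off `M`. -/
def cutoffSet (a : ℝ) (M : ℤ) : Set ℝ := {x | ⌊a * x⌋ ∈ Finset.Icc (-M) M}

open scoped Classical in
/-- The value of `η` on the cell of `x`, and `-1` off the retained cells. -/
noncomputable def cutoffEta (a : ℝ) (M : ℤ) (η : ℤ → ℝ) (x : ℝ) : ℝ :=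
  if x ∈ cutoffSet a M then η ⌊a * x⌋ else -1

theorem cutoffEta_of_mem {a : ℝ} {M : ℤ} (η : ℤ → ℝ) {x : ℝ} (hx : x ∈ cutoffSet a M) :
    cutoffEta a M η x = η ⌊a * x⌋ := if_pos hx

theorem cutoffEta_of_notMem {a : ℝ} {M : ℤ} (η : ℤ → ℝ) {x : ℝ} (hx : x ∉ cutoffSet a M) :
    cutoffEta a M η x = -1 := if_neg hx

theorem measurable_floor_mul (a : ℝ) : Measurable fun x : ℝ => ⌊a * x⌋ :=
  Int.measurable_floor.comp (measurable_const_mul a)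

theorem measurableSet_cutoffSet (a : ℝ) (M : ℤ) : MeasurableSet (cutoffSet a M) :=
  measurable_floor_mul a (MeasurableSet.of_discrete (s := {k | k ∈ Finset.Icc (-M) M}))

@[fun_prop]
theorem measurable_cutoffEta (a : ℝ) (M : ℤ) (η : ℤ → ℝ) : Measurable (cutoffEta a M η) :=
  Measurable.ite (measurableSet_cutoffSet a M)
    ((measurable_of_countable η).comp (measurable_floor_mul a)) measurable_const

/-- The Fourier multiplier of the kernel with cells of width `1/a`. -/
noncomputable def cutoffMultiplier (Ψ : ℝ → ℝ) (a : ℝ) (M : ℤ) (η : ℤ → ℝ) (s : ℝ) : ℝ :=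
  (shapeMeasure Ψ).real {x | |s| ≤ cutoffEta a M η x}

namespace IsShape

variable {Ψ : ℝ → ℝ}

theorem measureReal_Ico (h : IsShape Ψ) {p q : ℝ} (hpq : p ≤ q) :
    (shapeMeasure Ψ).real (Set.Ico p q) = Ψ p - Ψ q := by
  have := h.isProbabilityMeasure
  rw [measureReal_congr (Ico_ae_eq_Ioc (μ := shapeMeasure Ψ) (a := p) (b := q)),
    ← Set.Ioi_sdiff_Ioi, measureReal_sdiff (Set.Ioi_subset_Ioi hpq) measurableSet_Ioi,
    h.measureReal_Ioi, h.measureReal_Ioi]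

theorem measureReal_cell (h : IsShape Ψ) {a : ℝ} (ha : 0 < a) (k : ℤ) :
    (shapeMeasure Ψ).real {x | ⌊a * x⌋ = k} = Ψ (k / a) - Ψ ((k + 1) / a) := by
  have : {x | ⌊a * x⌋ = k} = Set.Ico (k / a) ((k + 1) / a) := by
    ext x
    simp only [Set.mem_ofPred_eq, Int.floor_eq_iff, Set.mem_Ico, div_le_iff₀ ha, lt_div_iff₀ ha,
      mul_comm a x]
  rw [this, h.measureReal_Ico (by gcongr; linarith)]

theorem measureReal_cutoffSet (h : IsShape Ψ) {a : ℝ} (ha : 0 < a) {M : ℤ} (hM : 0 ≤ M) :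
    (shapeMeasure Ψ).real (cutoffSet a M) = Ψ (-M / a) - Ψ ((M + 1) / a) := by
  have hM' : (0 : ℝ) ≤ M := by exact_mod_cast hM
  have : cutoffSet a M = Set.Ico (-M / a) ((M + 1) / a) := by
    ext x
    rw [cutoffSet, Set.mem_ofPred_eq, Finset.mem_Icc, Set.mem_Ico, div_le_iff₀ ha, lt_div_iff₀ ha,
      Int.le_floor, ← Int.lt_add_one_iff, Int.floor_lt, mul_comm x]
    push_cast; rfl
  rw [this, h.measureReal_Ico (by gcongr; linarith)]

-- The event decomposes over the cells, and the mass of a cell is an increment of `Ψ`.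
open scoped Classical in
theorem cutoffMultiplier_eq_sum (h : IsShape Ψ) {a : ℝ} (ha : 0 < a) (M : ℤ) (η : ℤ → ℝ) (s : ℝ) :
    cutoffMultiplier Ψ a M η s = ∑ k ∈ Finset.Icc (-M) M, (Ψ (k / a) - Ψ ((k + 1) / a)) *
      (Set.Icc (-η k) (η k)).indicator 1 s := by
  have := h.isProbabilityMeasure
  have h1 : {x | |s| ≤ cutoffEta a M η x} =
      ⋃ k ∈ (Finset.Icc (-M) M).filter (fun k => |s| ≤ η k), {x | ⌊a * x⌋ = k} := by
    ext x
    simp only [Set.mem_ofPred_eq, Set.mem_iUnion, Finset.mem_filter, exists_prop, exists_eq_right']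
    by_cases hx : x ∈ cutoffSet a M
    · rw [cutoffEta_of_mem η hx]
      exact (and_iff_right hx).symm
    · rw [cutoffEta_of_notMem η hx]
      -- The value `-1` off the retained cells is incompatible with `|s| ≥ 0`, so discarded points
      -- never contribute, not even at `s = 0`.
      refine iff_of_false (fun h0 => ?_) (fun h0 => hx h0.1)
      linarith [abs_nonneg s]
  rw [cutoffMultiplier, h1, measureReal_biUnion_finset, Finset.sum_filter]
  · refine Finset.sum_congr rfl fun k _ => ?_
    by_cases hk : |s| ≤ η k
    · rw [if_pos hk, h.measureReal_cell ha, Set.indicator_of_mem (Set.mem_Icc.2 (abs_le.1 hk))]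
      simp
    · rw [if_neg hk, Set.indicator_of_notMem (fun h0 => hk (abs_le.2 (Set.mem_Icc.1 h0)))]
      simp
  · intro k _ l _ hkl
    refine Set.disjoint_left.2 fun x hx hx' => hkl ?_
    exact (show ⌊a * x⌋ = k from hx).symm.trans hx'
  · exact fun k _ => measurable_floor_mul a (measurableSet_singleton k)

theorem integrable_cutoffMultiplier (h : IsShape Ψ) {a : ℝ} (ha : 0 < a) (M : ℤ) (η : ℤ → ℝ) :
    Integrable (cutoffMultiplier Ψ a M η) := by
  rw [funext (h.cutoffMultiplier_eq_sum ha M η)]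
  refine integrable_finsetSum _ fun k _ => Integrable.const_mul ?_ _
  exact (integrable_indicator_iff measurableSet_Icc).2
    (integrableOn_const (C := (1 : ℝ)) (by simp) (by simp))

/-- Each sine kernel is the Fourier transform of the indicator of `[-η(k), η(k)]`. Nonnegativity is
essential: for negative `η(k)` the interval is empty while the sine kernel is not zero. -/
theorem kernel_eq_integral (h : IsShape Ψ) {a : ℝ} (ha : 0 < a) {M : ℤ} {η : ℤ → ℝ}
    (hη : ∀ k ∈ Finset.Icc (-M) M, 0 ≤ η k) (t : ℝ) :
    ((∑ k ∈ Finset.Icc (-M) M, (Ψ (k / a) - Ψ ((k + 1) / a)) * sineKernel (η k) t : ℝ) : ℂ) =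
      ∫ s, (cutoffMultiplier Ψ a M η s : ℂ) * planeWave (s * t) := by
  have h1 : ∀ s : ℝ, (cutoffMultiplier Ψ a M η s : ℂ) * planeWave (s * t) =
      ∑ k ∈ Finset.Icc (-M) M, ((Ψ (k / a) - Ψ ((k + 1) / a) : ℝ) : ℂ) *
        (Set.Icc (-η k) (η k)).indicator (fun s => planeWave (s * t)) s := by
    intro s
    rw [h.cutoffMultiplier_eq_sum ha]
    push_cast
    rw [Finset.sum_mul]
    refine Finset.sum_congr rfl fun k _ => ?_
    by_cases hs : s ∈ Set.Icc (-η k) (η k)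
    · simp [Set.indicator_of_mem hs]
    · simp [Set.indicator_of_notMem hs]
  simp only [h1]
  rw [integral_finsetSum]
  · push_cast
    refine Finset.sum_congr rfl fun k hk => ?_
    rw [integral_const_mul, integral_indicator measurableSet_Icc, integral_Icc_eq_integral_Ioc,
      ← intervalIntegral.integral_of_le (by linarith [hη k hk]), intervalIntegral_planeWave]
  · intro k _
    refine Integrable.const_mul ((integrable_indicator_iff measurableSet_Icc).2 ?_) _
    exact (by fun_prop : Continuous fun s => planeWave (s * t)).integrableOn_Icc

end IsShape

/-- Coordinates outside the range of `g` are unconstrained and contribute mass 1. This allows the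
same `n` variables to serve compositions of every length. -/
theorem pi_measure_comp_injective {ι κ X : Type*} [Fintype ι] [Fintype κ] [MeasurableSpace X]
    (μ : Measure X) [IsProbabilityMeasure μ] {g : ι → κ} (hg : Function.Injective g)
    (S : ι → Set X) :
    Measure.pi (fun _ : κ => μ) {x | ∀ i, x (g i) ∈ S i} = ∏ i, μ (S i) := by
  have : {x : κ → X | ∀ i, x (g i) ∈ S i} =
      Set.univ.pi fun j => ⋂ i, ⋂ _ : g i = j, S i := by
    ext x
    simp only [Set.mem_ofPred_eq, Set.mem_pi, Set.mem_univ, true_imp_iff, Set.mem_iInter]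
    exact ⟨fun h j i hij => hij ▸ h i, fun h i => h _ i rfl⟩
  rw [this, Measure.pi_pi]
  refine (Fintype.prod_of_injective g hg _ _ (fun j hj => ?_) fun i => ?_).symm
  · have : ⋂ i, ⋂ _ : g i = j, S i = Set.univ := by
      refine Set.iInter_eq_univ.2 fun i => Set.iInter_eq_univ.2 fun hi => absurd ⟨i, hi⟩ hj
    rw [this, measure_univ]
  · congr 1
    ext x
    simp only [Set.mem_iInter]
    exact ⟨fun hx k hk => hg hk ▸ hx, fun hx => hx i rfl⟩

/-! ### Length of an intersection of intervals and its asymptotics -/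

/-- The length of the intersection of the intervals `[L_i - e_i, L_i + e_i]`. -/
noncomputable def overlap {ι : Type*} (L e : ι → ℝ) : ℝ :=
  max 0 ((⨅ i, (L i + e i)) + ⨅ i, (-L i + e i))

theorem inter_intervals_eq {ι : Type*} [Finite ι] [Nonempty ι] (L e : ι → ℝ) :
    {s : ℝ | ∀ i, |s - L i| ≤ e i} = Set.Icc (-⨅ i, (-L i + e i)) (⨅ i, (L i + e i)) := by
  ext s
  rw [Set.mem_ofPred_eq, Set.mem_Icc, neg_le, le_ciInf_iff (Set.finite_range _).bddBelow,
    le_ciInf_iff (Set.finite_range _).bddBelow, ← forall_and]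
  refine forall_congr' fun i => ?_
  rw [abs_le]
  constructor <;> rintro ⟨h1, h2⟩ <;> constructor <;> linarith

theorem measureReal_inter_intervals {ι : Type*} [Finite ι] [Nonempty ι] (L e : ι → ℝ) :
    (volume : Measure ℝ).real {s : ℝ | ∀ i, |s - L i| ≤ e i} = overlap L e := by
  rw [inter_intervals_eq, measureReal_def, Real.volume_Icc, ENNReal.toReal_ofReal', overlap,
    max_comm, sub_neg_eq_add]

/-- By independence the product is the probability of the `s`-slice of one set `A` of pairs `(s,
x)`. Tonelli measures `A` the other way round, and for fixed `x` the slice is an intersection of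
intervals. -/
theorem integral_prod_cutoffMultiplier {Ψ : ℝ → ℝ} (h : IsShape Ψ) (a : ℝ) (M : ℤ) (η : ℤ → ℝ)
    {ι κ : Type*} [Fintype ι] [Fintype κ] [Nonempty ι] {g : ι → κ} (hg : Function.Injective g)
    (L : ι → ℝ) :
    ∫ s, ∏ i, cutoffMultiplier Ψ a M η (s - L i) =
      ∫ x, overlap L (fun i => cutoffEta a M η (x (g i))) ∂shapePi Ψ κ := by
  have := h.isProbabilityMeasure
  set A : Set (ℝ × (κ → ℝ)) := {p | ∀ i, |p.1 - L i| ≤ cutoffEta a M η (p.2 (g i))} with hA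
  have hAm : MeasurableSet A := by
    rw [hA, Set.ofPred_forall]
    refine MeasurableSet.iInter fun i => measurableSet_le (by fun_prop) ?_
    exact (measurable_cutoffEta a M η).comp ((measurable_pi_apply (g i)).comp measurable_snd)
  have h1 : ∀ s, ∏ i, cutoffMultiplier Ψ a M η (s - L i) =
      (shapePi Ψ κ (Prod.mk s ⁻¹' A)).toReal := by
    intro s
    have : Prod.mk s ⁻¹' A = {x | ∀ i, x (g i) ∈ {y | |s - L i| ≤ cutoffEta a M η y}} := rfl
    rw [this, pi_measure_comp_injective _ hg, ENNReal.toReal_prod]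
    rfl
  have h2 : ∀ x : κ → ℝ, overlap L (fun i => cutoffEta a M η (x (g i))) =
      ((volume : Measure ℝ) ((fun s => (s, x)) ⁻¹' A)).toReal := fun x =>
    (measureReal_inter_intervals _ _).symm
  simp only [h1, h2]
  rw [integral_toReal (measurable_measure_prodMk_left hAm).aemeasurable
      (Eventually.of_forall fun s => measure_lt_top _ _),
    integral_toReal (measurable_measure_prodMk_right hAm).aemeasurable
      (Eventually.of_forall fun x => ?_), ← Measure.prod_apply hAm, ← Measure.prod_apply_symm hAm]
  have : (fun s => (s, x)) ⁻¹' A = {s : ℝ | ∀ i, |s - L i| ≤ cutoffEta a M η (x (g i))} := rfl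
  rw [this, inter_intervals_eq]
  simp

section FiniteInfimum

variable {ι : Type*} [Fintype ι] [Nonempty ι]

theorem abs_iInf_sub_iInf_le {g k : ι → ℝ} {δ : ℝ} (h : ∀ i, |g i - k i| ≤ δ) :
    |(⨅ i, g i) - ⨅ i, k i| ≤ δ := by
  have hb : ∀ g : ι → ℝ, BddBelow (Set.range g) := fun g => (Set.finite_range g).bddBelow
  have key : ∀ g k : ι → ℝ, (∀ i, |g i - k i| ≤ δ) → (⨅ i, g i) - δ ≤ ⨅ i, k i := by
    intro g k h
    refine le_ciInf fun i => ?_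
    linarith [ciInf_le (hb g) i, (abs_le.1 (h i)).2]
  rw [abs_le]
  constructor
  · linarith [key k g fun i => by rw [abs_sub_comm]; exact h i]
  · linarith [key g k h]

theorem abs_iInf_le_sum (g : ι → ℝ) : |⨅ i, g i| ≤ ∑ i, |g i| := by
  have := abs_iInf_sub_iInf_le (g := g) (k := fun _ => 0) (δ := ∑ i, |g i|) fun i => by
    rw [sub_zero]
    exact Finset.single_le_sum (f := fun i => |g i|) (fun _ _ => abs_nonneg _) (Finset.mem_univ i)
  simpa using this

/-- The limit of the length of the intersection of the intervals, after centering. -/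
noncomputable def centeredOverlap (L y : ι → ℝ) : ℝ :=
  (⨅ i, (L i + y i)) + ⨅ i, (-L i + y i)

theorem abs_centeredOverlap_le (L y : ι → ℝ) :
    |centeredOverlap L y| ≤ 2 * ∑ i, |L i| + 2 * ∑ i, |y i| := by
  have h1 : ∀ L : ι → ℝ, |⨅ i, (L i + y i)| ≤ ∑ i, |L i| + ∑ i, |y i| := fun L =>
    (abs_iInf_le_sum _).trans
      (by rw [← Finset.sum_add_distrib]; exact Finset.sum_le_sum fun i _ => abs_add_le _ _)
  have h2 := h1 L
  have h3 := h1 (fun i => -L i)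
  simp only [abs_neg] at h3
  unfold centeredOverlap
  linarith [abs_add_le (⨅ i, (L i + y i)) (⨅ i, (-L i + y i))]

theorem abs_centeredOverlap_sub_le (L : ι → ℝ) {y z : ι → ℝ} {δ : ℝ} (h : ∀ i, |y i - z i| ≤ δ) :
    |centeredOverlap L y - centeredOverlap L z| ≤ 2 * δ := by
  have h1 : ∀ L : ι → ℝ, |(⨅ i, (L i + y i)) - ⨅ i, (L i + z i)| ≤ δ := fun L =>
    abs_iInf_sub_iInf_le fun i => by simpa using h i
  have h2 := h1 L
  have h3 := h1 (fun i => -L i)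
  unfold centeredOverlap
  rw [abs_le] at *
  constructor <;> linarith

/-- Subtracting `ρ` commutes with both minima. The truncation of the length at 0 turns into a floor
at `-2ρ`, which recedes to `-∞`. -/
theorem overlap_eq_max_centeredOverlap (L e : ι → ℝ) (ρ : ℝ) :
    overlap L e - 2 * ρ = max (-(2 * ρ)) (centeredOverlap L fun i => e i - ρ) := by
  have h1 : ∀ L : ι → ℝ, (⨅ i, (L i + (e i - ρ))) = (⨅ i, (L i + e i)) - ρ := by
    intro L
    rw [sub_eq_add_neg, ciInf_add (Set.finite_range _).bddBelow]
    simp only [sub_eq_add_neg, add_assoc]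
  have h2 := h1 L
  have h3 := h1 (fun i => -L i)
  rw [overlap, centeredOverlap, h2, h3, ← max_sub_sub_right]
  congr 1 <;> ring

omit [Nonempty ι] in
theorem overlap_eq_zero (L : ι → ℝ) {e : ι → ℝ} {i : ι} (hi : e i ≤ 0) : overlap L e = 0 := by
  refine max_eq_left ?_
  linarith [ciInf_le (Set.finite_range fun i => L i + e i).bddBelow i,
    ciInf_le (Set.finite_range fun i => -L i + e i).bddBelow i]

/-- The bound is independent of `ρ`: a nonpositive floor can only bring a number closer to zero. -/
theorem abs_overlap_sub_le (L : ι → ℝ) {e y : ι → ℝ} {ρ δ : ℝ} (hρ : 0 ≤ ρ)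
    (h : ∀ i, |e i - (ρ + y i)| ≤ δ) :
    |overlap L e - 2 * ρ| ≤ 2 * ∑ i, |L i| + 2 * ∑ i, |y i| + 2 * δ := by
  have h1 := abs_centeredOverlap_sub_le L (y := fun i => e i - ρ) (z := y) (δ := δ)
    fun i => by simpa only [sub_sub] using h i
  have h2 := abs_centeredOverlap_le L y
  have h3 : |max (-(2 * ρ)) (centeredOverlap L fun i => e i - ρ)| ≤
      |centeredOverlap L fun i => e i - ρ| := by
    rcases max_choice (-(2 * ρ)) (centeredOverlap L fun i => e i - ρ) with h | h
    · have h4 := le_max_right (-(2 * ρ)) (centeredOverlap L fun i => e i - ρ)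
      rw [h] at h4 ⊢
      rw [abs_of_nonpos (by linarith), abs_of_nonpos (by linarith)]
      linarith
    · rw [h]
  rw [overlap_eq_max_centeredOverlap]
  rw [abs_le] at h1
  have h5 := abs_le.1 h2
  refine h3.trans (abs_le.2 ⟨?_, ?_⟩) <;> linarith

theorem tendsto_overlap_sub {l : Filter ℝ} (L : ι → ℝ) {e : ℝ → ι → ℝ} {y : ι → ℝ}
    {ρ δ : ℝ → ℝ} (hρ : Tendsto ρ l atTop) (hδ : Tendsto δ l (𝓝 0))
    (h : ∀ᶠ N in l, ∀ i, |e N i - (ρ N + y i)| ≤ δ N) :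
    Tendsto (fun N => overlap L (e N) - 2 * ρ N) l (𝓝 (centeredOverlap L y)) := by
  have h1 : Tendsto (fun N => centeredOverlap L fun i => e N i - ρ N) l
      (𝓝 (centeredOverlap L y)) := by
    rw [tendsto_iff_dist_tendsto_zero]
    refine squeeze_zero' (Eventually.of_forall fun _ => dist_nonneg) ?_
      (by simpa using hδ.const_mul 2)
    filter_upwards [h] with N hN
    exact abs_centeredOverlap_sub_le L fun i => by simpa only [sub_sub] using hN i
  refine h1.congr' ?_
  have h2 : Tendsto (fun N => -(2 * ρ N)) l atBot :=
    tendsto_neg_atTop_atBot.comp (hρ.const_mul_atTop two_pos)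
  filter_upwards [h1.eventually (lt_mem_nhds (sub_one_lt (centeredOverlap L y))),
    h2.eventually (eventually_le_atBot (centeredOverlap L y - 1))] with N hN hN'
  rw [overlap_eq_max_centeredOverlap, max_eq_right (by linarith)]

end FiniteInfimum

section Measurability

variable {ι X : Type*} [Fintype ι] [MeasurableSpace X]

@[fun_prop]
theorem Measurable.overlap {L e : X → ι → ℝ} (hL : ∀ i, Measurable fun x => L x i)
    (he : ∀ i, Measurable fun x => e x i) : Measurable fun x => overlap (L x) (e x) := by
  unfold _root_.overlap
  exact measurable_const.max ((Measurable.iInf fun i => (hL i).add (he i)).add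
    (Measurable.iInf fun i => (hL i).neg.add (he i)))

end Measurability

/-! ### Linear domination and truncated integrands -/

theorem abs_blockSum_le {m : ℕ} (c : Composition (m + 1)) (v : Fin m → ℝ) (i : Fin c.length) :
    |blockSum c (zeroSum (n := m + 1) v) i| ≤ (m + 1) * ∑ j, |v j| := by
  calc _ ≤ ∑ j : Fin (m + 1) with j.val < c.sizeUpTo (i.val + 1), |zeroSum (n := m + 1) v j| :=
        Finset.abs_sum_le_sum_abs _ _
    _ ≤ ∑ j : Fin (m + 1), |zeroSum (n := m + 1) v j| :=
        Finset.sum_le_sum_of_subset_of_nonneg (Finset.filter_subset _ _)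
          fun _ _ _ => abs_nonneg _
    _ ≤ ∑ _j : Fin (m + 1), ∑ j, |v j| := Finset.sum_le_sum fun j _ => abs_zeroSum_le v j
    _ = _ := by simp

@[fun_prop]
theorem continuous_blockSum {m : ℕ} (c : Composition (m + 1)) (i : Fin c.length) :
    Continuous fun v : Fin m → ℝ => blockSum c (zeroSum (n := m + 1) v) i := by
  unfold blockSum; fun_prop

/-- The weight dominating all integrands in the limit. -/
noncomputable def linearWeight {m : ℕ} (p : (Fin m → ℝ) × (Fin (m + 1) → ℝ)) : ℝ :=
  1 + ∑ j, |p.1 j| + ∑ i, |p.2 i|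

theorem IsShape.integrable_eval {Ψ : ℝ → ℝ} (h : IsShape Ψ) {κ : Type*} [Fintype κ] (i : κ) :
    Integrable (fun x : κ → ℝ => x i) (shapePi Ψ κ) := by
  have := h.isProbabilityMeasure
  exact integrable_comp_eval (μ := fun _ : κ => shapeMeasure Ψ) h.integrable_id

/-- The weight is a sum of terms in one variable each: the frequencies are absorbed by the `H¹`
bound, the `x_i` by the first moment of `Φ`. -/
theorem integrable_hyperplaneProd_mul_linearWeight {Ψ : ℝ → ℝ} (h : IsShape Ψ) {f : ℝ → ℝ}
    (hf : IsH1Compact f) (m : ℕ) :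
    Integrable (fun p : (Fin m → ℝ) × (Fin (m + 1) → ℝ) => ‖hyperplaneProd f p.1‖ * linearWeight p)
      (volume.prod (shapePi Ψ (Fin (m + 1)))) := by
  have := h.isProbabilityMeasure
  have h0 : Integrable fun v : Fin m → ℝ => ‖hyperplaneProd f v‖ :=
    hf.integrable_hyperplaneProd.norm
  have h1 : Integrable fun v : Fin m → ℝ => ‖hyperplaneProd f v‖ * (1 + ∑ j, |v j|) := by
    have : Integrable fun v : Fin m → ℝ =>
        ‖hyperplaneProd f v‖ + ∑ j, |v j| * ‖hyperplaneProd f v‖ :=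
      h0.add (integrable_finsetSum _ fun j _ => hf.integrable_abs_mul_hyperplaneProd j)
    refine this.congr (Eventually.of_forall fun v => ?_)
    simp only [← Finset.sum_mul]; ring
  have h2 : Integrable (fun x : Fin (m + 1) → ℝ => ∑ i, |x i|) (shapePi Ψ (Fin (m + 1))) :=
    integrable_finsetSum _ fun i _ => (h.integrable_eval i).abs
  have h3 := (h1.mul_prod (integrable_const (μ := shapePi Ψ (Fin (m + 1))) (1 : ℝ))).add
    (h0.mul_prod h2)
  refine h3.congr (Eventually.of_forall fun p => ?_)
  simp only [Pi.add_apply, linearWeight]; ring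

instance {m : ℕ} (c : Composition (m + 1)) : Nonempty (Fin c.length) :=
  ⟨⟨0, c.length_pos_of_pos m.succ_pos⟩⟩

/-- The variables `x_1, …, x_ℓ` attached to the blocks of a composition. -/
def blockVars {m : ℕ} (c : Composition (m + 1)) (x : Fin (m + 1) → ℝ) (i : Fin c.length) : ℝ :=
  x (Fin.castLE c.length_le i)

@[fun_prop]
theorem measurable_blockVars {m : ℕ} (c : Composition (m + 1)) (i : Fin c.length) :
    Measurable fun x => blockVars c x i := measurable_pi_apply _

theorem sum_abs_blockVars_le {m : ℕ} (c : Composition (m + 1)) (x : Fin (m + 1) → ℝ) :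
    ∑ i, |blockVars c x i| ≤ ∑ i, |x i| := by
  classical
  have := Finset.sum_image (f := fun i => |x i|) (s := Finset.univ)
    ((Fin.castLE_injective c.length_le).injOn (s := ((Finset.univ : Finset (Fin c.length)) : Set _)))
  simp only [blockVars]
  rw [← this]
  exact Finset.sum_le_sum_of_subset_of_nonneg (Finset.subset_univ _) fun _ _ _ => abs_nonneg _

theorem sum_abs_blockSum_le {m : ℕ} (c : Composition (m + 1)) (v : Fin m → ℝ) :
    ∑ i, |blockSum c (zeroSum (n := m + 1) v) i| ≤ (m + 1) * ((m + 1) * ∑ j, |v j|) := by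
  refine (Finset.sum_le_sum fun i _ => abs_blockSum_le c v i).trans ?_
  rw [Finset.sum_const, Finset.card_univ, Fintype.card_fin, nsmul_eq_mul]
  refine mul_le_mul_of_nonneg_right ?_ (by positivity)
  exact_mod_cast c.length_le

/-- Both infima are dominated by a multiple of the linear weight. -/
theorem blocks_le_linearWeight {m : ℕ} (c : Composition (m + 1)) {t : ℝ} (ht : 0 ≤ t) {δ : ℝ}
    (hδ : δ ≤ 1) (p : (Fin m → ℝ) × (Fin (m + 1) → ℝ)) :
    2 * ∑ i, |blockSum c (zeroSum (n := m + 1) p.1) i| + 2 * ∑ i, |t * blockVars c p.2 i| + 2 * δ ≤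
      2 * ((m + 1) * (m + 1) + t) * linearWeight p := by
  have h1 := sum_abs_blockSum_le c p.1
  have h2 : ∑ i, |t * blockVars c p.2 i| ≤ t * ∑ i, |p.2 i| := by
    simp only [abs_mul, abs_of_nonneg ht, ← Finset.mul_sum]
    exact mul_le_mul_of_nonneg_left (sum_abs_blockVars_le c p.2) ht
  have h3 : 0 ≤ ∑ j, |p.1 j| := by positivity
  have h4 : 0 ≤ ∑ i, |p.2 i| := by positivity
  have h5 : (0 : ℝ) ≤ m := by positivity
  unfold linearWeight
  nlinarith [mul_nonneg ht h3, mul_nonneg h5 h4, mul_nonneg (mul_nonneg h5 h5) h4, mul_nonneg h5 h5]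

/-- The frequencies attached to the blocks of a composition. -/
noncomputable def blockFreqs {m : ℕ} (c : Composition (m + 1)) (v : Fin m → ℝ)
    (i : Fin c.length) : ℝ :=
  blockSum c (zeroSum (n := m + 1) v) i

@[fun_prop]
theorem measurable_blockFreqs {m : ℕ} (c : Composition (m + 1)) (i : Fin c.length) :
    Measurable fun v : Fin m → ℝ => blockFreqs c v i := (continuous_blockSum c i).measurable

/-- The configurations whose block variables are all retained. -/
def retained {m : ℕ} (c : Composition (m + 1)) (A : Set ℝ) : Set (Fin (m + 1) → ℝ) :=
  {x | ∀ i, blockVars c x i ∈ A}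

theorem measurableSet_retained {m : ℕ} (c : Composition (m + 1)) {A : Set ℝ}
    (hA : MeasurableSet A) : MeasurableSet (retained c A) := by
  rw [retained, Set.ofPred_forall]
  exact MeasurableSet.iInter fun i => measurable_blockVars c i hA

theorem IsShape.measureReal_retained {Ψ : ℝ → ℝ} (h : IsShape Ψ) {m : ℕ}
    (c : Composition (m + 1)) (A : Set ℝ) :
    (shapePi Ψ (Fin (m + 1))).real (retained c A) = (shapeMeasure Ψ).real A ^ c.length := by
  have := h.isProbabilityMeasure
  have h1 := pi_measure_comp_injective (shapeMeasure Ψ) (Fin.castLE_injective c.length_le)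
    (fun _ => A)
  rw [measureReal_def, retained]
  simp only [blockVars]
  rw [h1, ENNReal.toReal_prod]
  simp [measureReal_def]

/-- The truncated integrand `overlap - 2ρ`, set to zero off the retained configurations. -/
noncomputable def truncatedOverlap {m : ℕ} (c : Composition (m + 1)) (A : Set ℝ) (e : ℝ → ℝ)
    (ρ : ℝ) (p : (Fin m → ℝ) × (Fin (m + 1) → ℝ)) : ℝ :=
  overlap (blockFreqs c p.1) (fun i => e (blockVars c p.2 i)) -
    2 * ρ * (retained c A).indicator 1 p.2

theorem measurable_truncatedOverlap {m : ℕ} (c : Composition (m + 1)) {A : Set ℝ}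
    (hA : MeasurableSet A) {e : ℝ → ℝ} (he : Measurable e) (ρ : ℝ) :
    Measurable (truncatedOverlap c A e ρ) := by
  unfold truncatedOverlap
  have h1 : Measurable ((retained c A).indicator (1 : (Fin (m + 1) → ℝ) → ℝ)) :=
    measurable_one.indicator (measurableSet_retained c hA)
  fun_prop

/-- Off the retained configurations some half-length is `-1`, so the overlap vanishes together with
the indicator. Without the indicator the term `2ρ` would be unbounded there. -/
theorem abs_truncatedOverlap_le {m : ℕ} (c : Composition (m + 1)) {A : Set ℝ} {e : ℝ → ℝ}
    {ρ δ t : ℝ} (ht : 0 ≤ t) (hρ : 0 ≤ ρ) (hδ : δ ≤ 1) (he : ∀ x ∉ A, e x = -1)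
    (hE : ∀ x ∈ A, |e x - (ρ + t * x)| ≤ δ) (p : (Fin m → ℝ) × (Fin (m + 1) → ℝ)) :
    |truncatedOverlap c A e ρ p| ≤ 2 * ((m + 1) * (m + 1) + t) * linearWeight p := by
  unfold truncatedOverlap
  by_cases hp : p.2 ∈ retained c A
  · rw [Set.indicator_of_mem hp, Pi.one_apply, mul_one]
    exact (abs_overlap_sub_le (blockFreqs c p.1) (y := fun i => t * blockVars c p.2 i) hρ
      fun i => hE _ (hp i)).trans (blocks_le_linearWeight c ht hδ p)
  · rw [Set.indicator_of_notMem hp]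
    obtain ⟨i, hi⟩ := not_forall.1 hp
    rw [overlap_eq_zero _ (i := i) (by rw [he _ hi]; norm_num)]
    simp only [mul_zero, sub_zero, abs_zero]
    unfold linearWeight
    positivity

/-! ### Passage to the limit for one composition -/

section Convergence

variable {Ψ f : ℝ → ℝ} {m : ℕ}

theorem integrable_hyperplaneProd_mul (h : IsShape Ψ) (hf : IsH1Compact f)
    {G : (Fin m → ℝ) × (Fin (m + 1) → ℝ) → ℝ} (hG : Measurable G) {C : ℝ}
    (hle : ∀ p, |G p| ≤ C * linearWeight p) :
    Integrable (fun p => hyperplaneProd f p.1 * (G p : ℂ))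
      (volume.prod (shapePi Ψ (Fin (m + 1)))) := by
  refine Integrable.mono' ((integrable_hyperplaneProd_mul_linearWeight h hf m).const_mul C) ?_
    (Eventually.of_forall fun p => ?_)
  · have := hf.continuous_hyperplaneProd (m := m)
    exact ((this.measurable.comp measurable_fst).mul
      (Complex.measurable_ofReal.comp hG)).aestronglyMeasurable
  · rw [norm_mul, Complex.norm_real, Real.norm_eq_abs]
    calc _ ≤ ‖hyperplaneProd f p.1‖ * (C * linearWeight p) :=
          mul_le_mul_of_nonneg_left (hle p) (norm_nonneg _)
      _ = _ := by ring

theorem integrable_linearWeight_right (h : IsShape Ψ) (v : Fin m → ℝ) :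
    Integrable (fun x : Fin (m + 1) → ℝ => linearWeight (v, x)) (shapePi Ψ (Fin (m + 1))) := by
  have := h.isProbabilityMeasure
  unfold linearWeight
  exact (integrable_const (1 + ∑ j, |v j|)).add (integrable_finsetSum _ fun i _ => (h.integrable_eval i).abs)

theorem integral_truncatedOverlap (h : IsShape Ψ) (c : Composition (m + 1)) {A : Set ℝ}
    (hA : MeasurableSet A) {e : ℝ → ℝ} (hem : Measurable e)
    {ρ δ t : ℝ} (ht : 0 ≤ t) (hρ : 0 ≤ ρ) (hδ : δ ≤ 1) (he : ∀ x ∉ A, e x = -1)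
    (hE : ∀ x ∈ A, |e x - (ρ + t * x)| ≤ δ) (v : Fin m → ℝ) :
    ∫ x, truncatedOverlap c A e ρ (v, x) ∂shapePi Ψ (Fin (m + 1)) =
      ∫ x, overlap (blockFreqs c v) (fun i => e (blockVars c x i)) ∂shapePi Ψ (Fin (m + 1)) -
        2 * ρ * (shapeMeasure Ψ).real A ^ c.length := by
  have := h.isProbabilityMeasure
  have h1 : Integrable (fun x => truncatedOverlap c A e ρ (v, x)) (shapePi Ψ (Fin (m + 1))) := by
    refine Integrable.mono' ((integrable_linearWeight_right h v).const_mul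
      (2 * ((m + 1) * (m + 1) + t))) ?_
      (Eventually.of_forall fun x => ?_)
    · exact ((measurable_truncatedOverlap c hA hem ρ).comp measurable_prodMk_left).aestronglyMeasurable
    · exact abs_truncatedOverlap_le c ht hρ hδ he hE (v, x)
  have h2 : Integrable (fun x => 2 * ρ * (retained c A).indicator (1 : (Fin (m + 1) → ℝ) → ℝ) x)
      (shapePi Ψ (Fin (m + 1))) :=
    ((integrable_indicator_iff (measurableSet_retained c hA)).2
      (integrable_const _).integrableOn).const_mul _
  have h3 : ∀ x, overlap (blockFreqs c v) (fun i => e (blockVars c x i)) =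
      truncatedOverlap c A e ρ (v, x) + 2 * ρ * (retained c A).indicator (1 : (Fin (m + 1) → ℝ) → ℝ) x := by
    intro x; simp [truncatedOverlap]
  simp only [h3]
  rw [integral_add h1 h2, integral_const_mul, integral_indicator_one (measurableSet_retained c hA),
    h.measureReal_retained]
  ring

/-- Dominated convergence for the truncated integrand. Replacing the retained mass `p^ℓ` by 1 in the
subtracted term then costs `2ρ(1 - p^ℓ)`, which tends to zero by the mass hypothesis. -/
theorem tendsto_integral_overlap (h : IsShape Ψ) (hf : IsH1Compact f) (c : Composition (m + 1))
    {A : ℝ → Set ℝ} {e : ℝ → ℝ → ℝ} {ρ δ : ℝ → ℝ} {t : ℝ} (ht : 0 ≤ t)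
    (hA : ∀ N, MeasurableSet (A N)) (hem : ∀ N, Measurable (e N))
    (he : ∀ N, ∀ x ∉ A N, e N x = -1) (hρ : Tendsto ρ atTop atTop) (hδ : Tendsto δ atTop (𝓝 0))
    (hE : ∀ᶠ N in atTop, ∀ x ∈ A N, |e N x - (ρ N + t * x)| ≤ δ N)
    (hAx : ∀ x, 0 < shapeDensity Ψ x → ∀ᶠ N in atTop, x ∈ A N)
    (hmass : Tendsto (fun N => ρ N * (1 - (shapeMeasure Ψ).real (A N))) atTop (𝓝 0)) :
    Tendsto (fun N => (∫ v : Fin m → ℝ, hyperplaneProd f v *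
        ((∫ x, overlap (blockFreqs c v) (fun i => e N (blockVars c x i))
          ∂shapePi Ψ (Fin (m + 1)) : ℝ) : ℂ)) - 2 * ρ N * ∫ v : Fin m → ℝ, hyperplaneProd f v)
      atTop (𝓝 (∫ p, hyperplaneProd f p.1 * ((centeredOverlap (blockFreqs c p.1)
        fun i => t * blockVars c p.2 i : ℝ) : ℂ) ∂(volume.prod (shapePi Ψ (Fin (m + 1)))))) := by
  have hprob := h.isProbabilityMeasure
  have hδ1 : ∀ᶠ N in atTop, δ N ≤ 1 := (hδ.eventually (gt_mem_nhds one_pos)).mono fun _ => le_of_lt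
  have hρ0 : ∀ᶠ N in atTop, 0 ≤ ρ N := hρ.eventually (eventually_ge_atTop 0)
  have hdom : Tendsto (fun N => ∫ p, hyperplaneProd f p.1 *
      ((truncatedOverlap c (A N) (e N) (ρ N) p : ℝ) : ℂ)
        ∂(volume.prod (shapePi Ψ (Fin (m + 1))))) atTop
      (𝓝 (∫ p, hyperplaneProd f p.1 * ((centeredOverlap (blockFreqs c p.1)
        fun i => t * blockVars c p.2 i : ℝ) : ℂ) ∂(volume.prod (shapePi Ψ (Fin (m + 1)))))) := by
    refine tendsto_integral_filter_of_dominated_convergence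
      (fun p => 2 * ((m + 1) * (m + 1) + t) * (‖hyperplaneProd f p.1‖ * linearWeight p))
      ?_ ?_ ((integrable_hyperplaneProd_mul_linearWeight h hf m).const_mul _) ?_
    · filter_upwards [hE, hδ1, hρ0] with N h1 h2 h3
      exact (integrable_hyperplaneProd_mul h hf (measurable_truncatedOverlap c (hA N) (hem N) _)
        (abs_truncatedOverlap_le c ht h3 h2 (he N) h1)).aestronglyMeasurable
    · filter_upwards [hE, hδ1, hρ0] with N h1 h2 h3
      refine Eventually.of_forall fun p => ?_
      rw [norm_mul, Complex.norm_real, Real.norm_eq_abs]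
      calc _ ≤ ‖hyperplaneProd f p.1‖ * (2 * ((m + 1) * (m + 1) + t) * linearWeight p) :=
            mul_le_mul_of_nonneg_left (abs_truncatedOverlap_le c ht h3 h2 (he N) h1 p)
              (norm_nonneg _)
        _ = _ := by ring
    -- The cut-off is only assumed to reach points where `Φ > 0`, and these carry the whole law.
    · have hae : ∀ᵐ p ∂((volume : Measure (Fin m → ℝ)).prod (shapePi Ψ (Fin (m + 1)))),
          ∀ i, 0 < shapeDensity Ψ (p.2 i) := by
        rw [ae_all_iff]
        intro i
        have h1 : ∀ᵐ x ∂shapePi Ψ (Fin (m + 1)), 0 < shapeDensity Ψ (x i) :=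
          (measurePreserving_eval (fun _ : Fin (m + 1) => shapeMeasure Ψ)
            i).quasiMeasurePreserving.ae (IsShape.ae_density_ne_zero Ψ)
        exact Measure.quasiMeasurePreserving_snd.ae h1
      filter_upwards [hae] with p hp
      refine Tendsto.const_mul _ ((Complex.continuous_ofReal.tendsto _).comp ?_)
      have hmem : ∀ᶠ N in atTop, p.2 ∈ retained c (A N) :=
        eventually_all.2 fun i => hAx _ (hp _)
      refine (tendsto_overlap_sub (blockFreqs c p.1) (e := fun N i => e N (blockVars c p.2 i))
        hρ hδ ?_).congr' ?_
      · filter_upwards [hE, hmem] with N h1 h2 i using h1 _ (h2 i)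
      · filter_upwards [hmem] with N h2
        simp [truncatedOverlap, Set.indicator_of_mem h2]
  have herr : Tendsto (fun N => ((2 * (ρ N * (1 - (shapeMeasure Ψ).real (A N) ^ c.length)) : ℝ) : ℂ) *
      ∫ v : Fin m → ℝ, hyperplaneProd f v) atTop (𝓝 0) := by
    have h1 : Tendsto (fun N => ρ N * (1 - (shapeMeasure Ψ).real (A N) ^ c.length)) atTop (𝓝 0) := by
      refine squeeze_zero' ?_ ?_ (by simpa using hmass.const_mul (c.length : ℝ))
      · filter_upwards [hρ0] with N h3
        exact mul_nonneg h3 (sub_nonneg.2 (pow_le_one₀ measureReal_nonneg measureReal_le_one))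
      · filter_upwards [hρ0] with N h3
        -- Bernoulli's inequality: `1 - p^ℓ ≤ ℓ(1 - p)`.
        have h4 := one_add_mul_le_pow (a := (shapeMeasure Ψ).real (A N) - 1)
          (by linarith [measureReal_nonneg (μ := shapeMeasure Ψ) (s := A N)]) c.length
        rw [mul_left_comm]
        refine mul_le_mul_of_nonneg_left ?_ h3
        simp only [add_sub_cancel] at h4
        linarith
    have h2 := ((Complex.continuous_ofReal.tendsto _).comp (h1.const_mul 2)).mul_const
      (∫ v : Fin m → ℝ, hyperplaneProd f v)
    simpa using h2
  have hsum := hdom.sub herr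
  rw [sub_zero] at hsum
  refine hsum.congr' ?_
  filter_upwards [hE, hδ1, hρ0] with N h1 h2 h3
  have hi := integrable_hyperplaneProd_mul h hf (measurable_truncatedOverlap c (hA N) (hem N) _)
        (abs_truncatedOverlap_le c ht h3 h2 (he N) h1)
  rw [integral_prod _ hi]
  have h4 : ∀ v : Fin m → ℝ, ∫ x, hyperplaneProd f v *
      ((truncatedOverlap c (A N) (e N) (ρ N) (v, x) : ℝ) : ℂ) ∂shapePi Ψ (Fin (m + 1)) =
      hyperplaneProd f v * ((∫ x, overlap (blockFreqs c v) (fun i => e N (blockVars c x i))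
          ∂shapePi Ψ (Fin (m + 1)) : ℝ) : ℂ) -
        hyperplaneProd f v * ((2 * ρ N * (shapeMeasure Ψ).real (A N) ^ c.length : ℝ) : ℂ) := by
    intro v
    rw [integral_const_mul, integral_complex_ofReal,
      integral_truncatedOverlap h c (hA N) (hem N) ht h3 h2 (he N) h1 v, ← mul_sub,
      ← Complex.ofReal_sub]
  have h5 : Integrable fun v : Fin m → ℝ =>
      hyperplaneProd f v * ((2 * ρ N * (shapeMeasure Ψ).real (A N) ^ c.length : ℝ) : ℂ) :=
    hf.integrable_hyperplaneProd.mul_const _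
  have h6 := hi.integral_prod_left
  simp only [h4] at h6 ⊢
  have h7 := h6.add h5
  simp only [Pi.add_def, sub_add_cancel] at h7
  rw [integral_sub h7 h5, integral_mul_const]
  push_cast
  ring

end Convergence

/-! ### The kernel `L^N` under the growth conditions -/

theorem kernelL_eq_sum {Ψ : ℝ → ℝ} {α τ N : ℝ} {ξ : ℤ → ℝ} (hξ : IsMeanValueChoice Ψ α τ N ξ)
    (Γ : ℝ) (η : ℤ → ℝ) (x y : ℝ) :
    kernelL Ψ α τ Γ η ξ N x y =
      ∑ k ∈ Finset.Icc (-⌊Γ * N ^ α⌋) ⌊Γ * N ^ α⌋,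
        (Ψ (k / (τ * N ^ α)) - Ψ ((k + 1) / (τ * N ^ α))) * sineKernel (η k) (x - y) := by
  rw [kernelL, Finset.mul_sum]
  refine Finset.sum_congr rfl fun k _ => ?_
  -- The mean value choice makes this an identity, with no Riemann-sum error.
  rw [← (hξ k).2, mul_assoc]

theorem ofReal_compTrace_eq {Ψ f : ℝ → ℝ} (h : IsShape Ψ) (hf : IsH1Compact f) {a : ℝ}
    (ha : 0 < a) {M : ℤ} {η : ℤ → ℝ} (hη : ∀ k ∈ Finset.Icc (-M) M, 0 ≤ η k) {K : ℝ → ℝ → ℝ}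
    (hK : ∀ x y, K x y = ∑ k ∈ Finset.Icc (-M) M,
      (Ψ (k / a) - Ψ ((k + 1) / a)) * sineKernel (η k) (x - y))
    {m : ℕ} (c : Composition (m + 1)) :
    (compTrace K f c : ℂ) = ∫ v : Fin m → ℝ, hyperplaneProd f v *
        ((∫ x, overlap (blockFreqs c v) (fun i => cutoffEta a M η (blockVars c x i))
          ∂shapePi Ψ (Fin (m + 1)) : ℝ) : ℂ) := by
  obtain ⟨h1, h2⟩ := hf.compTrace_eq (h.integrable_cutoffMultiplier ha M η) (K := K)
    (fun x y => by rw [hK]; exact h.kernel_eq_integral ha hη _) c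
  rw [h2, integral_prod_symm _ h1]
  refine integral_congr_ae (Eventually.of_forall fun v => ?_)
  simp only
  rw [integral_mul_const, integral_complex_ofReal, mul_comm]
  congr 2
  exact integral_prod_cutoffMultiplier h a M η (Fin.castLE_injective c.length_le) (blockFreqs c v)

namespace GrowthConditions

variable {Ψ : ℝ → ℝ} {α τ ν β ε : ℝ} {Γ : ℝ → ℝ} {η : ℝ → ℤ → ℝ}

theorem abs_le_of_mem {N : ℝ} {k : ℤ} (hk : k ∈ Finset.Icc (-⌊Γ N * N ^ α⌋) ⌊Γ N * N ^ α⌋) :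
    |(k : ℝ)| ≤ Γ N * N ^ α := by
  rw [Finset.mem_Icc, ← abs_le] at hk
  calc |(k : ℝ)| = ((|k| : ℤ) : ℝ) := by push_cast; rfl
    _ ≤ (⌊Γ N * N ^ α⌋ : ℝ) := by exact_mod_cast hk
    _ ≤ _ := Int.floor_le _

theorem eventually_nonneg (hη : GrowthConditions Ψ α τ ν β ε Γ η) (hν : 0 < ν) (hβ : 0 < β)
    (hε : 0 < ε) : ∀ᶠ N in atTop, ∀ k ∈ Finset.Icc (-⌊Γ N * N ^ α⌋) ⌊Γ N * N ^ α⌋, 0 ≤ η N k := by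
  obtain ⟨C, N₀, hC⟩ := hη.expansion
  have h1 : Tendsto (fun N : ℝ => C * N ^ (-ε)) atTop (𝓝 0) := by
    simpa using (tendsto_rpow_neg_atTop hε).const_mul C
  filter_upwards [eventually_ge_atTop N₀, eventually_gt_atTop 0,
    h1.eventually (gt_mem_nhds one_pos),
    (tendsto_rpow_atTop hν).eventually (eventually_ge_atTop 2),
    -- With this constant `βΓ ≤ N^ν/2`. As `N^ν ≥ 2` and the error term is below 1, what remains of
    -- `η` is nonnegative.
    hη.cutoff_small.eventually (gt_mem_nhds (show 0 < 1 / (2 * β) by positivity))]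
    with N hN hN0 h2 h3 h4 k hk
  have h5 := abs_le_of_mem hk
  have h6 := hC N hN k h5
  have h7 : 0 < N ^ α := Real.rpow_pos_of_pos hN0 _
  have h8 : |(k : ℝ) * N ^ (-α)| ≤ Γ N := by
    rw [abs_mul, abs_of_pos (Real.rpow_pos_of_pos hN0 _), Real.rpow_neg hN0.le]
    calc _ ≤ Γ N * N ^ α * (N ^ α)⁻¹ := by gcongr
      _ = _ := by field_simp
  rw [div_lt_div_iff₀ (by linarith) (by positivity)] at h4
  have h9 := (abs_le.1 h8).1
  have h10 := (abs_le.1 h6).1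
  nlinarith

/-- Besides the error in the expansion of `η`, rounding `τN^αx` to its cell costs at most one unit
of `k`, that is `βN^{-α}`. -/
theorem abs_cutoffEta_sub_le {N C : ℝ} (hN : 0 < N) (hβ : 0 < β)
    (hC : ∀ k : ℤ, |(k : ℝ)| ≤ Γ N * N ^ α →
      |η N k - (N ^ ν + β * k * N ^ (-α))| ≤ C * N ^ (-ε))
    {x : ℝ} (hx : x ∈ cutoffSet (τ * N ^ α) ⌊Γ N * N ^ α⌋) :
    |cutoffEta (τ * N ^ α) ⌊Γ N * N ^ α⌋ (η N) x - (N ^ ν + β * τ * x)| ≤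
      C * N ^ (-ε) + β * N ^ (-α) := by
  rw [cutoffEta_of_mem _ hx]
  set k := ⌊τ * N ^ α * x⌋ with hk
  have h1 := hC k (abs_le_of_mem hx)
  have h2 : 0 < N ^ (-α) := Real.rpow_pos_of_pos hN _
  have h3 : N ^ α * N ^ (-α) = 1 := by rw [← Real.rpow_add hN]; simp
  have h4 : β * τ * x = β * (τ * N ^ α * x) * N ^ (-α) := by
    linear_combination -(β * τ * x) * h3
  have h5 : |β * k * N ^ (-α) - β * τ * x| ≤ β * N ^ (-α) := by
    rw [h4, ← sub_mul, ← mul_sub, abs_mul, abs_mul, abs_of_pos hβ, abs_of_pos h2]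
    have h6 : |(k : ℝ) - τ * N ^ α * x| ≤ 1 := by
      rw [abs_le]
      constructor <;> linarith [Int.floor_le (τ * N ^ α * x), Int.lt_floor_add_one (τ * N ^ α * x)]
    calc _ ≤ β * 1 * N ^ (-α) := by gcongr
      _ = _ := by ring
  calc _ = |(η N k - (N ^ ν + β * k * N ^ (-α))) + (β * k * N ^ (-α) - β * τ * x)| := by ring_nf
    _ ≤ _ := (abs_add_le _ _).trans (add_le_add h1 h5)

/-- The last retained cell ends one step beyond the floor, hence not before `Γ/τ`; this is why the
upper tail condition can be stated at `Γ/τ` itself. -/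
theorem div_le_floor_div {N : ℝ} (hN : 0 < N) (hτ : 0 < τ) :
    Γ N / τ ≤ (⌊Γ N * N ^ α⌋ + 1) / (τ * N ^ α) := by
  have h7 : 0 < N ^ α := Real.rpow_pos_of_pos hN _
  rw [div_le_div_iff₀ hτ (by positivity)]
  nlinarith [(Int.lt_floor_add_one (Γ N * N ^ α)).le]

theorem floor_nonneg (hη : GrowthConditions Ψ α τ ν β ε Γ η) {N : ℝ} (hN : 0 < N) :
    0 ≤ ⌊Γ N * N ^ α⌋ :=
  Int.floor_nonneg.2 (mul_nonneg (hη.cutoff_pos N hN).le (Real.rpow_nonneg hN.le _))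

/-- The neglected mass is the sum of the two tails, hence at most twice their maximum. -/
theorem tendsto_mass (hΨ : IsShape Ψ) (hη : GrowthConditions Ψ α τ ν β ε Γ η) (hτ : 0 < τ) :
    Tendsto (fun N : ℝ => N ^ ν * (1 - (shapeMeasure Ψ).real
      (cutoffSet (τ * N ^ α) ⌊Γ N * N ^ α⌋))) atTop (𝓝 0) := by
  have := hΨ.isProbabilityMeasure
  refine squeeze_zero' ?_ ?_ (by simpa using hη.tails.const_mul 2)
  · filter_upwards [eventually_gt_atTop 0] with N hN
    exact mul_nonneg (Real.rpow_nonneg hN.le _) (sub_nonneg.2 measureReal_le_one)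
  · filter_upwards [eventually_gt_atTop 0] with N hN
    have h7 : 0 < N ^ α := Real.rpow_pos_of_pos hN _
    rw [hΨ.measureReal_cutoffSet (by positivity) (hη.floor_nonneg hN), mul_left_comm]
    refine mul_le_mul_of_nonneg_left ?_ (Real.rpow_nonneg hN.le _)
    have h1 := hΨ.antitone (div_le_floor_div (Γ := Γ) (α := α) hN hτ)
    have h2 := le_max_left (Ψ (Γ N / τ)) (1 - Ψ (-(⌊Γ N * N ^ α⌋ : ℝ) / (τ * N ^ α)))
    have h3 := le_max_right (Ψ (Γ N / τ)) (1 - Ψ (-(⌊Γ N * N ^ α⌋ : ℝ) / (τ * N ^ α)))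
    linarith

/-- Nothing forces the cut-off to exhaust the line. The tail condition does eventually place `Ψ(x)`
strictly between the values of `Ψ` at the two ends of the cut-off, and monotonicity then orders the
points. -/
theorem eventually_mem_cutoffSet (hΨ : IsShape Ψ) (hη : GrowthConditions Ψ α τ ν β ε Γ η)
    (hτ : 0 < τ) (hν : 0 < ν) {x : ℝ} (hx : 0 < shapeDensity Ψ x) :
    ∀ᶠ N in atTop, x ∈ cutoffSet (τ * N ^ α) ⌊Γ N * N ^ α⌋ := by
  have h0 : 0 < Ψ x := lt_of_le_of_ne (hΨ.mem_Icc x).1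
    fun h => hx.ne' (hΨ.density_eq_zero_of_eq_zero h.symm)
  have h1 : Ψ x < 1 := lt_of_le_of_ne (hΨ.mem_Icc x).2
    fun h => hx.ne' (hΨ.density_eq_zero_of_eq_one h)
  filter_upwards [eventually_gt_atTop 0, (tendsto_rpow_atTop hν).eventually (eventually_ge_atTop 1),
    hη.tails.eventually (gt_mem_nhds (lt_min h0 (sub_pos.2 h1)))] with N hN hN1 hlt
  set D := max (Ψ (Γ N / τ)) (1 - Ψ (-(⌊Γ N * N ^ α⌋ : ℝ) / (τ * N ^ α)))
  have hD : D < min (Ψ x) (1 - Ψ x) := by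
    have : 0 ≤ D := (hΨ.mem_Icc _).1.trans (le_max_left _ _)
    nlinarith
  have h2 : Ψ (Γ N / τ) < Ψ x := (le_max_left _ _).trans_lt (hD.trans_le (min_le_left _ _))
  have h3 : Ψ x < Ψ (-(⌊Γ N * N ^ α⌋ : ℝ) / (τ * N ^ α)) := by
    linarith [(le_max_right (Ψ (Γ N / τ)) (1 - Ψ (-(⌊Γ N * N ^ α⌋ : ℝ) / (τ * N ^ α)))).trans_lt
      (hD.trans_le (min_le_right _ _))]
  have h4 : x < Γ N / τ := hΨ.antitone.reflect_lt h2
  have h5 : -(⌊Γ N * N ^ α⌋ : ℝ) / (τ * N ^ α) < x := hΨ.antitone.reflect_lt h3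
  have h6 := h4.trans_le (div_le_floor_div (Γ := Γ) (α := α) hN hτ)
  have h7 : 0 < N ^ α := Real.rpow_pos_of_pos hN _
  have ha : 0 < τ * N ^ α := by positivity
  rw [div_lt_iff₀ ha, mul_comm x] at h5
  rw [lt_div_iff₀ ha, mul_comm x] at h6
  rw [cutoffSet, Set.mem_ofPred_eq, Finset.mem_Icc, Int.le_floor, ← Int.lt_add_one_iff,
    Int.floor_lt]
  push_cast
  exact ⟨h5.le, h6⟩

/-- The diverging term `2N^ν ∫ ∏ f̂` is common to all compositions, so the vanishing sum of the
weights removes it. -/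
theorem tendsto_kernelCumulant (hΨ : IsShape Ψ) (hη : GrowthConditions Ψ α τ ν β ε Γ η)
    (hα : 0 < α) (hτ : 0 < τ) (hν : 0 < ν) (hβ : 0 < β) (hε : 0 < ε) {ξ : ℝ → ℤ → ℝ}
    (hξ : ∀ N, 0 < N → IsMeanValueChoice Ψ α τ N (ξ N)) {f : ℝ → ℝ} (hf : IsH1Compact f) (m : ℕ)
    (hzero : ∑ c : Composition (m + 1), compWeight c = 0) :
    Tendsto (fun N =>
        (kernelCumulant (kernelL Ψ α τ (Γ N) (η N) (ξ N) N) f (m + 1) : ℂ)) atTop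
      (𝓝 (∑ c : Composition (m + 1), (compWeight c : ℂ) *
        ∫ p, hyperplaneProd f p.1 * ((centeredOverlap (blockFreqs c p.1)
        fun i => β * τ * blockVars c p.2 i : ℝ) : ℂ) ∂(volume.prod (shapePi Ψ (Fin (m + 1)))))) := by
  obtain ⟨C, N₀, hC⟩ := hη.expansion
  have hδ : Tendsto (fun N : ℝ => C * N ^ (-ε) + β * N ^ (-α)) atTop (𝓝 0) := by
    simpa using ((tendsto_rpow_neg_atTop hε).const_mul C).add
      ((tendsto_rpow_neg_atTop hα).const_mul β)
  have hE : ∀ᶠ N in atTop, ∀ x ∈ cutoffSet (τ * N ^ α) ⌊Γ N * N ^ α⌋,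
      |cutoffEta (τ * N ^ α) ⌊Γ N * N ^ α⌋ (η N) x - (N ^ ν + β * τ * x)| ≤
        C * N ^ (-ε) + β * N ^ (-α) := by
    filter_upwards [eventually_ge_atTop N₀, eventually_gt_atTop 0] with N hN hN0 x hx
    exact abs_cutoffEta_sub_le hN0 hβ (hC N hN) hx
  have hlim := fun c : Composition (m + 1) => tendsto_integral_overlap hΨ hf c
    (A := fun N => cutoffSet (τ * N ^ α) ⌊Γ N * N ^ α⌋)
    (e := fun N => cutoffEta (τ * N ^ α) ⌊Γ N * N ^ α⌋ (η N)) (mul_pos hβ hτ).le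
    (fun N => measurableSet_cutoffSet _ _) (fun N => measurable_cutoffEta _ _ _)
    (fun N x hx => cutoffEta_of_notMem _ hx) (tendsto_rpow_atTop hν) hδ hE
    (fun x hx => eventually_mem_cutoffSet hΨ hη hτ hν hx) (tendsto_mass hΨ hη hτ)
  refine (tendsto_finsetSum Finset.univ fun c _ => (hlim c).const_mul (compWeight c : ℂ)).congr' ?_
  filter_upwards [eventually_gt_atTop 0, hη.eventually_nonneg hν hβ hε] with N hN hpos
  have ha : 0 < τ * N ^ α := mul_pos hτ (Real.rpow_pos_of_pos hN _)
  have hzero' : ∑ c : Composition (m + 1), (compWeight c : ℂ) = 0 := by exact_mod_cast hzero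
  rw [kernelCumulant]
  push_cast
  simp only [mul_sub]
  rw [Finset.sum_sub_distrib, ← Finset.sum_mul, hzero', zero_mul, sub_zero]
  refine Finset.sum_congr rfl fun c _ => ?_
  rw [ofReal_compTrace_eq hΨ hf ha hpos (kernelL_eq_sum (hξ N hN) (Γ N) (η N)) c]

end GrowthConditions

/-! ### The law of a minimum and the constant `B^n_Ψ` -/

namespace IsShape

variable {Ψ : ℝ → ℝ}

theorem measure_Ici (h : IsShape Ψ) (t : ℝ) :
    shapeMeasure Ψ (Set.Ici t) = ENNReal.ofReal (Ψ t) := by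
  rw [← h.measure_Ioi t, measure_congr (Ioi_ae_eq_Ici (μ := shapeMeasure Ψ) (a := t))]

theorem integrable_density_mul_pow (h : IsShape Ψ) (k : ℕ) :
    Integrable fun x => (k + 1) * Ψ x ^ k * shapeDensity Ψ x := by
  refine h.integrable_density.bdd_mul (c := k + 1) ?_ (Eventually.of_forall fun x => ?_)
  · have := h.differentiable.continuous
    fun_prop
  · have h0 := h.mem_Icc x
    rw [norm_mul, norm_pow, Real.norm_of_nonneg h0.1, Real.norm_of_nonneg (by positivity)]
    exact mul_le_of_le_one_right (by positivity) (pow_le_one₀ h0.1 h0.2)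

theorem integral_Ioi_density_mul_pow (h : IsShape Ψ) (k : ℕ) (t : ℝ) :
    ∫ x in Set.Ioi t, (k + 1) * Ψ x ^ k * shapeDensity Ψ x = Ψ t ^ (k + 1) := by
  have hd : ∀ x ∈ Set.Ici t, HasDerivAt (fun x => -(Ψ x ^ (k + 1)))
      ((k + 1) * Ψ x ^ k * shapeDensity Ψ x) x := fun x _ => by
    refine ((h.hasDerivAt x).pow (k + 1)).neg.congr_deriv ?_
    push_cast
    ring
  rw [integral_Ioi_of_hasDerivAt_of_tendsto' hd (h.integrable_density_mul_pow k).integrableOn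
    (h.tendsto_atTop.pow (k + 1)).neg]
  simp

/-- The law of the minimum of `k + 1` independent variables with density `Φ`. -/
theorem map_iInf_eq (h : IsShape Ψ) {κ : Type*} [Fintype κ] {k : ℕ} {g : Fin (k + 1) → κ}
    (hg : Function.Injective g) :
    (shapePi Ψ κ).map (fun x => ⨅ i, x (g i)) =
      volume.withDensity fun x => ENNReal.ofReal ((k + 1) * Ψ x ^ k * shapeDensity Ψ x) := by
  have hprob := h.isProbabilityMeasure
  have hm : Measurable fun x : κ → ℝ => ⨅ i, x (g i) :=
    Measurable.iInf fun i => measurable_pi_apply _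
  have : IsProbabilityMeasure ((shapePi Ψ κ).map (fun x => ⨅ i, x (g i))) :=
    Measure.isProbabilityMeasure_map hm.aemeasurable
  refine Measure.ext_of_Ici _ _ fun t => ?_
  have h1 : (fun x : κ → ℝ => ⨅ i, x (g i)) ⁻¹' Set.Ici t = {x | ∀ i, x (g i) ∈ Set.Ici t} := by
    ext x
    exact le_ciInf_iff (Set.finite_range fun i => x (g i)).bddBelow
  rw [Measure.map_apply hm measurableSet_Ici, h1,
    pi_measure_comp_injective (shapeMeasure Ψ) hg fun _ => Set.Ici t,
    withDensity_apply _ measurableSet_Ici, ← restrict_Ioi_eq_restrict_Ici,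
    ← ofReal_integral_eq_lintegral_ofReal (h.integrable_density_mul_pow k).integrableOn
      (Eventually.of_forall fun x => mul_nonneg
        (mul_nonneg (by positivity) (pow_nonneg (h.mem_Icc x).1 _)) (h.density_nonneg x)),
    h.integral_Ioi_density_mul_pow]
  simp [h.measure_Ici, ENNReal.ofReal_pow (h.mem_Icc t).1]

theorem integral_iInf_eq (h : IsShape Ψ) {κ : Type*} [Fintype κ] {k : ℕ} {g : Fin (k + 1) → κ}
    (hg : Function.Injective g) :
    ∫ x, ⨅ i, x (g i) ∂shapePi Ψ κ = (k + 1) * ∫ x, x * shapeDensity Ψ x * Ψ x ^ k := by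
  have hm : Measurable fun x : κ → ℝ => ⨅ i, x (g i) :=
    Measurable.iInf fun i => measurable_pi_apply _
  have h1 := integral_map (μ := shapePi Ψ κ) hm.aemeasurable (f := fun y : ℝ => y)
    measurable_id.aestronglyMeasurable
  have hmeas : Measurable fun x => (k + 1) * Ψ x ^ k * shapeDensity Ψ x := by
    have := h.differentiable.continuous.measurable
    have := IsShape.measurable_density Ψ
    fun_prop
  rw [← h1, h.map_iInf_eq hg, integral_withDensity_eq_integral_toReal_smul hmeas.ennreal_ofReal
    (by simp), ← integral_const_mul]
  refine integral_congr_ae (Eventually.of_forall fun x => ?_)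
  simp only [smul_eq_mul]
  rw [ENNReal.toReal_ofReal (mul_nonneg
        (mul_nonneg (by positivity) (pow_nonneg (h.mem_Icc x).1 _)) (h.density_nonneg x))]
  ring

theorem integral_iInf_blockVars (h : IsShape Ψ) {m : ℕ} (c : Composition (m + 1)) :
    ∫ x, ⨅ i, blockVars c x i ∂shapePi Ψ (Fin (m + 1)) =
      c.length * ∫ x, x * shapeDensity Ψ x * Ψ x ^ (c.length - 1) := by
  -- The length is generalized to a free number so that it can be replaced by a successor.
  have key : ∀ (l : ℕ) (hl : 0 < l) (hle : l ≤ m + 1),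
      ∫ x, ⨅ i : Fin l, x (Fin.castLE hle i) ∂shapePi Ψ (Fin (m + 1)) =
        l * ∫ x, x * shapeDensity Ψ x * Ψ x ^ (l - 1) := by
    intro l hl hle
    obtain ⟨k, rfl⟩ := Nat.exists_eq_add_of_le' hl
    rw [h.integral_iInf_eq (Fin.castLE_injective hle)]
    push_cast; simp
  exact key _ (c.length_pos_of_pos m.succ_pos) c.length_le

/-- The binomial theorem under the integral sign. -/
theorem sum_choose_mul_moment (h : IsShape Ψ) (l r : ℕ) :
    ∑ j ∈ Finset.range (r + 1), (r.choose j : ℝ) *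
      ∫ x : ℝ, x * shapeDensity Ψ x * Ψ x ^ (l + j) * (1 - Ψ x) ^ (r - j) =
      ∫ x : ℝ, x * shapeDensity Ψ x * Ψ x ^ l := by
  simp only [← integral_const_mul]
  rw [← integral_finsetSum _ fun j _ => (h.integrable_moment _ _).const_mul _]
  refine integral_congr_ae (Eventually.of_forall fun x => ?_)
  have h1 := add_pow (Ψ x) (1 - Ψ x) r
  simp only [add_sub_cancel, one_pow] at h1
  calc _ = x * shapeDensity Ψ x * Ψ x ^ l *
        ∑ j ∈ Finset.range (r + 1), Ψ x ^ j * (1 - Ψ x) ^ (r - j) * (r.choose j : ℝ) := by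
        rw [Finset.mul_sum]
        refine Finset.sum_congr rfl fun j _ => ?_
        rw [pow_add]; ring
    _ = _ := by rw [← h1, mul_one]

/-- Interchanging the sums, the binomial coefficients for a fixed length resum to a power of `Ψ + (1
- Ψ) = 1`. The `1/ℓ` in the weight cancels the `ℓ` from the mean of the minimum. -/
theorem shapeB_eq (h : IsShape Ψ) (m : ℕ) :
    shapeB Ψ (m + 1) = ∑ c : Composition (m + 1), compWeight c *
      (c.length * ∫ x, x * shapeDensity Ψ x * Ψ x ^ (c.length - 1)) := by
  -- Here `l` stands for compositions of length `l + 1`, matching the exponent `ℓ - 1` of `Ψ`.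
  have h1 : shapeB Ψ (m + 1) = ∑ l ∈ Finset.range (m + 1), (-1) ^ (l + 2) *
      (∑ c : Composition (m + 1) with c.length = l + 1,
        ((m + 1)! / ∏ i, (c.blocksFun i)! : ℝ)) *
      ∫ x : ℝ, x * shapeDensity Ψ x * Ψ x ^ l := by
    simp only [shapeB, coeffB]
    have h2 : ∀ k ∈ Finset.range (m + 1), (∑ l ∈ Finset.Icc 1 (k + 1), (-1) ^ (l + 1) *
        ((m + 1 - l).choose (k + 1 - l) : ℝ) *
        ∑ c : Composition (m + 1) with c.length = l, ((m + 1)! / ∏ i, (c.blocksFun i)! : ℝ)) *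
        ∫ x : ℝ, x * shapeDensity Ψ x * Ψ x ^ k * (1 - Ψ x) ^ (m + 1 - 1 - k) =
        ∑ l ∈ Finset.range (m + 1), if l ≤ k then ((-1) ^ (l + 2) *
          ∑ c : Composition (m + 1) with c.length = l + 1,
            ((m + 1)! / ∏ i, (c.blocksFun i)! : ℝ)) * (((m - l).choose (k - l) : ℝ) *
          ∫ x : ℝ, x * shapeDensity Ψ x * Ψ x ^ k * (1 - Ψ x) ^ (m - k)) else 0 := by
      intro k hk
      rw [Finset.sum_mul, ← Finset.sum_filter]
      have h3 : (Finset.range (m + 1)).filter (fun l => l ≤ k) = Finset.range (k + 1) := by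
        ext l; simp only [Finset.mem_filter, Finset.mem_range] at *; omega
      rw [h3, ← Finset.Ico_succ_right_eq_Icc, Finset.sum_Ico_eq_sum_range]
      refine Finset.sum_congr (by simp) fun l _ => ?_
      rw [show 1 + l = l + 1 by ring, Nat.add_sub_add_right, Nat.add_sub_add_right,
        Nat.add_sub_cancel]
      ring
    rw [Finset.sum_congr rfl h2, Finset.sum_comm]
    refine Finset.sum_congr rfl fun l hl => ?_
    rw [← Finset.sum_filter, ← Finset.mul_sum]
    congr 1
    rw [← h.sum_choose_mul_moment l (m - l)]
    have h4 : (Finset.range (m + 1)).filter (fun k => l ≤ k) =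
        (Finset.range (m - l + 1)).image (fun j => l + j) := by
      ext k
      simp only [Finset.mem_filter, Finset.mem_range, Finset.mem_image] at *
      exact ⟨fun hk => ⟨k - l, by omega, by omega⟩, by rintro ⟨j, hj, rfl⟩; omega⟩
    rw [h4, Finset.sum_image (by intro a _ b _ hab; simpa using hab)]
    refine Finset.sum_congr rfl fun j hj => ?_
    rw [Nat.add_sub_cancel_left, Nat.sub_sub]
  have hmaps : ∀ c ∈ (Finset.univ : Finset (Composition (m + 1))),
      c.length - 1 ∈ Finset.range (m + 1) := fun c _ => by
    have := c.length_le
    have := c.length_pos_of_pos m.succ_pos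
    rw [Finset.mem_range]; omega
  rw [h1, ← Finset.sum_fiberwise_of_maps_to hmaps]
  refine Finset.sum_congr rfl fun l _ => ?_
  have h5 : (Finset.univ.filter fun c : Composition (m + 1) => c.length - 1 = l) =
      Finset.univ.filter fun c : Composition (m + 1) => c.length = l + 1 := by
    ext c
    have := c.length_pos_of_pos m.succ_pos
    simp only [Finset.mem_filter, Finset.mem_univ, true_and]; omega
  rw [h5, Finset.mul_sum, Finset.sum_mul]
  refine Finset.sum_congr rfl fun c hc => ?_
  have hc1 := (Finset.mem_filter.1 hc).2
  have hl : l = c.length - 1 := by omega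
  have h6 : l + 2 = c.length + 1 := by omega
  have h7 : (c.length : ℝ) ≠ 0 := by
    have : c.length ≠ 0 := by omega
    exact_mod_cast this
  rw [compWeight, h6, hl]
  field_simp

end IsShape

/-! ### Symmetrization onto increasing configurations -/

/-- The hyperplane `x_i = x_j` is null for the law of independent variables with density. -/
theorem IsShape.ae_injective {Ψ : ℝ → ℝ} (h : IsShape Ψ) (κ : Type*) [Fintype κ] :
    ∀ᵐ x ∂shapePi Ψ κ, Function.Injective x := by
  classical
  have h1 : ∀ i j : κ, i ≠ j → ∀ᵐ x ∂shapePi Ψ κ, x i ≠ x j := by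
    intro i j hij
    rw [h.shapePi_eq]
    refine (withDensity_absolutelyContinuous volume _).ae_le ?_
    set S : Submodule ℝ (κ → ℝ) :=
      LinearMap.ker ((LinearMap.proj i : (κ → ℝ) →ₗ[ℝ] ℝ) - LinearMap.proj j)
    have hS : S ≠ ⊤ := by
      intro hS
      have : (Pi.single i 1 : κ → ℝ) ∈ S := hS ▸ Submodule.mem_top
      simp [S, LinearMap.mem_ker, hij.symm] at this
    have h2 := Measure.addHaar_submodule volume S hS
    rw [mem_ae_iff]
    convert h2 using 2
    ext x
    simp [S, LinearMap.mem_ker, sub_eq_zero]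
  have h2 : ∀ᵐ x ∂shapePi Ψ κ, ∀ i j : κ, i ≠ j → x i ≠ x j := by
    simp only [ae_all_iff]
    exact h1
  filter_upwards [h2] with x hx i j hij
  by_contra hne
  exact hx i j hne hij

theorem measurableSet_strictMono (n : ℕ) :
    MeasurableSet {x : Fin n → ℝ | StrictMono x} := by
  have : {x : Fin n → ℝ | StrictMono x} = ⋂ i, ⋂ j, ⋂ _ : i < j, {x | x i < x j} := by
    ext x; simp [StrictMono]
  rw [this]
  refine MeasurableSet.iInter fun i => MeasurableSet.iInter fun j => MeasurableSet.iInter fun _ =>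
    measurableSet_lt (measurable_pi_apply i) (measurable_pi_apply j)

-- Exactly one permutation sorts a tuple with distinct entries, giving a partition of unity over the
-- permutations.
open scoped Classical in
theorem sum_indicator_strictMono {n : ℕ} {x : Fin n → ℝ} (hx : Function.Injective x) :
    ∑ σ : Equiv.Perm (Fin n), {y : Fin n → ℝ | StrictMono y}.indicator (fun _ => (1 : ℝ)) (x ∘ σ)
      = 1 := by
  have h1 : StrictMono (x ∘ Tuple.sort x) :=
    (Tuple.monotone_sort x).strictMono_of_injective (hx.comp (Equiv.injective _))
  rw [Finset.sum_eq_single (Tuple.sort x)]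
  · exact Set.indicator_of_mem h1 _
  · intro σ _ hσ
    refine Set.indicator_of_notMem (fun h2 => hσ ?_) _
    have h3 := Tuple.unique_monotone (StrictMono.monotone h2) h1.monotone
    exact Equiv.ext fun i => hx (congrFun h3 i)
  · simp

/-- Permutations of the coordinates preserve the product law. -/
theorem measurePreserving_comp_perm {n : ℕ} {X : Type*} [MeasurableSpace X] (μ : Measure X)
    [SigmaFinite μ] (σ : Equiv.Perm (Fin n)) :
    MeasurePreserving (MeasurableEquiv.piCongrLeft (fun _ => X) σ.symm)
      (Measure.pi fun _ : Fin n => μ) (Measure.pi fun _ : Fin n => μ) :=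
  measurePreserving_piCongrLeft (fun _ => μ) σ.symm

theorem piCongrLeft_perm_apply {n : ℕ} {X : Type*} [MeasurableSpace X] (σ : Equiv.Perm (Fin n))
    (x : Fin n → X) : MeasurableEquiv.piCongrLeft (fun _ => X) σ.symm x = x ∘ σ := by
  funext i
  have := Equiv.piCongrLeft_apply_apply (fun _ => X) σ.symm x (σ i)
  simpa [MeasurableEquiv.piCongrLeft] using this

section Symmetrization

variable {Ψ : ℝ → ℝ} {n : ℕ} {Y : Type*} [MeasurableSpace Y]

/-- The law of `n` independent variables restricted to the increasing configurations. -/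
noncomputable def orderedPi (Ψ : ℝ → ℝ) (n : ℕ) : Measure (Fin n → ℝ) :=
  (shapePi Ψ (Fin n)).restrict {x | StrictMono x}

theorem measurePreserving_prod_perm (h : IsShape Ψ) (ν : Measure Y) [SFinite ν]
    (σ : Equiv.Perm (Fin n)) :
    MeasurePreserving (fun p : Y × (Fin n → ℝ) => (p.1, p.2 ∘ σ))
      (ν.prod (shapePi Ψ (Fin n))) (ν.prod (shapePi Ψ (Fin n))) := by
  have := h.isProbabilityMeasure
  have h1 := (MeasurePreserving.id ν).prod (measurePreserving_comp_perm (shapeMeasure Ψ) σ)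
  convert h1 using 2 with p
  simp [Prod.map, piCongrLeft_perm_apply]

theorem integrable_comp_perm (h : IsShape Ψ) (ν : Measure Y) [SFinite ν]
    {G : Y × (Fin n → ℝ) → ℝ} (hG : Integrable G (ν.prod (shapePi Ψ (Fin n))))
    (σ : Equiv.Perm (Fin n)) :
    Integrable (fun p : Y × (Fin n → ℝ) => G (p.1, p.2 ∘ σ)) (ν.prod (orderedPi Ψ n)) := by
  have := h.isProbabilityMeasure
  have h1 := (measurePreserving_prod_perm h ν σ).integrable_comp_of_integrable hG
  refine h1.mono_measure ?_
  exact Measure.prod_mono le_rfl Measure.restrict_le_self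

/-- Ties have probability zero, so the sorting partition of unity may be inserted; invariance of the
product law under permutations then brings each piece to the increasing chamber. -/
theorem integral_symmetrize (h : IsShape Ψ) (ν : Measure Y) [SFinite ν]
    {G : Y × (Fin n → ℝ) → ℝ} (hG : Integrable G (ν.prod (shapePi Ψ (Fin n)))) :
    ∫ p, G p ∂(ν.prod (shapePi Ψ (Fin n))) =
      ∫ p, ∑ σ : Equiv.Perm (Fin n), G (p.1, p.2 ∘ σ) ∂(ν.prod (orderedPi Ψ n)) := by
  classical
  have := h.isProbabilityMeasure
  set S : Set (Fin n → ℝ) := {x | StrictMono x} with hS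
  have hSm : MeasurableSet S := measurableSet_strictMono n
  have hprod : ν.prod (orderedPi Ψ n) = (ν.prod (shapePi Ψ (Fin n))).restrict (Set.univ ×ˢ S) := by
    rw [orderedPi, ← Measure.prod_restrict, Measure.restrict_univ]
  have hUm : MeasurableSet ((Set.univ : Set Y) ×ˢ S) := MeasurableSet.univ.prod hSm
  have hae : ∀ᵐ p ∂(ν.prod (shapePi Ψ (Fin n))), Function.Injective p.2 :=
    Measure.quasiMeasurePreserving_snd.ae (h.ae_injective (Fin n))
  have hone : Measurable (S.indicator fun _ => (1 : ℝ)) := measurable_const.indicator hSm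
  have hint : ∀ σ : Equiv.Perm (Fin n), Integrable (fun p : Y × (Fin n → ℝ) =>
      S.indicator (fun _ => (1 : ℝ)) (p.2 ∘ σ) * G p) (ν.prod (shapePi Ψ (Fin n))) := by
    intro σ
    refine hG.bdd_mul (c := 1) ?_ (Eventually.of_forall fun p => ?_)
    · refine (hone.comp ?_).aestronglyMeasurable
      exact (measurable_pi_lambda _ fun i => measurable_pi_apply _).comp measurable_snd
    · rw [Set.indicator_apply]; split_ifs <;> simp
  calc ∫ p, G p ∂(ν.prod (shapePi Ψ (Fin n)))
      = ∫ p, ∑ σ : Equiv.Perm (Fin n), S.indicator (fun _ => (1 : ℝ)) (p.2 ∘ σ) * G p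
          ∂(ν.prod (shapePi Ψ (Fin n))) := by
        refine integral_congr_ae ?_
        filter_upwards [hae] with p hp
        rw [← Finset.sum_mul, sum_indicator_strictMono hp, one_mul]
    _ = ∑ σ : Equiv.Perm (Fin n), ∫ p, S.indicator (fun _ => (1 : ℝ)) (p.2 ∘ σ) * G p
          ∂(ν.prod (shapePi Ψ (Fin n))) := integral_finsetSum _ fun σ _ => hint σ
    _ = ∑ σ : Equiv.Perm (Fin n), ∫ p, S.indicator (fun _ => (1 : ℝ)) p.2 * G (p.1, p.2 ∘ σ.symm)
          ∂(ν.prod (shapePi Ψ (Fin n))) := by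
        refine Finset.sum_congr rfl fun σ _ => ?_
        -- Substituting `x ∘ σ⁻¹` moves the permutation from the indicator onto `G`.
        have hmp := measurePreserving_prod_perm h ν σ.symm
        conv_lhs => rw [← hmp.map_eq]
        rw [integral_map hmp.measurable.aemeasurable
          (by rw [hmp.map_eq]; exact (hint σ).aestronglyMeasurable)]
        refine integral_congr_ae (Eventually.of_forall fun p => ?_)
        simp [Function.comp_assoc]
    _ = ∑ σ : Equiv.Perm (Fin n), ∫ p, G (p.1, p.2 ∘ σ.symm) ∂(ν.prod (orderedPi Ψ n)) := by
        refine Finset.sum_congr rfl fun σ _ => ?_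
        rw [hprod, ← integral_indicator hUm]
        refine integral_congr_ae (Eventually.of_forall fun p => ?_)
        by_cases hp : p.2 ∈ S
        · simp [hp]
        · simp [hp]
    _ = ∑ σ : Equiv.Perm (Fin n), ∫ p, G (p.1, p.2 ∘ σ) ∂(ν.prod (orderedPi Ψ n)) :=
        Equiv.sum_comp (Equiv.inv (Equiv.Perm (Fin n)))
          fun σ => ∫ p, G (p.1, p.2 ∘ σ) ∂(ν.prod (orderedPi Ψ n))
    _ = _ := (integral_finsetSum _ fun σ _ => integrable_comp_perm h ν hG σ).symm

/-- Odd functions of the frequencies have vanishing integral. -/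
theorem integral_eq_zero_of_odd {m : ℕ} {Z : Type*} [MeasurableSpace Z] (π : Measure Z) [SFinite π]
    {G : (Fin m → ℝ) × Z → ℝ} (hG : ∀ p, G (-p.1, p.2) = -G p) :
    ∫ p, G p ∂((volume : Measure (Fin m → ℝ)).prod π) = 0 := by
  have hmp : MeasurePreserving ((MeasurableEquiv.neg (Fin m → ℝ)).prodCongr
      (MeasurableEquiv.refl Z)) ((volume : Measure (Fin m → ℝ)).prod π)
      ((volume : Measure (Fin m → ℝ)).prod π) :=
    (Measure.measurePreserving_neg volume).prod (MeasurePreserving.id π)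
  have h1 := hmp.integral_comp' G
  have h2 : ∀ p, G ((MeasurableEquiv.neg (Fin m → ℝ)).prodCongr (MeasurableEquiv.refl Z) p) =
      -G p := fun p => hG p
  simp only [h2, integral_neg] at h1
  linarith

end Symmetrization

/-! ### Identification of the limit -/

section Limit

variable {Ψ f : ℝ → ℝ} {m : ℕ}

theorem blockFreqs_neg (c : Composition (m + 1)) (v : Fin m → ℝ) (i : Fin c.length) :
    blockFreqs c (-v) i = -blockFreqs c v i := by
  simp only [blockFreqs, blockSum, zeroSum_neg, Finset.sum_neg_distrib]

theorem re_hyperplaneProd_neg (f : ℝ → ℝ) (v : Fin m → ℝ) :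
    (hyperplaneProd f (-v)).re = (hyperplaneProd f v).re := by
  rw [hyperplaneProd_neg, Complex.conj_re]

theorem integrable_re_mul (h : IsShape Ψ) (hf : IsH1Compact f)
    {G : (Fin m → ℝ) × (Fin (m + 1) → ℝ) → ℝ} (hG : Measurable G) {C : ℝ}
    (hle : ∀ p, |G p| ≤ C * linearWeight p) :
    Integrable (fun p => (hyperplaneProd f p.1).re * G p)
      (volume.prod (shapePi Ψ (Fin (m + 1)))) := by
  refine (integrable_hyperplaneProd_mul h hf hG hle).re.congr (Eventually.of_forall fun p => ?_)
  simp

theorem blockFreqs_le_linearWeight (c : Composition (m + 1)) {t : ℝ} (ht : 0 ≤ t)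
    (p : (Fin m → ℝ) × (Fin (m + 1) → ℝ)) :
    2 * ∑ i, |blockFreqs c p.1 i| + 2 * ∑ i, |t * blockVars c p.2 i| ≤
      2 * ((m + 1) * (m + 1) + t) * linearWeight p := by
  have h1 := blocks_le_linearWeight c ht (δ := 0) zero_le_one p
  rw [mul_zero, add_zero] at h1
  exact h1

/-- The minimum of `t x_i - Λ_i` over the blocks. -/
noncomputable def blockMin (c : Composition (m + 1)) (t : ℝ)
    (p : (Fin m → ℝ) × (Fin (m + 1) → ℝ)) : ℝ :=
  ⨅ i, (-blockFreqs c p.1 i + t * blockVars c p.2 i)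

@[fun_prop]
theorem measurable_blockMin (c : Composition (m + 1)) (t : ℝ) : Measurable (blockMin c t) := by
  unfold blockMin
  refine Measurable.iInf fun i => ?_
  fun_prop

theorem abs_blockMin_le (c : Composition (m + 1)) {t : ℝ} (ht : 0 ≤ t)
    (p : (Fin m → ℝ) × (Fin (m + 1) → ℝ)) :
    |blockMin c t p| ≤ 2 * ((m + 1) * (m + 1) + t) * linearWeight p := by
  have h1 := blockFreqs_le_linearWeight c ht p
  have h2 : |blockMin c t p| ≤ ∑ i, |blockFreqs c p.1 i| + ∑ i, |t * blockVars c p.2 i| := by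
    refine (abs_iInf_le_sum _).trans ?_
    rw [← Finset.sum_add_distrib]
    refine Finset.sum_le_sum fun i _ => (abs_add_le _ _).trans_eq ?_
    rw [abs_neg]
  have h3 : 0 ≤ ∑ i, |blockFreqs c p.1 i| := by positivity
  have h4 : 0 ≤ ∑ i, |t * blockVars c p.2 i| := by positivity
  linarith

/-- The reflection `u ↦ -u` exchanges the two minima and preserves `Re ∏ f̂(u_i)`, so both
contribute equally. -/
theorem re_integral_centeredOverlap (h : IsShape Ψ) (hf : IsH1Compact f)
    (c : Composition (m + 1)) {t : ℝ} (ht : 0 ≤ t) :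
    (∫ p, hyperplaneProd f p.1 * ((centeredOverlap (blockFreqs c p.1)
        fun i => t * blockVars c p.2 i : ℝ) : ℂ) ∂(volume.prod (shapePi Ψ (Fin (m + 1))))).re =
      2 * ∫ p, (hyperplaneProd f p.1).re * blockMin c t p
        ∂(volume.prod (shapePi Ψ (Fin (m + 1)))) := by
  have hprob := h.isProbabilityMeasure
  have hrefl : ∀ p : (Fin m → ℝ) × (Fin (m + 1) → ℝ), centeredOverlap (blockFreqs c p.1)
      (fun i => t * blockVars c p.2 i) = blockMin c t (-p.1, p.2) + blockMin c t p := by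
    intro p
    simp only [centeredOverlap, blockMin, blockFreqs_neg, neg_neg]
  have hmneg : Measurable fun p : (Fin m → ℝ) × (Fin (m + 1) → ℝ) => (-p.1, p.2) :=
    measurable_fst.neg.prodMk measurable_snd
  have hwneg : ∀ p : (Fin m → ℝ) × (Fin (m + 1) → ℝ),
      linearWeight (-p.1, p.2) = linearWeight p := fun p => by simp [linearWeight]
  have hm1 := measurable_blockMin c t
  have hm2 : Measurable fun p : (Fin m → ℝ) × (Fin (m + 1) → ℝ) => blockMin c t (-p.1, p.2) :=
    hm1.comp hmneg
  have hb2 : ∀ p : (Fin m → ℝ) × (Fin (m + 1) → ℝ), |blockMin c t (-p.1, p.2)| ≤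
      2 * ((m + 1) * (m + 1) + t) * linearWeight p := fun p => by
    rw [← hwneg p]; exact abs_blockMin_le c ht _
  have hi1 := integrable_re_mul h hf hm1 (abs_blockMin_le c ht)
  have hi2 := integrable_re_mul h hf hm2 hb2
  have hI := (integrable_hyperplaneProd_mul h hf hm1 (abs_blockMin_le c ht)).add
    (integrable_hyperplaneProd_mul h hf hm2 hb2)
  have hodd := integral_eq_zero_of_odd (shapePi Ψ (Fin (m + 1)))
    (G := fun p => (hyperplaneProd f p.1).re * blockMin c t (-p.1, p.2) -
      (hyperplaneProd f p.1).re * blockMin c t p) (fun p => by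
        simp only [re_hyperplaneProd_neg, neg_neg]; ring)
  rw [integral_sub hi2 hi1, sub_eq_zero] at hodd
  have hre := integral_re (𝕜 := ℂ) hI
  simp only [RCLike.re_to_complex] at hre
  have e1 : ∀ p : (Fin m → ℝ) × (Fin (m + 1) → ℝ), hyperplaneProd f p.1 *
      ((centeredOverlap (blockFreqs c p.1) fun i => t * blockVars c p.2 i : ℝ) : ℂ) =
      ((fun p : (Fin m → ℝ) × (Fin (m + 1) → ℝ) => hyperplaneProd f p.1 * (blockMin c t p : ℂ)) +
        fun p : (Fin m → ℝ) × (Fin (m + 1) → ℝ) =>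
          hyperplaneProd f p.1 * (blockMin c t (-p.1, p.2) : ℂ)) p := by
    intro p
    rw [hrefl, Pi.add_apply]; push_cast; ring
  simp only [e1]
  rw [← hre]
  have e2 : ∀ p : (Fin m → ℝ) × (Fin (m + 1) → ℝ),
      (((fun p : (Fin m → ℝ) × (Fin (m + 1) → ℝ) => hyperplaneProd f p.1 * (blockMin c t p : ℂ)) +
        fun p : (Fin m → ℝ) × (Fin (m + 1) → ℝ) =>
          hyperplaneProd f p.1 * (blockMin c t (-p.1, p.2) : ℂ)) p).re =
      (hyperplaneProd f p.1).re * blockMin c t p +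
        (hyperplaneProd f p.1).re * blockMin c t (-p.1, p.2) := by
    intro p; simp [Complex.mul_re]
  simp only [e2]
  rw [integral_add hi1 hi2, hodd]
  ring

theorem ciSup_eq_neg_iInf {ι : Type*} [Finite ι] [Nonempty ι] (g : ι → ℝ) (a : ℝ) :
    ⨆ i, (a - g i) = a - ⨅ i, g i := by
  refine le_antisymm (ciSup_le fun i => sub_le_sub_left (ciInf_le (Set.finite_range g).bddBelow i) a)
    ?_
  obtain ⟨i, hi⟩ := exists_eq_ciInf_of_finite (f := g)
  rw [← hi]
  exact le_ciSup (Set.finite_range fun i => a - g i).bddAbove i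

theorem argMinIndex_le (c : Composition (m + 1)) (σ : Equiv.Perm (Fin (m + 1)))
    (i : Fin c.length) :
    σ (Fin.castLE c.length_le (argMinIndex m.succ_pos c σ)) ≤ σ (Fin.castLE c.length_le i) := by
  unfold argMinIndex
  exact Function.argmin_le (fun i : Fin c.length => σ (Fin.castLE c.length_le i)) i

/-- The symmetrized minimum in terms of `G`, for increasing configurations. -/
theorem sum_blockMin_eq (c : Composition (m + 1)) (t : ℝ)
    {p : (Fin m → ℝ) × (Fin (m + 1) → ℝ)} (hp : StrictMono p.2) :
    ∑ σ : Equiv.Perm (Fin (m + 1)), blockMin c t (p.1, p.2 ∘ σ) =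
      -compG m.succ_pos t c (zeroSum (n := m + 1) p.1) p.2 -
        ∑ σ : Equiv.Perm (Fin (m + 1)), blockFreqs c p.1 (argMinIndex m.succ_pos c σ) +
        t * ∑ σ : Equiv.Perm (Fin (m + 1)), ⨅ i, blockVars c (p.2 ∘ σ) i := by
  rw [compG, Finset.mul_sum, ← Finset.sum_neg_distrib, ← Finset.sum_sub_distrib,
    ← Finset.sum_add_distrib]
  refine Finset.sum_congr rfl fun σ _ => ?_
  set s := argMinIndex m.succ_pos c σ with hs
  -- For increasing `x` the smallest `x_{σ(i)}` sits where `σ` is smallest. This is the reason for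
  -- singling out the index `s` and for working in the increasing chamber.
  have h1 : ⨅ i, blockVars c (p.2 ∘ σ) i = p.2 (σ (Fin.castLE c.length_le s)) := by
    refine le_antisymm (ciInf_le (Set.finite_range _).bddBelow s) (le_ciInf fun i => ?_)
    exact hp.monotone (argMinIndex_le c σ i)
  have h2 : ∀ i : Fin c.length, blockLambda c (zeroSum (n := m + 1) p.1) i s -
      t * (p.2 (σ (Fin.castLE c.length_le i)) - p.2 (σ (Fin.castLE c.length_le s))) =
      (-blockFreqs c p.1 s + t * p.2 (σ (Fin.castLE c.length_le s))) -
        (-blockFreqs c p.1 i + t * blockVars c (p.2 ∘ σ) i) := by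
    intro i
    simp only [blockLambda, blockFreqs, blockVars, Function.comp_apply]; ring
  simp only [h2]
  rw [ciSup_eq_neg_iInf, h1, blockMin]
  ring

/-- Each maximum is a difference of two quantities dominated by the linear weight, and the weight is
invariant under permuting `x`. -/
theorem abs_compG_le (c : Composition (m + 1)) {t : ℝ} (ht : 0 ≤ t)
    (p : (Fin m → ℝ) × (Fin (m + 1) → ℝ)) :
    |compG m.succ_pos t c (zeroSum (n := m + 1) p.1) p.2| ≤
      (m + 1)! * (4 * ((m + 1) * (m + 1) + t)) * linearWeight p := by
  have hterm : ∀ σ : Equiv.Perm (Fin (m + 1)),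
      |⨆ i : Fin c.length, (blockLambda c (zeroSum (n := m + 1) p.1) i (argMinIndex m.succ_pos c σ) -
      t * (p.2 (σ (Fin.castLE c.length_le i)) -
        p.2 (σ (Fin.castLE c.length_le (argMinIndex m.succ_pos c σ)))))| ≤
      4 * ((m + 1) * (m + 1) + t) * linearWeight p := by
    intro σ
    set s := argMinIndex m.succ_pos c σ
    have hw : linearWeight (p.1, p.2 ∘ σ) = linearWeight p := by
      simp only [linearWeight, Function.comp_apply]
      rw [Equiv.sum_comp σ fun i => |p.2 i|]
    have h2 : ∀ i : Fin c.length, blockLambda c (zeroSum (n := m + 1) p.1) i s -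
        t * (p.2 (σ (Fin.castLE c.length_le i)) - p.2 (σ (Fin.castLE c.length_le s))) =
        (-blockFreqs c p.1 s + t * blockVars c (p.2 ∘ σ) s) -
          (-blockFreqs c p.1 i + t * blockVars c (p.2 ∘ σ) i) := by
      intro i
      simp only [blockLambda, blockFreqs, blockVars, Function.comp_apply]; ring
    simp only [h2]
    rw [ciSup_eq_neg_iInf]
    have h3 := abs_blockMin_le c ht (p.1, p.2 ∘ σ)
    have h4 := blockFreqs_le_linearWeight c ht (p.1, p.2 ∘ σ)
    rw [hw] at h3 h4
    have h5 := Finset.single_le_sum (f := fun i => |blockFreqs c p.1 i|)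
      (fun _ _ => abs_nonneg _) (Finset.mem_univ s)
    have h6 := Finset.single_le_sum (f := fun i => |t * blockVars c (p.2 ∘ σ) i|)
      (fun _ _ => abs_nonneg _) (Finset.mem_univ s)
    have h7 : |-blockFreqs c p.1 s + t * blockVars c (p.2 ∘ σ) s| ≤
        2 * ((m + 1) * (m + 1) + t) * linearWeight p := by
      have h8 := abs_add_le (-blockFreqs c p.1 s) (t * blockVars c (p.2 ∘ σ) s)
      rw [abs_neg] at h8
      have h9 := abs_nonneg (blockFreqs c p.1 s)
      have h10 := abs_nonneg (t * blockVars c (p.2 ∘ σ) s)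
      linarith
    have h11 := abs_sub (-blockFreqs c p.1 s + t * blockVars c (p.2 ∘ σ) s)
      (blockMin c t (p.1, p.2 ∘ σ))
    rw [blockMin] at h11 h3
    linarith
  rw [compG]
  refine (Finset.abs_sum_le_sum_abs _ _).trans ((Finset.sum_le_sum fun σ _ => hterm σ).trans_eq ?_)
  rw [Finset.sum_const, Finset.card_univ, Fintype.card_perm, Fintype.card_fin, nsmul_eq_mul]
  ring

theorem measurable_compG (c : Composition (m + 1)) (t : ℝ) :
    Measurable fun p : (Fin m → ℝ) × (Fin (m + 1) → ℝ) =>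
      compG m.succ_pos t c (zeroSum (n := m + 1) p.1) p.2 := by
  unfold compG
  refine Finset.measurable_sum _ fun σ _ => Measurable.iSup fun i => ?_
  have h1 : ∀ i, Measurable fun p : (Fin m → ℝ) × (Fin (m + 1) → ℝ) =>
      blockSum c (zeroSum (n := m + 1) p.1) i := fun i =>
    (continuous_blockSum c i).measurable.comp measurable_fst
  unfold blockLambda
  exact ((h1 _).sub (h1 _)).sub (by fun_prop)

theorem prod_orderedPi_eq (h : IsShape Ψ) :
    (volume : Measure (Fin m → ℝ)).prod (orderedPi Ψ (m + 1)) =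
      (((volume : Measure (Fin m → ℝ)).prod (volume : Measure (Fin (m + 1) → ℝ))).restrict
        (Set.univ ×ˢ {x | StrictMono x})).withDensity
        fun p => ENNReal.ofReal (∏ i, shapeDensity Ψ (p.2 i)) := by
  have hm : Measurable fun x : Fin (m + 1) → ℝ =>
      ENNReal.ofReal (∏ i, shapeDensity Ψ (x i)) := by
    have := IsShape.measurable_density Ψ
    fun_prop
  have := h.isProbabilityMeasure
  have hs : SFinite ((volume.restrict {x : Fin (m + 1) → ℝ | StrictMono x}).withDensity
    fun x => ENNReal.ofReal (∏ i, shapeDensity Ψ (x i))) := inferInstance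
  rw [orderedPi, h.shapePi_eq, restrict_withDensity (measurableSet_strictMono _),
    prod_withDensity_right hm, ← Measure.prod_restrict, Measure.restrict_univ]

theorem limitIntegrand_eq (hm : 0 < m + 1) (Ψ f : ℝ → ℝ) (t : ℝ)
    (p : (Fin m → ℝ) × (Fin (m + 1) → ℝ)) :
    limitIntegrand hm Ψ f t p = (∏ i, shapeDensity Ψ (p.2 i)) *
      ((hyperplaneProd f p.1).re * ∑ c : Composition (m + 1), compWeight c *
        compG hm t c (zeroSum (n := m + 1) p.1) p.2) := by
  have h1 : (∏ i, 𝓕 (fun y : ℝ => (f y : ℂ)) (zeroSum (n := m + 1) p.1 i) *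
      (shapeDensity Ψ (p.2 i) : ℂ)) =
      hyperplaneProd f p.1 * ((∏ i, shapeDensity Ψ (p.2 i) : ℝ) : ℂ) := by
    rw [Finset.prod_mul_distrib]
    push_cast
    rfl
  unfold limitIntegrand
  rw [h1, Complex.re_mul_ofReal]
  ring

theorem integrable_prod_orderedPi_iff (h : IsShape Ψ)
    (G : (Fin m → ℝ) × (Fin (m + 1) → ℝ) → ℝ) :
    Integrable G ((volume : Measure (Fin m → ℝ)).prod (orderedPi Ψ (m + 1))) ↔
      IntegrableOn (fun p => (∏ i, shapeDensity Ψ (p.2 i)) * G p)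
        (Set.univ ×ˢ {x | StrictMono x}) (volume.prod volume) := by
  have hm : Measurable fun p : (Fin m → ℝ) × (Fin (m + 1) → ℝ) =>
      ENNReal.ofReal (∏ i, shapeDensity Ψ (p.2 i)) := by
    have := IsShape.measurable_density Ψ
    fun_prop
  rw [prod_orderedPi_eq h, integrable_withDensity_iff_integrable_smul' hm (by simp), IntegrableOn]
  simp only [ENNReal.toReal_ofReal (Finset.prod_nonneg fun i _ => h.density_nonneg _), smul_eq_mul]

theorem integral_prod_orderedPi (h : IsShape Ψ)
    (G : (Fin m → ℝ) × (Fin (m + 1) → ℝ) → ℝ) :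
    ∫ p, G p ∂((volume : Measure (Fin m → ℝ)).prod (orderedPi Ψ (m + 1))) =
      ∫ p in Set.univ ×ˢ {x | StrictMono x}, (∏ i, shapeDensity Ψ (p.2 i)) * G p
        ∂(volume.prod volume) := by
  have hm : Measurable fun p : (Fin m → ℝ) × (Fin (m + 1) → ℝ) =>
      ENNReal.ofReal (∏ i, shapeDensity Ψ (p.2 i)) := by
    have := IsShape.measurable_density Ψ
    fun_prop
  rw [prod_orderedPi_eq h, integral_withDensity_eq_integral_toReal_smul hm (by simp)]
  simp only [ENNReal.toReal_ofReal (Finset.prod_nonneg fun i _ => h.density_nonneg _), smul_eq_mul]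

theorem integrable_re_mul_compG (h : IsShape Ψ) (hf : IsH1Compact f) (c : Composition (m + 1))
    {t : ℝ} (ht : 0 ≤ t) :
    Integrable (fun p : (Fin m → ℝ) × (Fin (m + 1) → ℝ) => (hyperplaneProd f p.1).re *
      compG m.succ_pos t c (zeroSum (n := m + 1) p.1) p.2)
      (volume.prod (orderedPi Ψ (m + 1))) := by
  have := h.isProbabilityMeasure
  exact (integrable_re_mul h hf (measurable_compG c t) (abs_compG_le c ht)).mono_measure
    (Measure.prod_mono le_rfl Measure.restrict_le_self)

theorem integrableOn_limitIntegrand (h : IsShape Ψ) (hf : IsH1Compact f) {t : ℝ} (ht : 0 ≤ t) :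
    IntegrableOn (limitIntegrand m.succ_pos Ψ f t) (limitDomain (m + 1)) := by
  have h1 : Integrable (fun p : (Fin m → ℝ) × (Fin (m + 1) → ℝ) => (hyperplaneProd f p.1).re *
      ∑ c : Composition (m + 1), compWeight c *
        compG m.succ_pos t c (zeroSum (n := m + 1) p.1) p.2)
      (volume.prod (orderedPi Ψ (m + 1))) := by
    have := integrable_finsetSum Finset.univ fun (c : Composition (m + 1)) _ =>
      (integrable_re_mul_compG h hf c ht).const_mul (compWeight c)
    refine this.congr (Eventually.of_forall fun p => ?_)
    simp only [Finset.mul_sum]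
    exact Finset.sum_congr rfl fun c _ => by ring
  rw [integrable_prod_orderedPi_iff h] at h1
  exact h1.congr (Eventually.of_forall fun p => (limitIntegrand_eq m.succ_pos Ψ f t p).symm)

theorem integral_limitIntegrand (h : IsShape Ψ) (hf : IsH1Compact f) {t : ℝ} (ht : 0 ≤ t) :
    ∫ p in limitDomain (m + 1), limitIntegrand m.succ_pos Ψ f t p =
      ∑ c : Composition (m + 1), compWeight c *
        ∫ p, (hyperplaneProd f p.1).re * compG m.succ_pos t c (zeroSum (n := m + 1) p.1) p.2
          ∂((volume : Measure (Fin m → ℝ)).prod (orderedPi Ψ (m + 1))) := by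
  simp only [← integral_const_mul]
  rw [← integral_finsetSum _ fun c _ => (integrable_re_mul_compG h hf c ht).const_mul _,
    integral_prod_orderedPi h]
  refine integral_congr_ae (Eventually.of_forall fun p => ?_)
  refine (limitIntegrand_eq m.succ_pos Ψ f t p).trans ?_
  simp only [Finset.mul_sum]
  exact Finset.sum_congr rfl fun c _ => by ring

/-- The contribution of one composition to the limit. -/
theorem integral_blockMin (h : IsShape Ψ) (hf : IsH1Compact f) (c : Composition (m + 1)) {t : ℝ}
    (ht : 0 ≤ t) :
    ∫ p, (hyperplaneProd f p.1).re * blockMin c t p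
        ∂(volume.prod (shapePi Ψ (Fin (m + 1)))) =
      -∫ p, (hyperplaneProd f p.1).re * compG m.succ_pos t c (zeroSum (n := m + 1) p.1) p.2
          ∂((volume : Measure (Fin m → ℝ)).prod (orderedPi Ψ (m + 1))) +
        t * ((∫ x, f x ^ (m + 1)) *
          (c.length * ∫ x, x * shapeDensity Ψ x * Ψ x ^ (c.length - 1))) := by
  have hprob := h.isProbabilityMeasure
  have hfin : IsFiniteMeasure (orderedPi Ψ (m + 1)) := by unfold orderedPi; infer_instance
  have hi := integrable_re_mul h hf (measurable_blockMin c t) (abs_blockMin_le c ht)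
  have hvarm : Measurable fun p : (Fin m → ℝ) × (Fin (m + 1) → ℝ) => ⨅ i, blockVars c p.2 i :=
    Measurable.iInf fun i => (measurable_blockVars c i).comp measurable_snd
  have hvarb : ∀ p : (Fin m → ℝ) × (Fin (m + 1) → ℝ), |⨅ i, blockVars c p.2 i| ≤
      1 * linearWeight p := by
    intro p
    have h1 := (abs_iInf_le_sum _).trans (sum_abs_blockVars_le c p.2)
    have h2 : 0 ≤ ∑ j, |p.1 j| := by positivity
    unfold linearWeight
    linarith
  have hivar := integrable_re_mul h hf hvarm hvarb
  have hG := integrable_re_mul_compG h hf c ht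
  have hL : Integrable (fun p : (Fin m → ℝ) × (Fin (m + 1) → ℝ) => (hyperplaneProd f p.1).re *
      ∑ σ : Equiv.Perm (Fin (m + 1)), blockFreqs c p.1 (argMinIndex m.succ_pos c σ))
      (volume.prod (orderedPi Ψ (m + 1))) := by
    have : ∀ i, Integrable (fun p : (Fin m → ℝ) × (Fin (m + 1) → ℝ) => (hyperplaneProd f p.1).re *
      blockFreqs c p.1 i) (volume.prod (orderedPi Ψ (m + 1))) := by
      intro i
      refine (integrable_re_mul h hf (C := (m + 1)) (by fun_prop) fun p => ?_).mono_measure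
        (Measure.prod_mono le_rfl Measure.restrict_le_self)
      refine (abs_blockSum_le c p.1 i).trans (mul_le_mul_of_nonneg_left ?_ (by positivity))
      have h2 : 0 ≤ ∑ j, |p.2 j| := by positivity
      unfold linearWeight
      linarith
    simp only [Finset.mul_sum]
    exact integrable_finsetSum _ fun σ _ => this _
  have hV := integrable_finsetSum Finset.univ fun (σ : Equiv.Perm (Fin (m + 1))) _ =>
    integrable_comp_perm h volume hivar σ
  -- The index `s` depends only on `σ`, so this term is linear in `u` against an even weight and
  -- drops out.
  have hodd := integral_eq_zero_of_odd (orderedPi Ψ (m + 1))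
    (G := fun p => (hyperplaneProd f p.1).re *
      ∑ σ : Equiv.Perm (Fin (m + 1)), blockFreqs c p.1 (argMinIndex m.succ_pos c σ)) (fun p => by
        simp only [re_hyperplaneProd_neg, blockFreqs_neg, Finset.sum_neg_distrib]; ring)
  have hmin : ∫ p, ∑ σ : Equiv.Perm (Fin (m + 1)), (hyperplaneProd f p.1).re *
      (⨅ i, blockVars c (p.2 ∘ σ) i) ∂((volume : Measure (Fin m → ℝ)).prod (orderedPi Ψ (m + 1))) =
      (∫ x, f x ^ (m + 1)) * (c.length * ∫ x, x * shapeDensity Ψ x * Ψ x ^ (c.length - 1)) := by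
    -- Undoing the symmetrization restores independence: frequencies and block variables separate
    -- into `∫ f^n` times the mean of a minimum.
    rw [← integral_symmetrize h volume hivar, integral_prod_mul (fun v => (hyperplaneProd f v).re)
      (fun x => ⨅ i, blockVars c x i), h.integral_iInf_blockVars]
    congr 1
    have h3 := integral_re (𝕜 := ℂ) (hf.integrable_hyperplaneProd (m := m))
    simp only [RCLike.re_to_complex] at h3
    rw [h3, hf.integral_hyperplaneProd, Complex.ofReal_re]
  have hdom : ∀ᵐ p ∂((volume : Measure (Fin m → ℝ)).prod (orderedPi Ψ (m + 1))),
      StrictMono p.2 :=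
    Measure.quasiMeasurePreserving_snd.ae (ae_restrict_mem (measurableSet_strictMono _))
  rw [integral_symmetrize h volume hi, ← hmin, ← integral_const_mul, ← integral_neg]
  have hsplit : ∀ᵐ p ∂((volume : Measure (Fin m → ℝ)).prod (orderedPi Ψ (m + 1))),
      ∑ σ : Equiv.Perm (Fin (m + 1)), (hyperplaneProd f p.1).re * blockMin c t (p.1, p.2 ∘ σ) =
      -((hyperplaneProd f p.1).re * compG m.succ_pos t c (zeroSum (n := m + 1) p.1) p.2) -
        (hyperplaneProd f p.1).re *
          ∑ σ : Equiv.Perm (Fin (m + 1)), blockFreqs c p.1 (argMinIndex m.succ_pos c σ) +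
        t * ∑ σ : Equiv.Perm (Fin (m + 1)), (hyperplaneProd f p.1).re *
          ⨅ i, blockVars c (p.2 ∘ σ) i := by
    filter_upwards [hdom] with p hp
    rw [← Finset.mul_sum, sum_blockMin_eq c t hp, ← Finset.mul_sum]
    ring
  have a1 : Integrable (fun p : (Fin m → ℝ) × (Fin (m + 1) → ℝ) => -((hyperplaneProd f p.1).re *
      compG m.succ_pos t c (zeroSum (n := m + 1) p.1) p.2)) (volume.prod (orderedPi Ψ (m + 1))) :=
    hG.neg
  have a2 : Integrable (fun p : (Fin m → ℝ) × (Fin (m + 1) → ℝ) =>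
      t * ∑ σ : Equiv.Perm (Fin (m + 1)), (hyperplaneProd f p.1).re *
        ⨅ i, blockVars c (p.2 ∘ σ) i) (volume.prod (orderedPi Ψ (m + 1))) := hV.const_mul t
  rw [integral_congr_ae hsplit, integral_add (by exact a1.sub hL) a2, integral_sub a1 hL, hodd,
    sub_zero]

theorem re_sum_eq_limitCumulant (h : IsShape Ψ) (hf : IsH1Compact f) {t : ℝ} (ht : 0 ≤ t) :
    (∑ c : Composition (m + 1), (compWeight c : ℂ) *
        ∫ p, hyperplaneProd f p.1 * ((centeredOverlap (blockFreqs c p.1)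
        fun i => t * blockVars c p.2 i : ℝ) : ℂ) ∂(volume.prod (shapePi Ψ (Fin (m + 1))))).re =
      limitCumulant m.succ_pos Ψ f t := by
  rw [Complex.re_sum]
  simp only [Complex.re_ofReal_mul, re_integral_centeredOverlap h hf _ ht,
    integral_blockMin h hf _ ht]
  rw [limitCumulant, integral_limitIntegrand h hf ht, h.shapeB_eq, Finset.mul_sum, Finset.mul_sum,
    Finset.sum_mul, ← Finset.sum_sub_distrib]
  refine Finset.sum_congr rfl fun c _ => ?_
  ring

end Limit

/-! ### Fredholm coefficients and the Plemelj recursion -/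

section Fredholm

/-- The integral of `F` against the product weight `g(z_1) ⋯ g(z_k)`. -/
noncomputable def weightedIntegral (g : ℝ → ℝ) {k : ℕ} (F : (Fin k → ℝ) → ℝ) : ℝ :=
  ∫ z : Fin k → ℝ, (∏ i, g (z i)) * F z

variable {g : ℝ → ℝ}

theorem integrable_prod_mul_of_continuous (hg : Continuous g) (hgc : HasCompactSupport g) {k : ℕ}
    {F : (Fin k → ℝ) → ℝ} (hF : Continuous F) : Integrable fun z => (∏ i, g (z i)) * F z := by
  refine Continuous.integrable_of_hasCompactSupport (by fun_prop) ?_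
  refine HasCompactSupport.intro (isCompact_univ_pi fun _ : Fin k => hgc) fun z hz => ?_
  simp only [Set.mem_pi, Set.mem_univ, true_imp_iff, not_forall] at hz
  obtain ⟨i, hi⟩ := hz
  rw [Finset.prod_eq_zero (Finset.mem_univ i) (image_eq_zero_of_notMem_tsupport (f := g) hi),
    zero_mul]

theorem weightedIntegral_zero (F : (Fin 0 → ℝ) → ℝ) : weightedIntegral g F = F Fin.elim0 := by
  rw [weightedIntegral, volume_pi, Measure.pi_of_empty _ Fin.elim0]
  simp

theorem weightedIntegral_const_mul {k : ℕ} (a : ℝ) (F : (Fin k → ℝ) → ℝ) :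
    weightedIntegral g (fun z => a * F z) = a * weightedIntegral g F := by
  rw [weightedIntegral, weightedIntegral, ← integral_const_mul]
  exact integral_congr_ae (Eventually.of_forall fun z => by simp only; ring)

/-- Integrating out one variable. -/
theorem weightedIntegral_insertNth (hg : Continuous g) (hgc : HasCompactSupport g) {k : ℕ}
    {F : (Fin (k + 1) → ℝ) → ℝ} (hF : Continuous F) (j : Fin (k + 1)) :
    Integrable (fun s => g s * weightedIntegral g fun z => F (j.insertNth s z)) ∧
    weightedIntegral g F = ∫ s, g s * weightedIntegral g fun z => F (j.insertNth s z) := by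
  have hmp := (volume_preserving_piFinSuccAbove (fun _ : Fin (k + 1) => ℝ) j).symm
  have hint := integrable_prod_mul_of_continuous hg hgc hF
  have hint' := hmp.integrable_comp_of_integrable hint
  have hpt : ∀ p : ℝ × (Fin k → ℝ),
      ((fun z => (∏ i, g (z i)) * F z) ∘
        (MeasurableEquiv.piFinSuccAbove (fun _ : Fin (k + 1) => ℝ) j).symm) p =
      g p.1 * ((∏ i, g (p.2 i)) * F (j.insertNth p.1 p.2)) := by
    intro p
    have : (MeasurableEquiv.piFinSuccAbove (fun _ : Fin (k + 1) => ℝ) j).symm p =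
        j.insertNth p.1 p.2 := rfl
    simp only [Function.comp_apply, this]
    rw [Fin.prod_univ_succAbove _ j]
    simp [mul_assoc]
  have hint2 := hint'.congr (Eventually.of_forall hpt)
  have hin : ∀ s, ∫ z : Fin k → ℝ, g s * ((∏ i, g (z i)) * F (j.insertNth s z)) =
      g s * weightedIntegral g fun z => F (j.insertNth s z) := fun s => integral_const_mul _ _
  constructor
  · exact hint2.integral_prod_left.congr (Eventually.of_forall hin)
  · rw [weightedIntegral, ← hmp.integral_comp' (g := fun z => (∏ i, g (z i)) * F z)]
    simp only [← hin]
    rw [← integral_prod _ hint2]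
    exact integral_congr_ae (Eventually.of_forall hpt)

theorem weightedIntegral_cons (hg : Continuous g) (hgc : HasCompactSupport g) {k : ℕ}
    {F : (Fin (k + 1) → ℝ) → ℝ} (hF : Continuous F) :
    Integrable (fun s => g s * weightedIntegral g fun z => F (Fin.cons s z)) ∧
    weightedIntegral g F = ∫ s, g s * weightedIntegral g fun z => F (Fin.cons s z) := by
  have := weightedIntegral_insertNth hg hgc hF 0
  simpa only [Fin.insertNth_zero'] using this

variable (K : ℝ → ℝ → ℝ)

/-- The determinant with rows `x, z_1, …, z_k` and columns `y, z_1, …, z_k`. -/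
noncomputable def borderedDet {k : ℕ} (x y : ℝ) (z : Fin k → ℝ) : ℝ :=
  (Matrix.of fun i j : Fin (k + 1) => K ((Fin.cons x z : Fin (k + 1) → ℝ) i)
    ((Fin.cons y z : Fin (k + 1) → ℝ) j)).det

/-- The determinant with points `z_1, …, z_k`. -/
noncomputable def kernelDet {k : ℕ} (z : Fin k → ℝ) : ℝ :=
  (Matrix.of fun i j : Fin k => K (z i) (z j)).det

/-- The product of `K` along the path `x, z_1, …, z_k, y`. -/
noncomputable def pathProd : (k : ℕ) → (Fin k → ℝ) → ℝ → ℝ → ℝ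
  | 0, _, x, y => K x y
  | k + 1, z, x, y => K x (z 0) * pathProd k (Fin.tail z) (z 0) y

variable {K}

theorem Continuous.kernel_comp (hK : Continuous fun p : ℝ × ℝ => K p.1 p.2) {X : Type*}
    [TopologicalSpace X] {x y : X → ℝ} (hx : Continuous x) (hy : Continuous y) :
    Continuous fun a => K (x a) (y a) :=
  hK.comp (hx.prodMk hy)

theorem continuous_borderedDet (hK : Continuous fun p : ℝ × ℝ => K p.1 p.2) {X : Type*}
    [TopologicalSpace X] {k : ℕ} {x y : X → ℝ} {z : X → Fin k → ℝ} (hx : Continuous x)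
    (hy : Continuous y) (hz : Continuous z) :
    Continuous fun a => borderedDet K (x a) (y a) (z a) := by
  unfold borderedDet
  refine Continuous.matrix_det (continuous_matrix fun i j => ?_)
  have h1 : Continuous fun a => (Fin.cons (x a) (z a) : Fin (k + 1) → ℝ) i := by
    induction i using Fin.cases with
    | zero => simpa using hx
    | succ i => simp only [Fin.cons_succ]; exact (continuous_apply i).comp hz
  have h2 : Continuous fun a => (Fin.cons (y a) (z a) : Fin (k + 1) → ℝ) j := by
    induction j using Fin.cases with
    | zero => simpa using hy
    | succ i => simp only [Fin.cons_succ]; exact (continuous_apply i).comp hz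
  exact hK.comp (h1.prodMk h2)

theorem continuous_kernelDet (hK : Continuous fun p : ℝ × ℝ => K p.1 p.2) {k : ℕ} :
    Continuous fun z : Fin k → ℝ => kernelDet K z := by
  unfold kernelDet
  refine Continuous.matrix_det (continuous_matrix fun i j => ?_)
  change Continuous fun z : Fin k → ℝ => K (z i) (z j)
  exact hK.kernel_comp (continuous_apply i) (continuous_apply j)

theorem continuous_pathProd (hK : Continuous fun p : ℝ × ℝ => K p.1 p.2) {X : Type*}
    [TopologicalSpace X] {k : ℕ} {x y : X → ℝ} {z : X → Fin k → ℝ} (hx : Continuous x)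
    (hy : Continuous y) (hz : Continuous z) :
    Continuous fun a => pathProd K k (z a) (x a) (y a) := by
  induction k generalizing x with
  | zero => exact hK.comp (hx.prodMk hy)
  | succ k ih =>
    have h0 : Continuous fun a => z a 0 := (continuous_apply 0).comp hz
    have ht : Continuous fun a => Fin.tail (z a) :=
      continuous_pi fun i => (continuous_apply i.succ).comp hz
    exact (hK.comp (hx.prodMk h0)).mul (ih h0 ht)

theorem borderedDet_self (s : ℝ) {k : ℕ} (z : Fin k → ℝ) :
    borderedDet K s s z = kernelDet K (Fin.cons s z : Fin (k + 1) → ℝ) := rfl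

/-- Laplace expansion of the bordered determinant along the first row. -/
theorem borderedDet_eq {k : ℕ} (x y : ℝ) (z : Fin (k + 1) → ℝ) :
    borderedDet K x y z = K x y * kernelDet K z -
      ∑ j : Fin (k + 1), K x (z j) * borderedDet K (z j) y (j.removeNth z) := by
  rw [borderedDet, Matrix.det_succ_row_zero, Fin.sum_univ_succ, sub_eq_add_neg,
    ← Finset.sum_neg_distrib]
  congr 1
  · simp only [Fin.val_zero, pow_zero, one_mul, Matrix.of_apply, Fin.cons_zero]
    congr 1
  · refine Finset.sum_congr rfl fun j _ => ?_
    simp only [Matrix.of_apply, Fin.cons_zero, Fin.cons_succ, Fin.val_succ]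
    set B : Matrix (Fin (k + 1)) (Fin (k + 1)) ℝ := Matrix.of fun i l =>
      K (z i) ((Fin.cons y (j.removeNth z) : Fin (k + 1) → ℝ) l) with hB
    have h1 : (Matrix.of fun i l : Fin (k + 2) => K ((Fin.cons x z : Fin (k + 2) → ℝ) i)
        ((Fin.cons y z : Fin (k + 2) → ℝ) l)).submatrix Fin.succ j.succ.succAbove = B := by
      ext i l
      simp only [Matrix.submatrix_apply, Matrix.of_apply, Fin.cons_succ, hB]
      congr 1
      induction l using Fin.cases with
      | zero => simp
      | succ l => simp [Fin.removeNth]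
    have h2 : borderedDet K (z j) y (j.removeNth z) = (-1) ^ (j : ℕ) * B.det := by
      -- Bringing the row of `z_j` to the top is a cycle of sign `(-1)^j`. Together with the Laplace
      -- sign `(-1)^(j+1)` it leaves a single minus.
      have h3 := Matrix.det_permute j.cycleRange.symm B
      rw [Equiv.Perm.sign_symm, Fin.sign_cycleRange] at h3
      push_cast at h3
      rw [← h3, borderedDet]
      congr 1
      ext i l
      simp only [Matrix.of_apply, Matrix.submatrix_apply, hB, id]
      congr 1
      have h4 := Fin.insertNth_apply_cycleRange_symm j (z j) (j.removeNth z) i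
      rw [Fin.insertNth_self_removeNth] at h4
      exact h4.symm
    rw [h1, h2, pow_succ]
    have h5 : ((-1 : ℝ) ^ (j : ℕ)) * (-1) ^ (j : ℕ) = 1 := by
      rw [← pow_add, ← two_mul, pow_mul]; simp
    ring

theorem pathProd_eq_prod {k : ℕ} (z : Fin k → ℝ) (x y : ℝ) :
    pathProd K k z x y = ∏ i : Fin (k + 1), K ((Fin.cons x z : Fin (k + 1) → ℝ) i)
      ((Fin.snoc z y : Fin (k + 1) → ℝ) i) := by
  induction k generalizing x with
  | zero => simp [pathProd, Fin.snoc]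
  | succ k ih =>
    rw [pathProd, ih]
    have h1 : (Fin.snoc z y : Fin (k + 2) → ℝ) = Fin.cons (z 0) (Fin.snoc (Fin.tail z) y) := by
      rw [Fin.cons_snoc_eq_snoc_cons, Fin.cons_self_tail]
    have h2 : (Fin.cons (z 0) (Fin.tail z) : Fin (k + 1) → ℝ) = z := Fin.cons_self_tail z
    rw [h1, h2, Fin.prod_univ_succ (n := k + 1)]
    rfl

theorem pathProd_self {k : ℕ} (s : ℝ) (z : Fin k → ℝ) :
    pathProd K k z s s = ∏ i : Fin (k + 1), K ((Fin.cons s z : Fin (k + 1) → ℝ) i)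
      ((Fin.cons s z : Fin (k + 1) → ℝ) (finRotate (k + 1) i)) := by
  rw [pathProd_eq_prod, Fin.snoc_eq_cons_rotate]

/-- The integral of the cyclic product of `K` over `k + 1` points. -/
noncomputable def cyclicIntegral (g : ℝ → ℝ) (K : ℝ → ℝ → ℝ) (k : ℕ) : ℝ :=
  weightedIntegral g fun w : Fin (k + 1) → ℝ => ∏ i, K (w i) (w (finRotate (k + 1) i))

theorem weightedIntegral_sub_sum (hg : Continuous g) (hgc : HasCompactSupport g) {k : ℕ}
    {ι : Type*} (s : Finset ι) {F : (Fin k → ℝ) → ℝ} {H : ι → (Fin k → ℝ) → ℝ}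
    (hF : Continuous F) (hH : ∀ i, Continuous (H i)) :
    weightedIntegral g (fun z => F z - ∑ i ∈ s, H i z) =
      weightedIntegral g F - ∑ i ∈ s, weightedIntegral g (H i) := by
  unfold weightedIntegral
  rw [← integral_finsetSum _ fun i _ => integrable_prod_mul_of_continuous hg hgc (hH i),
    ← integral_sub (integrable_prod_mul_of_continuous hg hgc hF)
      (integrable_finsetSum _ fun i _ => integrable_prod_mul_of_continuous hg hgc (hH i))]
  exact integral_congr_ae (Eventually.of_forall fun z => by simp only [mul_sub, Finset.mul_sum])

/-- After integration the `k + 1` terms of the Laplace expansion coincide, since each `z_j` is just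
a variable being integrated out. -/
theorem weightedIntegral_borderedDet_succ (hg : Continuous g) (hgc : HasCompactSupport g)
    (hK : Continuous fun p : ℝ × ℝ => K p.1 p.2) (k : ℕ) (x y : ℝ) :
    weightedIntegral g (fun z : Fin (k + 1) → ℝ => borderedDet K x y z) =
      K x y * weightedIntegral g (fun z : Fin (k + 1) → ℝ => kernelDet K z) -
      (k + 1) * ∫ s, g s * (K x s *
        weightedIntegral g (fun z : Fin k → ℝ => borderedDet K s y z)) := by
  have hc : ∀ j : Fin (k + 1), Continuous fun z : Fin (k + 1) → ℝ =>
      K x (z j) * borderedDet K (z j) y (j.removeNth z) := fun j =>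
    (hK.kernel_comp continuous_const (continuous_apply j)).mul
      (continuous_borderedDet hK (continuous_apply j) continuous_const
        (continuous_pi fun i => continuous_apply _))
  simp only [borderedDet_eq]
  rw [weightedIntegral_sub_sum hg hgc _ (F := fun z => K x y * kernelDet K z)
    (continuous_const.mul (continuous_kernelDet hK)) hc,
    weightedIntegral_const_mul]
  have hj : ∀ j : Fin (k + 1), weightedIntegral g (fun z : Fin (k + 1) → ℝ =>
      K x (z j) * borderedDet K (z j) y (j.removeNth z)) = ∫ s, g s * (K x s *
        weightedIntegral g (fun z : Fin k → ℝ => borderedDet K s y z)) := by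
    intro j
    rw [(weightedIntegral_insertNth hg hgc (hc j) j).2]
    simp only [Fin.insertNth_apply_same, Fin.removeNth_insertNth, weightedIntegral_const_mul]
  simp only [hj, Finset.sum_const, Finset.card_univ, Fintype.card_fin, nsmul_eq_mul]
  push_cast
  rfl

theorem weightedIntegral_pathProd_succ (hg : Continuous g) (hgc : HasCompactSupport g)
    (hK : Continuous fun p : ℝ × ℝ => K p.1 p.2) (k : ℕ) (x y : ℝ) :
    Integrable (fun s => g s * (K x s *
      weightedIntegral g (fun z : Fin k → ℝ => pathProd K k z s y))) ∧
    weightedIntegral g (fun z : Fin (k + 1) → ℝ => pathProd K (k + 1) z x y) =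
      ∫ s, g s * (K x s * weightedIntegral g (fun z : Fin k → ℝ => pathProd K k z s y)) := by
  have := weightedIntegral_cons hg hgc (F := fun z : Fin (k + 1) → ℝ => pathProd K (k + 1) z x y)
    (continuous_pathProd hK continuous_const continuous_const continuous_id)
  simpa only [pathProd, Fin.cons_zero, Fin.tail_cons, weightedIntegral_const_mul] using this

theorem cyclicIntegral_eq (hg : Continuous g) (hgc : HasCompactSupport g)
    (hK : Continuous fun p : ℝ × ℝ => K p.1 p.2) (k : ℕ) :
    Integrable (fun s => g s * weightedIntegral g (fun z : Fin k → ℝ => pathProd K k z s s)) ∧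
    cyclicIntegral g K k =
      ∫ s, g s * weightedIntegral g (fun z : Fin k → ℝ => pathProd K k z s s) := by
  have := weightedIntegral_cons hg hgc
    (F := fun w : Fin (k + 1) → ℝ => ∏ i, K (w i) (w (finRotate (k + 1) i)))
    (continuous_finsetProd _ fun i _ => hK.kernel_comp (continuous_apply _) (continuous_apply _))
  simp only [← pathProd_self] at this
  exact this

/-- The coefficients of the Fredholm determinant. -/
noncomputable def fredholmCoeff (g : ℝ → ℝ) (K : ℝ → ℝ → ℝ) (k : ℕ) : ℝ :=
  weightedIntegral g (fun z : Fin k → ℝ => kernelDet K z) / k !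

theorem fredholmCoeff_zero : fredholmCoeff g K 0 = 1 := by
  simp [fredholmCoeff, weightedIntegral_zero, kernelDet]

/-- Iterating the one-step expansion attaches one more kernel to a path starting at `x`; the
induction therefore runs over all `x` with `y` fixed. -/
theorem weightedIntegral_borderedDet (hg : Continuous g) (hgc : HasCompactSupport g)
    (hK : Continuous fun p : ℝ × ℝ => K p.1 p.2) (k : ℕ) (x y : ℝ) :
    weightedIntegral g (fun z : Fin k → ℝ => borderedDet K x y z) =
      k ! * ∑ j ∈ Finset.range (k + 1), (-1) ^ j * fredholmCoeff g K (k - j) *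
        weightedIntegral g (fun z : Fin j → ℝ => pathProd K j z x y) := by
  induction k generalizing x with
  | zero => simp [weightedIntegral_zero, fredholmCoeff_zero, borderedDet, pathProd]
  | succ k ih =>
    rw [weightedIntegral_borderedDet_succ hg hgc hK, Finset.sum_range_succ']
    simp only [ih, Nat.add_sub_add_right, (weightedIntegral_pathProd_succ hg hgc hK _ x y).2]
    have h0 : weightedIntegral g (fun z : Fin 0 → ℝ => pathProd K 0 z x y) = K x y :=
      weightedIntegral_zero _
    have h1 : (∫ s, g s * (K x s * (k ! * ∑ j ∈ Finset.range (k + 1),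
        (-1) ^ j * fredholmCoeff g K (k - j) *
        weightedIntegral g (fun z : Fin j → ℝ => pathProd K j z s y)))) =
        k ! * ∑ j ∈ Finset.range (k + 1), (-1) ^ j * fredholmCoeff g K (k - j) *
          ∫ s, g s * (K x s * weightedIntegral g (fun z : Fin j → ℝ => pathProd K j z s y)) := by
      simp only [← integral_const_mul]
      rw [← integral_finsetSum, ← integral_const_mul]
      · refine integral_congr_ae (Eventually.of_forall fun s => ?_)
        simp only [Finset.mul_sum]
        exact Finset.sum_congr rfl fun j _ => by ring
      · exact fun j _ => (weightedIntegral_pathProd_succ hg hgc hK j x y).1.const_mul _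
    rw [h1, h0]
    have h2 : weightedIntegral g (fun z : Fin (k + 1) → ℝ => kernelDet K z) =
        (k + 1)! * fredholmCoeff g K (k + 1) := by
      rw [fredholmCoeff]; field_simp
    rw [h2, Nat.factorial_succ]
    push_cast
    simp only [pow_succ, pow_zero, mul_add, Finset.mul_sum]
    rw [sub_eq_neg_add, ← Finset.sum_neg_distrib]
    congr 1
    · exact Finset.sum_congr rfl fun j _ => by ring
    · ring

/-- The Plemelj recursion. -/
theorem fredholmCoeff_succ (hg : Continuous g) (hgc : HasCompactSupport g)
    (hK : Continuous fun p : ℝ × ℝ => K p.1 p.2) (k : ℕ) :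
    (k + 1) * fredholmCoeff g K (k + 1) =
      ∑ j ∈ Finset.range (k + 1), (-1) ^ j * cyclicIntegral g K j * fredholmCoeff g K (k - j) := by
  rw [fredholmCoeff, (weightedIntegral_cons hg hgc (continuous_kernelDet hK)).2]
  -- On the diagonal `x = y = s` the paths close up into cycles.
  simp only [← borderedDet_self, weightedIntegral_borderedDet hg hgc hK,
    (cyclicIntegral_eq hg hgc hK _).2]
  rw [Nat.factorial_succ]
  have h1 : (∫ s, g s * (k ! * ∑ j ∈ Finset.range (k + 1),
        (-1) ^ j * fredholmCoeff g K (k - j) *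
        weightedIntegral g (fun z : Fin j → ℝ => pathProd K j z s s))) =
      k ! * ∑ j ∈ Finset.range (k + 1), (-1) ^ j * (∫ s, g s *
        weightedIntegral g (fun z : Fin j → ℝ => pathProd K j z s s)) *
        fredholmCoeff g K (k - j) := by
    have h2 : ∀ j, (-1) ^ j * (∫ s, g s *
        weightedIntegral g (fun z : Fin j → ℝ => pathProd K j z s s)) *
        fredholmCoeff g K (k - j) = ∫ s, ((-1) ^ j * fredholmCoeff g K (k - j)) * (g s *
        weightedIntegral g (fun z : Fin j → ℝ => pathProd K j z s s)) := by
      intro j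
      rw [integral_const_mul]; ring
    simp only [h2]
    rw [← integral_finsetSum, ← integral_const_mul]
    · refine integral_congr_ae (Eventually.of_forall fun s => ?_)
      simp only [Finset.mul_sum]
      exact Finset.sum_congr rfl fun j _ => by ring
    · exact fun j _ => (cyclicIntegral_eq hg hgc hK j).1.const_mul _
  rw [h1]
  push_cast
  field_simp

end Fredholm

/-! ### Newton's recursion and exponentials of power series -/

section NewtonRecursion

/-- The radius `3/2` lies strictly between 1, where the series will be evaluated, and 2, where
convergence may fail; it yields the geometric rate `3/4`. -/
theorem hasDerivAt_tsum_pow {c : ℕ → ℝ} (hc : ∀ k, |c k| ≤ (1 / 2) ^ k) {z : ℝ}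
    (hz : |z| < 3 / 2) :
    HasDerivAt (fun z => ∑' k, c k * z ^ k) (∑' k, (k + 1) * c (k + 1) * z ^ k) z := by
  have hu : Summable fun k : ℕ => (k : ℝ) ^ 1 * (3 / 4 : ℝ) ^ k :=
    summable_pow_mul_geometric_of_norm_lt_one 1 (by rw [Real.norm_eq_abs]; norm_num [abs_of_pos])
  have hmem : ∀ y : ℝ, y ∈ Metric.ball (0 : ℝ) (3 / 2) ↔ |y| < 3 / 2 := fun y => by
    rw [mem_ball_zero_iff, Real.norm_eq_abs]
  have hb : ∀ (k : ℕ) (y : ℝ), y ∈ Metric.ball (0 : ℝ) (3 / 2) →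
      ‖c k * (k * y ^ (k - 1))‖ ≤ (k : ℝ) ^ 1 * (3 / 4 : ℝ) ^ k := by
    intro k y hy
    rw [hmem] at hy
    rcases k with _ | k
    · simp
    · rw [Real.norm_eq_abs, abs_mul, abs_mul, abs_pow, Nat.abs_cast, pow_one, Nat.add_sub_cancel]
      have h1 : |y| ^ k ≤ (3 / 2) ^ k := pow_le_pow_left₀ (abs_nonneg _) hy.le k
      have h2 : (3 / 4 : ℝ) ^ (k + 1) = (1 / 2) ^ (k + 1) * (3 / 2) ^ (k + 1) := by
        rw [← mul_pow]; norm_num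
      have h3 : (3 / 2 : ℝ) ^ k ≤ (3 / 2) ^ (k + 1) := by
        rw [pow_succ]; nlinarith [pow_pos (show (0 : ℝ) < 3 / 2 by norm_num) k]
      calc |c (k + 1)| * (((k + 1 : ℕ) : ℝ) * |y| ^ k)
          ≤ (1 / 2) ^ (k + 1) * (((k + 1 : ℕ) : ℝ) * (3 / 2) ^ (k + 1)) := by
            gcongr
            · exact hc _
            · exact h1.trans h3
        _ = _ := by rw [h2]; ring
  have h := hasDerivAt_tsum_of_isPreconnected hu Metric.isOpen_ball
    (convex_ball (0 : ℝ) (3 / 2)).isPreconnected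
    (g := fun k y => c k * y ^ k) (g' := fun k y => c k * (k * y ^ (k - 1)))
    (fun k y _ => (hasDerivAt_pow k y).const_mul (c k)) hb
    ((hmem 0).2 (by norm_num)) (y₀ := 0)
    (summable_of_ne_finset_zero (s := {0}) fun k hk => by
      simp at hk; simp [hk])
    ((hmem z).2 hz)
  have hs : Summable fun k : ℕ => c k * (k * z ^ (k - 1)) :=
    Summable.of_norm_bounded hu fun k => hb k z ((hmem z).2 hz)
  rw [hs.tsum_eq_zero_add] at h
  simp only [Nat.cast_zero, zero_mul, mul_zero, zero_add, Nat.add_sub_cancel] at h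
  rwa [tsum_congr fun k => show c (k + 1) * (((k + 1 : ℕ) : ℝ) * z ^ k) =
    (k + 1) * c (k + 1) * z ^ k by push_cast; ring] at h

theorem summable_norm_mul_pow {c : ℕ → ℝ} (hc : ∀ k, |c k| ≤ (1 / 2) ^ k) {z : ℝ}
    (hz : |z| < 3 / 2) : Summable fun k => ‖c k * z ^ k‖ := by
  refine Summable.of_nonneg_of_le (fun _ => norm_nonneg _) (fun k => ?_)
    (summable_geometric_of_lt_one (by norm_num) (by norm_num : (3 / 4 : ℝ) < 1))
  rw [Real.norm_eq_abs, abs_mul, abs_pow, show (3 / 4 : ℝ) = 1 / 2 * (3 / 2) by norm_num, mul_pow]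
  exact mul_le_mul (hc k) (pow_le_pow_left₀ (abs_nonneg _) hz.le k) (by positivity) (by positivity)

/-- A sequence given by Newton's recursion sums to the exponential of the generating series. -/
theorem hasSum_exp_of_newton {a T : ℕ → ℝ} (h0 : a 0 = 1) {r : ℝ} (hr : r ≤ 1 / 2) (hr0 : 0 ≤ r)
    (hT : ∀ j, |T j| ≤ r ^ (j + 1))
    (hrec : ∀ k : ℕ, (k + 1) * a (k + 1) = ∑ j ∈ Finset.range (k + 1), T j * a (k - j)) :
    HasSum a (Real.exp (∑' j : ℕ, T j / (j + 1))) := by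
  -- The recursion has `k + 1` terms of size at most `r^(k+1)`, and the factor `k + 1` on its left
  -- absorbs their number.
  have ha' : ∀ k, |a k| ≤ r ^ k := by
    intro k
    induction k using Nat.strong_induction_on with
    | _ k ih =>
      rcases k with _ | k
      · simp [h0]
      · have hk : (0 : ℝ) < k + 1 := by positivity
        refine le_of_mul_le_mul_left ?_ hk
        calc (k + 1 : ℝ) * |a (k + 1)| = |(k + 1) * a (k + 1)| := by rw [abs_mul, abs_of_pos hk]
          _ ≤ ∑ j ∈ Finset.range (k + 1), |T j * a (k - j)| := by
            rw [hrec]; exact Finset.abs_sum_le_sum_abs _ _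
          _ ≤ ∑ j ∈ Finset.range (k + 1), r ^ (k + 1) := by
            refine Finset.sum_le_sum fun j hj => ?_
            have hj' : j ≤ k := Nat.lt_succ_iff.1 (Finset.mem_range.1 hj)
            rw [abs_mul, show k + 1 = (j + 1) + (k - j) by omega, pow_add]
            exact mul_le_mul (hT j) (ih _ (by omega)) (abs_nonneg _) (by positivity)
          _ = _ := by simp
  have ha : ∀ k, |a k| ≤ (1 / 2) ^ k := fun k => (ha' k).trans (pow_le_pow_left₀ hr0 hr k)
  have hT' : ∀ j, |T j| ≤ (1 / 2) ^ j := fun j => (hT j).trans <| by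
    rw [pow_succ]
    calc r ^ j * r ≤ r ^ j * 1 := by gcongr; linarith
      _ = r ^ j := mul_one _
      _ ≤ _ := pow_le_pow_left₀ hr0 hr j
  set l : ℕ → ℝ := fun k => Nat.casesOn k 0 fun j => T j / (j + 1) with hl
  have hlb : ∀ k, |l k| ≤ (1 / 2) ^ k := by
    rintro (_ | k)
    · simp [hl]
    · have hk : (1 : ℝ) ≤ k + 1 := by linarith [Nat.cast_nonneg (α := ℝ) k]
      simp only [hl]
      rw [abs_div, abs_of_pos (by linarith : (0 : ℝ) < k + 1)]
      exact (div_le_self (abs_nonneg _) hk).trans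
        ((hT k).trans (pow_le_pow_left₀ hr0 hr _))
  set D : ℝ → ℝ := fun z => ∑' k, a k * z ^ k with hD
  set L : ℝ → ℝ := fun z => ∑' k, l k * z ^ k with hL
  have hLd : ∀ z, |z| < 3 / 2 → HasDerivAt L (∑' j, T j * z ^ j) z := by
    intro z hz
    convert hasDerivAt_tsum_pow hlb hz using 1
    refine tsum_congr fun k => ?_
    simp only [hl]
    have : (k + 1 : ℝ) ≠ 0 := by positivity
    field_simp
  -- The recursion says, coefficient by coefficient, that `D' = L' D`; the right side is a Cauchy
  -- product. Hence `exp(-L) D` is constant.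
  have hDd : ∀ z, |z| < 3 / 2 → HasDerivAt D ((∑' j, T j * z ^ j) * D z) z := by
    intro z hz
    convert hasDerivAt_tsum_pow ha hz using 1
    rw [hD, tsum_mul_tsum_eq_tsum_sum_range_of_summable_norm (summable_norm_mul_pow hT' hz)
      (summable_norm_mul_pow ha hz)]
    refine tsum_congr fun k => ?_
    rw [hrec, Finset.sum_mul]
    refine Finset.sum_congr rfl fun j hj => ?_
    have hj' : j ≤ k := Nat.lt_succ_iff.1 (Finset.mem_range.1 hj)
    calc T j * z ^ j * (a (k - j) * z ^ (k - j)) = T j * a (k - j) * (z ^ j * z ^ (k - j)) := by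
          ring
      _ = _ := by rw [← pow_add, Nat.add_sub_cancel' hj']
  have hconst : ∀ z, |z| < 3 / 2 → HasDerivAt (fun z => Real.exp (-L z) * D z) 0 z := by
    intro z hz
    have h := (hLd z hz).neg.exp.mul (hDd z hz)
    rwa [show Real.exp ((-L) z) * -(∑' j, T j * z ^ j) * D z +
      Real.exp ((-L) z) * ((∑' j, T j * z ^ j) * D z) = 0 by ring] at h
  have habs : ∀ z ∈ Set.Icc (0 : ℝ) 1, |z| < 3 / 2 := fun z hz => by
    rw [abs_of_nonneg hz.1]; linarith [hz.2]
  have hfin := constant_of_has_deriv_right_zero (a := (0 : ℝ)) (b := 1)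
    (f := fun z => Real.exp (-L z) * D z)
    (fun z hz => (hconst z (habs z hz)).continuousAt.continuousWithinAt)
    (fun z hz => (hconst z (habs z ⟨hz.1, hz.2.le⟩)).hasDerivWithinAt) 1 (by simp)
  have hL0 : L 0 = 0 := by
    rw [hL]; simp only
    rw [tsum_eq_single 0 fun k hk => by simp [hk]]
    simp [hl]
  have hD0 : D 0 = 1 := by
    rw [hD]; simp only
    rw [tsum_eq_single 0 fun k hk => by simp [hk]]
    simp [h0]
  have hL1 : L 1 = ∑' j : ℕ, T j / (j + 1) := by
    have hs : Summable l := Summable.of_norm (by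
      simpa using summable_norm_mul_pow hlb (z := 1) (by norm_num))
    simp only [hL, one_pow, mul_one]
    rw [hs.tsum_eq_zero_add]
    simp [hl]
  have hD1 : D 1 = Real.exp (∑' j : ℕ, T j / (j + 1)) := by
    simp only [hL0, hD0, neg_zero, Real.exp_zero, mul_one] at hfin
    rw [← hL1]
    calc D 1 = Real.exp (L 1) * (Real.exp (-L 1) * D 1) := by
          rw [← mul_assoc, ← Real.exp_add, add_neg_cancel, Real.exp_zero, one_mul]
      _ = _ := by rw [hfin, mul_one]
  have hs : Summable a := Summable.of_norm (by
    simpa using summable_norm_mul_pow ha (z := 1) (by norm_num))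
  have := hs.hasSum
  rwa [← hD1, show D 1 = ∑' k, a k by simp [hD]]

end NewtonRecursion

/-! ### Composition with `t ↦ exp(ta) - 1` and the weights `M(m)` -/

section ExpSeries

variable {E : Type*} [NormedRing E] [NormedAlgebra ℝ E]

/-- The power series of `t ↦ exp (t a) - 1`. -/
noncomputable def expSubOneSeries (a : E) : FormalMultilinearSeries ℝ ℝ E :=
  (NormedSpace.expSeries ℝ E).compContinuousLinearMap (ContinuousLinearMap.toSpanSingleton ℝ a) -
    constFormalMultilinearSeries ℝ ℝ (1 : E)

theorem hasFPowerSeriesAt_exp_sub_one [CompleteSpace E] (a : E) :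
    HasFPowerSeriesAt (fun t : ℝ => NormedSpace.exp (t • a) - 1) (expSubOneSeries a) 0 := by
  have h1 : HasFPowerSeriesOnBall NormedSpace.exp (NormedSpace.expSeries ℝ E)
      (ContinuousLinearMap.toSpanSingleton ℝ a 0) ⊤ := by
    rw [map_zero]; exact NormedSpace.exp_hasFPowerSeriesOnBall
  exact h1.compContinuousLinearMap.hasFPowerSeriesAt.sub hasFPowerSeriesAt_const

theorem expSubOneSeries_apply_one (a : E) {n : ℕ} (hn : n ≠ 0) :
    expSubOneSeries a n (fun _ => 1) = ((n ! : ℝ))⁻¹ • a ^ n := by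
  have : expSubOneSeries a n = (NormedSpace.expSeries ℝ E).compContinuousLinearMap
      (ContinuousLinearMap.toSpanSingleton ℝ a) n - constFormalMultilinearSeries ℝ ℝ (1 : E) n :=
    rfl
  rw [this, constFormalMultilinearSeries_apply_of_nonzero hn, sub_zero,
    FormalMultilinearSeries.compContinuousLinearMap_apply, ← NormedSpace.expSeries_apply_eq]
  congr 1
  ext i
  simp

/-- Derivatives at the origin of a power series composed with `t ↦ exp (t a) - 1`. -/
theorem iteratedDeriv_comp_exp_sub_one [CompleteSpace E] {F : E → ℝ} {p : FormalMultilinearSeries ℝ E ℝ}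
    (hF : HasFPowerSeriesAt F p 0) (a : E) (n : ℕ) :
    iteratedDeriv n (fun t : ℝ => F (NormedSpace.exp (t • a) - 1)) 0 =
      n ! * ∑ c : Composition n,
        p c.length fun i => ((c.blocksFun i)! : ℝ)⁻¹ • a ^ c.blocksFun i := by
  have h0 : HasFPowerSeriesAt F p ((fun t : ℝ => NormedSpace.exp (t • a) - 1) 0) := by
    simpa using hF
  obtain ⟨r, hr⟩ := HasFPowerSeriesAt.comp (f := fun t : ℝ => NormedSpace.exp (t • a) - 1) h0
    (hasFPowerSeriesAt_exp_sub_one a)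
  have h1 := hr.factorial_smul 1 n
  rw [iteratedDeriv_eq_iteratedFDeriv]
  change (iteratedFDeriv ℝ n (F ∘ fun t : ℝ => NormedSpace.exp (t • a) - 1) 0) _ = _
  rw [← h1, nsmul_eq_mul]
  congr 1
  rw [FormalMultilinearSeries.comp, sum_apply]
  refine Finset.sum_congr rfl fun c _ => ?_
  rw [FormalMultilinearSeries.compAlongComposition_apply]
  congr 1
  ext1 i
  rw [← expSubOneSeries_apply_one a (Nat.one_le_iff_ne_zero.1 (c.one_le_blocksFun i))]
  rfl

/-- These are the coefficients of `log(1 + (e^t - 1)) = t`, whose derivatives of order at least 2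
vanish. -/
theorem sum_compWeight {n : ℕ} (hn : 2 ≤ n) : ∑ c : Composition n, compWeight c = 0 := by
  have h := iteratedDeriv_comp_exp_sub_one hasFPowerSeriesAt_log_one_add (1 : ℝ) n
  have h1 : (fun t : ℝ => Real.log (1 + (NormedSpace.exp (t • (1 : ℝ)) - 1))) = id := by
    ext t
    rw [← Real.exp_eq_exp_ℝ]
    simp
  have h2 : iteratedDeriv n (id : ℝ → ℝ) 0 = 0 := by
    obtain ⟨k, rfl⟩ := Nat.exists_eq_add_of_le' hn
    rw [iteratedDeriv_succ', iteratedDeriv_succ']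
    simp
  rw [h1, h2, Finset.mul_sum] at h
  rw [h]
  refine Finset.sum_congr rfl fun c _ => ?_
  simp only [FormalMultilinearSeries.ofScalars, smul_apply,
    ContinuousMultilinearMap.mkPiAlgebraFin_apply, List.prod_ofFn, one_pow, smul_eq_mul, mul_one,
    Finset.prod_inv_distrib, compWeight, pow_succ, Nat.cast_prod]
  ring

end ExpSeries

/-! ### The logarithm of the Fredholm determinant as a power series -/

section TraceSeries

open scoped BoundedContinuousFunction

variable (K : ℝ → ℝ → ℝ) (S : Set ℝ)

/-- The integral over `S ^ l` of `∏ g_i(x_i) K(x_i, x_{i+1})`, as a multilinear map of the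
functions `g_i`. -/
noncomputable def traceIntegral (l : ℕ) (g : Fin l → ℝ →ᵇ ℝ) : ℝ :=
  ∫ x : Fin l → ℝ, (∏ i, g i (x i)) * ∏ i, K (x i) (x (finRotate l i))
    ∂Measure.pi fun _ => volume.restrict S

variable {K S}

theorem abs_prod_kernel_le {M : ℝ} (hM : ∀ x y, |K x y| ≤ M) {l : ℕ} (x : Fin l → ℝ) :
    |∏ i, K (x i) (x (finRotate l i))| ≤ M ^ l := by
  rw [Finset.abs_prod]
  calc ∏ i, |K (x i) (x (finRotate l i))| ≤ ∏ _i : Fin l, M :=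
        Finset.prod_le_prod (fun _ _ => abs_nonneg _) fun _ _ => hM _ _
    _ = M ^ l := by simp

theorem abs_trace_integrand_le {M : ℝ} (hM : ∀ x y, |K x y| ≤ M) {l : ℕ} (g : Fin l → ℝ →ᵇ ℝ)
    (x : Fin l → ℝ) :
    |(∏ i, g i (x i)) * ∏ i, K (x i) (x (finRotate l i))| ≤ M ^ l * ∏ i, ‖g i‖ := by
  have hM0 : 0 ≤ M := (abs_nonneg _).trans (hM 0 0)
  rw [abs_mul, mul_comm]
  refine mul_le_mul (abs_prod_kernel_le hM x) ?_ (abs_nonneg _) (by positivity)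
  rw [Finset.abs_prod]
  exact Finset.prod_le_prod (fun _ _ => abs_nonneg _) fun i _ => (g i).norm_coe_le_norm (x i)

theorem integrable_trace_integrand (hK : Continuous fun p : ℝ × ℝ => K p.1 p.2) {M : ℝ}
    (hM : ∀ x y, |K x y| ≤ M) (hS : volume S ≠ ⊤) {l : ℕ} (g : Fin l → ℝ →ᵇ ℝ) :
    Integrable (fun x : Fin l → ℝ => (∏ i, g i (x i)) * ∏ i, K (x i) (x (finRotate l i)))
      (Measure.pi fun _ => volume.restrict S) := by
  have : IsFiniteMeasure (volume.restrict S) := ⟨by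
    rw [Measure.restrict_apply_univ]; exact hS.lt_top⟩
  refine Integrable.of_bound (Continuous.aestronglyMeasurable ?_) (M ^ l * ∏ i, ‖g i‖)
    (Eventually.of_forall fun x => abs_trace_integrand_le hM g x)
  refine Continuous.mul ?_ (continuous_finsetProd _ fun i _ =>
    hK.kernel_comp (continuous_apply _) (continuous_apply _))
  exact continuous_finsetProd _ fun i _ => (g i).continuous.comp (continuous_apply i)

/-- A sup-norm bound over a set of finite measure suffices; no operator or trace norms are involved.
-/
theorem abs_traceIntegral_le {M : ℝ} (hM : ∀ x y, |K x y| ≤ M) (hS : volume S ≠ ⊤) {l : ℕ}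
    (g : Fin l → ℝ →ᵇ ℝ) :
    |traceIntegral K S l g| ≤ (M * volume.real S) ^ l * ∏ i, ‖g i‖ := by
  have : IsFiniteMeasure (volume.restrict S) := ⟨by
    rw [Measure.restrict_apply_univ]; exact hS.lt_top⟩
  have h := norm_integral_le_of_norm_le_const
    (μ := Measure.pi fun _ : Fin l => volume.restrict S)
    (f := fun x : Fin l → ℝ => (∏ i, g i (x i)) * ∏ i, K (x i) (x (finRotate l i)))
    (Eventually.of_forall fun x => abs_trace_integrand_le hM g x)
  have h2 : (Measure.pi fun _ : Fin l => volume.restrict S).real Set.univ =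
      volume.real S ^ l := by
    rw [Measure.real, Measure.pi_univ]
    simp [Measure.real]
  rw [h2] at h
  refine (show |traceIntegral K S l g| ≤ _ from h).trans_eq ?_
  rw [mul_pow]; ring

/-- `traceIntegral` as a continuous multilinear map. -/
noncomputable def traceMap (hK : Continuous fun p : ℝ × ℝ => K p.1 p.2) {M : ℝ}
    (hM : ∀ x y, |K x y| ≤ M) (hS : volume S ≠ ⊤) (l : ℕ) :
    ContinuousMultilinearMap ℝ (fun _ : Fin l => ℝ →ᵇ ℝ) ℝ :=
  MultilinearMap.mkContinuous
    { toFun := traceIntegral K S l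
      map_update_add' := by
        intro _ m i a b
        have hd : ‹DecidableEq (Fin l)› = instDecidableEqFin l := Subsingleton.elim _ _
        subst hd
        unfold traceIntegral
        rw [← integral_add (integrable_trace_integrand hK hM hS _)
          (integrable_trace_integrand hK hM hS _)]
        refine integral_congr_ae (Eventually.of_forall fun x => ?_)
        -- For fixed `x`, multilinearity in the functions is that of a product of real numbers
        -- composed with evaluations.
        have h := ((MultilinearMap.mkPiAlgebra ℝ (Fin l) ℝ).compLinearMap fun i =>
          (BoundedContinuousFunction.evalCLM ℝ (x i) : (ℝ →ᵇ ℝ) →L[ℝ] ℝ).toLinearMap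
            ).map_update_add m i a b
        simp only [MultilinearMap.compLinearMap_apply, MultilinearMap.mkPiAlgebra_apply] at h
        simp only [← add_mul]
        exact congrArg (· * _) h
      map_update_smul' := by
        intro _ m i t a
        have hd : ‹DecidableEq (Fin l)› = instDecidableEqFin l := Subsingleton.elim _ _
        subst hd
        unfold traceIntegral
        rw [smul_eq_mul, ← integral_const_mul]
        refine integral_congr_ae (Eventually.of_forall fun x => ?_)
        have h := ((MultilinearMap.mkPiAlgebra ℝ (Fin l) ℝ).compLinearMap fun i =>
          (BoundedContinuousFunction.evalCLM ℝ (x i) : (ℝ →ᵇ ℝ) →L[ℝ] ℝ).toLinearMap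
            ).map_update_smul m i t a
        simp only [MultilinearMap.compLinearMap_apply, MultilinearMap.mkPiAlgebra_apply,
          smul_eq_mul] at h
        simp only [← mul_assoc]
        exact congrArg (· * _) h }
    ((M * volume.real S) ^ l) fun g => abs_traceIntegral_le hM hS g

/-- The power series of `g ↦ log det (1 + g K)`. -/
noncomputable def logDetSeries (hK : Continuous fun p : ℝ × ℝ => K p.1 p.2) {M : ℝ}
    (hM : ∀ x y, |K x y| ≤ M) (hS : volume S ≠ ⊤) : FormalMultilinearSeries ℝ (ℝ →ᵇ ℝ) ℝ :=
  fun l => ((-1 : ℝ) ^ (l + 1) / l) • traceMap hK hM hS l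

theorem logDetSeries_apply (hK : Continuous fun p : ℝ × ℝ => K p.1 p.2) {M : ℝ}
    (hM : ∀ x y, |K x y| ≤ M) (hS : volume S ≠ ⊤) (l : ℕ) (g : Fin l → ℝ →ᵇ ℝ) :
    logDetSeries hK hM hS l g = (-1 : ℝ) ^ (l + 1) / l * traceIntegral K S l g := rfl

theorem radius_logDetSeries_pos (hK : Continuous fun p : ℝ × ℝ => K p.1 p.2) {M : ℝ}
    (hM : ∀ x y, |K x y| ≤ M) (hS : volume S ≠ ⊤) : 0 < (logDetSeries hK hM hS).radius := by
  have hM0 : 0 ≤ M := (abs_nonneg _).trans (hM 0 0)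
  have hV : 0 ≤ M * volume.real S := mul_nonneg hM0 measureReal_nonneg
  have hV1 : 0 < M * volume.real S + 1 := by linarith
  -- The summand 1 keeps the inverse meaningful when the kernel bound or the volume is zero.
  obtain ⟨r, hr⟩ : ∃ r : NNReal, (r : ℝ) = (M * volume.real S + 1)⁻¹ :=
    ⟨⟨_, (inv_pos.2 hV1).le⟩, rfl⟩
  have hr0 : 0 < r := by
    rw [← NNReal.coe_pos, hr]; exact inv_pos.2 hV1
  refine lt_of_lt_of_le (ENNReal.coe_pos.2 hr0)
    (FormalMultilinearSeries.le_radius_of_bound _ 1 fun l => ?_)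
  have h1 : ‖logDetSeries hK hM hS l‖ ≤ (M * volume.real S) ^ l := by
    have h2 : ‖(-1 : ℝ) ^ (l + 1) / l‖ ≤ 1 := by
      rw [norm_div, norm_pow, norm_neg, norm_one, one_pow, Real.norm_natCast]
      rcases l with _ | l
      · simp
      · rw [div_le_one (by positivity)]
        push_cast; linarith [Nat.cast_nonneg (α := ℝ) l]
    refine ContinuousMultilinearMap.opNorm_le_bound (by positivity) fun g => ?_
    rw [logDetSeries_apply, norm_mul]
    calc _ ≤ 1 * ((M * volume.real S) ^ l * ∏ i, ‖g i‖) := by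
          gcongr
          exact abs_traceIntegral_le hM hS g
      _ = _ := one_mul _
  calc ‖logDetSeries hK hM hS l‖ * (r : ℝ) ^ l
      ≤ (M * volume.real S) ^ l * ((M * volume.real S + 1)⁻¹) ^ l := by
        rw [hr]; gcongr
    _ = (M * volume.real S / (M * volume.real S + 1)) ^ l := by rw [← mul_pow, div_eq_mul_inv]
    _ ≤ 1 := pow_le_one₀ (by positivity) (by rw [div_le_one (by positivity)]; linarith)

theorem traceIntegral_eq_integral {l : ℕ} {g : Fin l → ℝ →ᵇ ℝ}
    (hg : ∀ i, ∀ x ∉ S, g i x = 0) :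
    traceIntegral K S l g =
      ∫ x : Fin l → ℝ, (∏ i, g i (x i)) * ∏ i, K (x i) (x (finRotate l i)) := by
  rw [traceIntegral, ← Measure.restrict_pi_pi, volume_pi]
  refine setIntegral_eq_integral_of_forall_compl_eq_zero fun x hx => ?_
  simp only [Set.mem_pi, Set.mem_univ, true_imp_iff, not_forall] at hx
  obtain ⟨i, hi⟩ := hx
  rw [Finset.prod_eq_zero (Finset.mem_univ i) (hg i _ hi), zero_mul]

/-- Near the origin, `logDetSeries` sums to the logarithm of the Fredholm determinant. -/
theorem eventually_hasSum_fredholmCoeff (hK : Continuous fun p : ℝ × ℝ => K p.1 p.2) {M : ℝ}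
    (hM : ∀ x y, |K x y| ≤ M) (hS : IsCompact S) :
    ∀ᶠ g : ℝ →ᵇ ℝ in 𝓝 0, (∀ x ∉ S, g x = 0) →
      HasSum (fredholmCoeff g K)
        (Real.exp ((logDetSeries hK hM hS.measure_lt_top.ne).sum g)) := by
  have hM0 : 0 ≤ M := (abs_nonneg _).trans (hM 0 0)
  have hV : 0 ≤ M * volume.real S := mul_nonneg hM0 measureReal_nonneg
  -- The threshold `1/2` is the one under which Newton's recursion was solved.
  have hlt : ∀ᶠ g : ℝ →ᵇ ℝ in 𝓝 0, M * volume.real S * ‖g‖ < 1 / 2 := by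
    have hc : Continuous fun g : ℝ →ᵇ ℝ => M * volume.real S * ‖g‖ := by fun_prop
    refine (hc.tendsto 0).eventually_lt_const ?_
    simp
  filter_upwards [hlt] with g hg hgS
  have hcont : Continuous g := g.continuous
  have hcomp : HasCompactSupport g := HasCompactSupport.intro hS hgS
  have hT : ∀ j, cyclicIntegral g K j = traceIntegral K S (j + 1) fun _ => g := fun j =>
    (traceIntegral_eq_integral fun _ => hgS).symm
  have hTle : ∀ j, |(-1) ^ j * cyclicIntegral g K j| ≤ (M * volume.real S * ‖g‖) ^ (j + 1) := by
    intro j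
    rw [abs_mul, abs_pow, abs_neg, abs_one, one_pow, one_mul, hT]
    refine (abs_traceIntegral_le hM hS.measure_lt_top.ne _).trans_eq ?_
    rw [Finset.prod_const, Finset.card_univ, Fintype.card_fin, ← mul_pow]
  have h := hasSum_exp_of_newton (a := fredholmCoeff g K)
    (T := fun j => (-1) ^ j * cyclicIntegral g K j) fredholmCoeff_zero hg.le (by positivity) hTle
    (fredholmCoeff_succ hcont hcomp hK)
  convert h using 2
  have hs : Summable fun l : ℕ => (logDetSeries hK hM hS.measure_lt_top.ne l) fun _ => g := by
    refine Summable.of_norm_bounded (g := fun l : ℕ => (1 / 2 : ℝ) ^ l)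
      (summable_geometric_of_lt_one (by norm_num) (by norm_num)) fun l => ?_
    rw [logDetSeries_apply]
    rcases l with _ | l
    · simp
    · rw [← hT, norm_mul, norm_div, norm_pow, norm_neg, norm_one, one_pow, Real.norm_natCast]
      have h3 := hTle l
      rw [abs_mul, abs_pow, abs_neg, abs_one, one_pow, one_mul] at h3
      have h4 : (1 : ℝ) / ((l + 1 : ℕ) : ℝ) ≤ 1 := by
        rw [div_le_one (by positivity)]
        push_cast; linarith [Nat.cast_nonneg (α := ℝ) l]
      calc _ ≤ 1 * (M * volume.real S * ‖g‖) ^ (l + 1) := by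
            gcongr
            exact h3
        _ ≤ _ := by rw [one_mul]; gcongr
  -- The term of degree 0 has coefficient `-1/0`, which is 0 by convention; the series thus starts
  -- with the first trace.
  rw [FormalMultilinearSeries.sum, hs.tsum_eq_zero_add]
  simp only [logDetSeries_apply, Nat.cast_zero, div_zero, zero_mul, zero_add, ← hT]
  refine tsum_congr fun j => ?_
  rw [pow_succ, pow_succ]
  push_cast
  ring

end TraceSeries

/-! ### Cumulants of linear statistics of determinantal processes -/

section LinearStatistic

open scoped BoundedContinuousFunction

theorem exp_smul_sub_one_apply (a : ℝ →ᵇ ℝ) (t x : ℝ) :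
    (NormedSpace.exp (t • a) - 1 : ℝ →ᵇ ℝ) x = Real.exp (t * a x) - 1 := by
  have h1 := (NormedSpace.exp_series_hasSum_exp' (𝕂 := ℝ) (t • a)).mapL
    (BoundedContinuousFunction.evalCLM ℝ x)
  have h2 := NormedSpace.exp_series_hasSum_exp' (𝕂 := ℝ) (t * a x)
  rw [← Real.exp_eq_exp_ℝ] at h2
  have h3 : (NormedSpace.exp (t • a) : ℝ →ᵇ ℝ) x = Real.exp (t * a x) := by
    refine h1.unique ?_
    convert h2 using 2 with n
    simp
  rw [BoundedContinuousFunction.sub_apply, h3]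
  rfl

variable {Ω : Type*} {X : Ω → Set ℝ} {K : ℝ → ℝ → ℝ} {f : ℝ → ℝ}

/-- Points outside the support of `f` contribute 1 to the product and 0 to the sum, so both reduce
to the finite set of points in the support. -/
theorem finprod_one_add_eq_exp (hX : ∀ C : Set ℝ, IsCompact C → ∀ ω, (X ω ∩ C).Finite)
    (hfc : HasCompactSupport f) (t : ℝ) (ω : Ω) :
    ∏ᶠ x ∈ X ω, (1 + ((Real.exp (t * f x) - 1 : ℝ) : ℂ)) =
      ((Real.exp (t * linearStatistic X f ω) : ℝ) : ℂ) := by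
  set T := (hX (tsupport f) hfc ω).toFinset with hT
  have hmem : ∀ x, f x ≠ 0 → (x ∈ X ω ↔ x ∈ T) := by
    intro x hx
    simp only [hT, Set.Finite.mem_toFinset, Set.mem_inter_iff]
    exact ⟨fun h => ⟨h, subset_tsupport f hx⟩, fun h => h.1⟩
  rw [finprod_mem_eq_prod_of_inter_mulSupport_eq (t := T), linearStatistic,
    finsum_mem_eq_sum_of_inter_support_eq (t := T), Finset.mul_sum, Real.exp_sum,
    Complex.ofReal_prod]
  · exact Finset.prod_congr rfl fun x _ => by push_cast; ring
  · ext x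
    simp only [Set.mem_inter_iff, Finset.mem_coe, Function.mem_support]
    exact and_congr_left fun hx => hmem x hx
  · ext x
    simp only [Set.mem_inter_iff, Finset.mem_coe, Function.mem_mulSupport]
    refine and_congr_left fun hx => hmem x fun h0 => hx ?_
    simp [h0]

theorem continuous_exp_mul_sub_one (hf : Continuous f) (t : ℝ) :
    Continuous fun x => Real.exp (t * f x) - 1 := by fun_prop

theorem hasCompactSupport_exp_mul_sub_one (hfc : HasCompactSupport f) (t : ℝ) :
    HasCompactSupport fun x => Real.exp (t * f x) - 1 :=
  HasCompactSupport.intro hfc fun x hx => by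
    have : f x = 0 := image_eq_zero_of_notMem_tsupport hx
    simp [this]

variable [MeasurableSpace Ω] {P : Measure Ω}

theorem IsDeterminantalProcess.integrable_exp (hX : IsDeterminantalProcess P X K)
    (hf : Continuous f) (hfc : HasCompactSupport f) (t : ℝ) :
    Integrable (fun ω => Real.exp (t * linearStatistic X f ω)) P := by
  have h := hX.integrable (fun x => ((Real.exp (t * f x) - 1 : ℝ) : ℂ))
    (Complex.continuous_ofReal.comp (continuous_exp_mul_sub_one hf t))
    ((hasCompactSupport_exp_mul_sub_one hfc t).comp_left Complex.ofReal_zero)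
  simp only [finprod_one_add_eq_exp (fun C hC ω => hX.locallyFinite ω C hC) hfc] at h
  refine h.re.congr (Eventually.of_forall fun ω => ?_)
  exact Complex.ofReal_re _

theorem IsDeterminantalProcess.hasSum_mgf (hX : IsDeterminantalProcess P X K)
    (hf : Continuous f) (hfc : HasCompactSupport f) (t : ℝ) :
    HasSum (fredholmCoeff (fun x => Real.exp (t * f x) - 1) K)
      (mgf (linearStatistic X f) P t) := by
  have h := hX.hasSum (fun x => ((Real.exp (t * f x) - 1 : ℝ) : ℂ))
    (Complex.continuous_ofReal.comp (continuous_exp_mul_sub_one hf t))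
    ((hasCompactSupport_exp_mul_sub_one hfc t).comp_left Complex.ofReal_zero)
  simp only [finprod_one_add_eq_exp (fun C hC ω => hX.locallyFinite ω C hC) hfc,
    ← Complex.ofReal_prod, ← Complex.ofReal_mul, integral_complex_ofReal] at h
  rw [← Complex.hasSum_ofReal]
  rw [mgf]
  convert h using 2 with k
  rw [fredholmCoeff, weightedIntegral]
  push_cast
  rw [one_div, div_eq_inv_mul]
  rfl

/-- The cumulants of a linear statistic in terms of the kernel. -/
theorem IsDeterminantalProcess.cumulant_eq (hX : IsDeterminantalProcess P X K)
    (hK : Continuous fun p : ℝ × ℝ => K p.1 p.2) {M : ℝ} (hM : ∀ x y, |K x y| ≤ M)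
    (hf : Continuous f) (hfc : HasCompactSupport f) (n : ℕ) :
    cumulant P (linearStatistic X f) n = kernelCumulant K f n := by
  obtain ⟨C, hC⟩ := hfc.exists_bound_of_continuous hf
  set a : ℝ →ᵇ ℝ := BoundedContinuousFunction.ofNormedAddCommGroup f hf C hC with ha
  have hax : ∀ x, a x = f x := fun x => rfl
  have hS : IsCompact (tsupport f) := hfc
  set p := logDetSeries hK hM hS.measure_lt_top.ne with hp
  have hF : HasFPowerSeriesAt p.sum p 0 :=
    (p.hasFPowerSeriesOnBall (radius_logDetSeries_pos hK hM _)).hasFPowerSeriesAt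
  have hq : Continuous fun t : ℝ => (NormedSpace.exp (t • a) - 1 : ℝ →ᵇ ℝ) :=
    ((NormedSpace.exp_continuous (𝔸 := ℝ →ᵇ ℝ)).comp
      (continuous_id.smul continuous_const)).sub continuous_const
  -- For small `t` the function `e^{tf} - 1` is small in sup norm and vanishes off the support of
  -- `f`, so the moment generating function is the exponential of the trace series.
  have hev : cgf (linearStatistic X f) P =ᶠ[𝓝 0]
      fun t : ℝ => p.sum (NormedSpace.exp (t • a) - 1) := by
    have ht := hq.tendsto 0
    simp only [zero_smul, NormedSpace.exp_zero, sub_self] at ht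
    filter_upwards [ht.eventually (eventually_hasSum_fredholmCoeff hK hM hS)] with t ht
    have hx : ((NormedSpace.exp (t • a) - 1 : ℝ →ᵇ ℝ) : ℝ → ℝ) =
        fun x => Real.exp (t * f x) - 1 := by
      ext x
      rw [exp_smul_sub_one_apply, hax]
    have h1 := ht fun x hx' => by
      have : f x = 0 := image_eq_zero_of_notMem_tsupport hx'
      rw [hx]; simp [this]
    rw [hx] at h1
    rw [cgf, (hX.hasSum_mgf hf hfc t).unique h1, Real.log_exp]
  rw [cumulant, hev.iteratedDeriv_eq, iteratedDeriv_comp_exp_sub_one hF, kernelCumulant,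
    Finset.mul_sum]
  refine Finset.sum_congr rfl fun c _ => ?_
  -- The factorials `1/m_i!` come from the exponential series and combine with `n!` into the
  -- multinomial coefficient; `(-1)^(ℓ+1)/ℓ` comes from the logarithm.
  rw [logDetSeries_apply, traceIntegral_eq_integral, compTrace, compWeight]
  · have h2 : ∀ x : Fin c.length → ℝ,
        (∏ i, (((c.blocksFun i)! : ℝ)⁻¹ • a ^ c.blocksFun i) (x i)) *
          ∏ i, K (x i) (x (finRotate c.length i)) =
        (∏ i, ((c.blocksFun i)! : ℝ))⁻¹ *
          ∏ i, f (x i) ^ c.blocksFun i * K (x i) (x (finRotate c.length i)) := by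
      intro x
      have h3 : ∏ i, (((c.blocksFun i)! : ℝ)⁻¹ • a ^ c.blocksFun i) (x i) =
          ∏ i, ((c.blocksFun i)! : ℝ)⁻¹ * f (x i) ^ c.blocksFun i := rfl
      rw [h3, Finset.prod_mul_distrib, Finset.prod_mul_distrib, Finset.prod_inv_distrib,
        mul_assoc]
    simp only [h2, integral_const_mul]
    push_cast
    ring
  · intro i x hx
    have h0 : f x = 0 := image_eq_zero_of_notMem_tsupport hx
    change ((c.blocksFun i)! : ℝ)⁻¹ * f x ^ c.blocksFun i = 0
    rw [h0, zero_pow (Nat.one_le_iff_ne_zero.1 (c.one_le_blocksFun i)), mul_zero]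

end LinearStatistic

/-! ### Continuity and boundedness of `L^N`, and the theorem -/

section KernelL

theorem continuous_kernelL (Ψ : ℝ → ℝ) (α τ Γ : ℝ) (η ξ : ℤ → ℝ) (N : ℝ) :
    Continuous fun p : ℝ × ℝ => kernelL Ψ α τ Γ η ξ N p.1 p.2 := by
  unfold kernelL sineKernel
  have := Real.continuous_sinc
  fun_prop

theorem exists_abs_kernelL_le (Ψ : ℝ → ℝ) (α τ Γ : ℝ) (η ξ : ℤ → ℝ) (N : ℝ) :
    ∃ M, ∀ x y, |kernelL Ψ α τ Γ η ξ N x y| ≤ M := by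
  refine ⟨|1 / (τ * N ^ α)| * ∑ k ∈ Finset.Icc (-⌊Γ * N ^ α⌋) ⌊Γ * N ^ α⌋,
    |shapeDensity Ψ ((k + ξ k) / (τ * N ^ α))| * |2 * η k|, fun x y => ?_⟩
  rw [kernelL, abs_mul]
  refine mul_le_mul_of_nonneg_left ((Finset.abs_sum_le_sum_abs _ _).trans
    (Finset.sum_le_sum fun k _ => ?_)) (abs_nonneg _)
  rw [abs_mul, sineKernel, abs_mul]
  exact mul_le_mul_of_nonneg_left
    (mul_le_of_le_one_right (abs_nonneg _) (Real.abs_sinc_le_one _)) (abs_nonneg _)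

end KernelL

theorem mainTheorem7
    (Ψ : ℝ → ℝ) (hΨ : IsShape Ψ)
    (α τ ν β ε : ℝ) (hα : α ∈ Set.Ioo (0 : ℝ) 1) (hτ : 0 < τ) (hν : 0 < ν) (hβ : 0 < β)
    (hε : 0 < ε)
    (Γ : ℝ → ℝ) (η : ℝ → ℤ → ℝ) (hη : GrowthConditions Ψ α τ ν β ε Γ η)
    (ξ : ℝ → ℤ → ℝ) (hξ : ∀ N, 0 < N → IsMeanValueChoice Ψ α τ N (ξ N))
    (f : ℝ → ℝ) (hf : IsH1Compact f)
    (n : ℕ) (hn : 2 ≤ n) :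
    -- the integrals in the limit converge absolutely
    (∀ k < n, Integrable fun x : ℝ =>
      x * shapeDensity Ψ x * Ψ x ^ k * (1 - Ψ x) ^ (n - 1 - k)) ∧
    IntegrableOn (limitIntegrand (Nat.zero_lt_of_lt hn) Ψ f (β * τ)) (limitDomain n) ∧
    -- convergence of the cumulants as expressed through the kernel
    Tendsto (fun N => kernelCumulant (kernelL Ψ α τ (Γ N) (η N) (ξ N) N) f n) atTop
      (𝓝 (limitCumulant (Nat.zero_lt_of_lt hn) Ψ f (β * τ))) ∧
    -- convergence of the cumulants of the linear statistic of the point processes themselves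
    ∀ (Ω : ℝ → Type*) [∀ N, MeasurableSpace (Ω N)] (P : ∀ N, Measure (Ω N))
      [∀ N, IsProbabilityMeasure (P N)] (X : ∀ N, Ω N → Set ℝ),
      (∀ᶠ N in atTop, IsDeterminantalProcess (P N) (X N)
        (kernelL Ψ α τ (Γ N) (η N) (ξ N) N)) →
      (∀ᶠ N in atTop, ∀ t : ℝ,
        Integrable (fun ω => Real.exp (t * linearStatistic (X N) f ω)) (P N)) ∧
      Tendsto (fun N => cumulant (P N) (linearStatistic (X N) f) n) atTop
        (𝓝 (limitCumulant (Nat.zero_lt_of_lt hn) Ψ f (β * τ))) := by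
  obtain ⟨m, rfl⟩ : ∃ m, n = m + 1 := Nat.exists_eq_succ_of_ne_zero (by omega)
  have ht : 0 ≤ β * τ := (mul_pos hβ hτ).le
  have hlim : Tendsto (fun N => kernelCumulant (kernelL Ψ α τ (Γ N) (η N) (ξ N) N) f (m + 1))
      atTop (𝓝 (limitCumulant (Nat.zero_lt_of_lt hn) Ψ f (β * τ))) := by
    have h := GrowthConditions.tendsto_kernelCumulant hΨ hη hα.1 hτ hν hβ hε hξ hf m
      (sum_compWeight hn)
    -- The prelimit cumulants are real, so only the real part of the complex limit has to be
    -- identified.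
    have h2 := (Complex.continuous_re.tendsto _).comp h
    rw [re_sum_eq_limitCumulant hΨ hf ht] at h2
    exact h2
  refine ⟨fun k _ => IsShape.integrable_moment hΨ k _, integrableOn_limitIntegrand hΨ hf ht, hlim, ?_⟩
  intro Ω _ P _ X hX
  refine ⟨hX.mono fun N hN t => hN.integrable_exp hf.continuous hf.compact t, ?_⟩
  refine hlim.congr' (hX.mono fun N hN => ?_)
  obtain ⟨M, hM⟩ := exists_abs_kernelL_le Ψ α τ (Γ N) (η N) (ξ N) N
  exact (hN.cumulant_eq (continuous_kernelL ..) hM hf.continuous hf.compact _).symm
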